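/- **Theorem (elliptic maximum principle).** Let $(M,g)$ be a smooth connected Riemannian manifold without boundary (Hausdorff, with countable base), with Riemannian measure $\mathrm{vol}_g$, and let $\mu=\Psi\,\mathrm{vol}_g$, where $\Psi:M\to(0,\infty)$ is smooth. Let $\rho:M\to(0,\infty)$ and $V:M\to[0,\infty)$ be smooth. A function $f\in L^1_{\mathrm{loc}}(M)$ is identified with the distribution $\varphi\mapsto\int_M f\varphi\,d\mathrm{vol}_g$, and the Schrödinger operator $\mathcal L_{\rho,V}$ acts on distributions by $$\mathcal L_{\rho,V}u=\rho^{-1}\Delta u-\rho^{-1}Vu,\qquad \Delta u=\Psi^{-1}\operatorname{div}(\Psi\nabla u),$$ where $\nabla$ and $\operatorname{div}$ are the distributional gradient and divergence of $(M,g)$. For smooth $\sigma:M\to(0,\infty)$ let $$W^1(M,\sigma)=\{f\in L^2(M,\sigma\mu):\ \nabla f\in \vec L^2(M,\mu)\},\qquad \|f\|_{W^1}=\Big(\int_M|\nabla f|^2\,d\mu+\int_M f^2\sigma\,d\mu\Big)^{1/2},$$ where $\vec L^2(M,\mu)$ is the space of measurable vector fields $X$ on $M$ with $\int_M|X|^2\,d\mu<\infty$,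 and let $W^1_0(M,\sigma)$ be the closure of $C_c^\infty(M)$ in $W^1(M,\sigma)$. Let $f\in W^1(M,\rho+V)$ satisfy $f\ge 0 \mod W^1_0(M,\rho+V)$, i.e. there is $h\in W^1_0(M,\rho+V)$ with $f+h\ge 0$ $\mu$-almost everywhere. If for some $\alpha>0$ the inequality $(\alpha-\mathcal L_{\rho,V})f\ge 0$ holds in the sense of distributions, i.e. $\langle(\alpha-\mathcal L_{\rho,V})f,\varphi\rangle\ge 0$ for all nonnegative $\varphi\in C_c^\infty(M)$, then $f\ge 0$ $\mu$-almost everywhere on $M$. -/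

import Mathlib

open scoped Manifold ContDiff

namespace WeightedManifold

open MeasureTheory

section

variable {n : ℕ} {M : Type*} [TopologicalSpace M] [ChartedSpace (EuclideanSpace ℝ (Fin n)) M]
  [IsManifold (𝓡 n) ∞ M]

/-- Smooth Riemannian metrics on the `n`-dimensional manifold `M` (without boundary). -/
abbrev RiemMetric (n : ℕ) (M : Type*) [TopologicalSpace M]
    [ChartedSpace (EuclideanSpace ℝ (Fin n)) M] [IsManifold (𝓡 n) ∞ M] :=
  Bundle.ContMDiffRiemannianMetric (𝓡 n) ∞ (EuclideanSpace ℝ (Fin n))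
    (fun x : M => TangentSpace (𝓡 n) x)

/-- Vector fields on `M`, without any regularity. -/
abbrev VField (n : ℕ) (M : Type*) [TopologicalSpace M]
    [ChartedSpace (EuclideanSpace ℝ (Fin n)) M] :=
  ∀ x : M, TangentSpace (𝓡 n) x

/-! ### Riemannian volume, gradient, divergence -/

/-- The coefficients `g_ij` of the metric in the chart around `c`, as functions on the chart
target: `g_ij(y) = g(∂_i, ∂_j)` at the point with coordinates `y`. -/
noncomputable def gram (g : RiemMetric n M) (c : M) (y : EuclideanSpace ℝ (Fin n)) :
    Matrix (Fin n) (Fin n) ℝ :=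
  Matrix.of fun i j =>
    g.inner ((extChartAt (𝓡 n) c).symm y)
      (mfderiv (𝓡 n) (𝓡 n) (extChartAt (𝓡 n) c).symm y (EuclideanSpace.single i (1 : ℝ)))
      (mfderiv (𝓡 n) (𝓡 n) (extChartAt (𝓡 n) c).symm y (EuclideanSpace.single j (1 : ℝ)))

/-- The Riemannian volume density `√det (g_ij)` in the chart around `c`. -/
noncomputable def volDensity (g : RiemMetric n M) (c : M) (y : EuclideanSpace ℝ (Fin n)) : ℝ :=
  √ (gram g c y).det

/-- The Riemannian volume of the domain of the chart around `c`, as a measure on `M` that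
vanishes off that domain: the image under the inverse chart of `√det (g_ij) dy`. -/
noncomputable def chartVol [MeasurableSpace M] (g : RiemMetric n M) (c : M) : Measure M :=
  (((volume : Measure (EuclideanSpace ℝ (Fin n))).restrict
      (extChartAt (𝓡 n) c).target).withDensity
        fun y => ENNReal.ofReal (volDensity g c y)).map (extChartAt (𝓡 n) c).symm

/-- The Riemannian volume measure `vol_g`. The measures `chartVol g c` agree on overlaps of
chart domains, so their least upper bound is the measure that restricts to `chartVol g c` on
the domain of the chart around `c`, for every `c`. -/
noncomputable def vol [MeasurableSpace M] (g : RiemMetric n M) : Measure M :=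
  ⨆ c : M, chartVol g c

/-- The measure with density `σ` with respect to `μ`. -/
noncomputable def densityMeasure [MeasurableSpace M] (μ : Measure M) (σ : M → ℝ) : Measure M :=
  μ.withDensity fun x => ENNReal.ofReal (σ x)

/-- The Riemannian gradient: `g(grad φ, v) = dφ(v)` for all tangent vectors `v`. -/
noncomputable def grad (g : RiemMetric n M) (φ : M → ℝ) : VField n M := fun x =>
  (g.inner x).inverse (mfderiv (𝓡 n) 𝓘(ℝ, ℝ) φ x)

theorem apply_inverse_apply {n : ℕ}
    (B : EuclideanSpace ℝ (Fin n) →L[ℝ] EuclideanSpace ℝ (Fin n) →L[ℝ] ℝ)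
    (hB : ∀ v, v ≠ 0 → 0 < B v v) (l : EuclideanSpace ℝ (Fin n) →L[ℝ] ℝ) :
    B (B.inverse l) = l := by
  have hinj : Function.Injective B.toLinearMap := by
    rw [← LinearMap.ker_eq_bot, LinearMap.ker_eq_bot']
    intro v hv
    by_contra hne
    have h := hB v hne
    have hv' : B v = 0 := hv
    simp [hv'] at h
  have hfin : Module.finrank ℝ (EuclideanSpace ℝ (Fin n)) =
      Module.finrank ℝ (EuclideanSpace ℝ (Fin n) →L[ℝ] ℝ) :=
    (InnerProductSpace.toDual ℝ (EuclideanSpace ℝ (Fin n))).toLinearEquiv.finrank_eq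
  have : FiniteDimensional ℝ (EuclideanSpace ℝ (Fin n) →L[ℝ] ℝ) :=
    (InnerProductSpace.toDual ℝ (EuclideanSpace ℝ (Fin n))).toLinearEquiv.finiteDimensional
  let e := (LinearEquiv.ofInjectiveOfFinrankEq B.toLinearMap
    hinj hfin).toContinuousLinearEquiv
  have he : B = (e : EuclideanSpace ℝ (Fin n) →L[ℝ] _) := by
    ext v w
    rfl
  rw [he, ContinuousLinearMap.inverse_equiv]
  exact e.apply_symm_apply l

theorem inner_grad (g : RiemMetric n M) (φ : M → ℝ) (x : M) (v : TangentSpace (𝓡 n) x) :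
    g.inner x (grad g φ x) v = mfderiv (𝓡 n) 𝓘(ℝ, ℝ) φ x v :=
  congrArg (fun l : EuclideanSpace ℝ (Fin n) →L[ℝ] ℝ => l v)
    (apply_inverse_apply (g.inner x) (g.pos x) (mfderiv (𝓡 n) 𝓘(ℝ, ℝ) φ x))

/-- The coordinates of the vector field `Y` in the chart around `c`, as a function on the chart
target with values in `ℝⁿ`. -/
noncomputable def coord (c : M) (Y : VField n M) (y : EuclideanSpace ℝ (Fin n)) :
    EuclideanSpace ℝ (Fin n) :=
  mfderiv (𝓡 n) (𝓡 n) (extChartAt (𝓡 n) c) ((extChartAt (𝓡 n) c).symm y)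
    (Y ((extChartAt (𝓡 n) c).symm y))

/-- The Riemannian divergence `(√det g)⁻¹ ∑ i, ∂_i (√det g Y^i)` of a smooth vector field,
computed at `x` in the chart around `x`. -/
noncomputable def div (g : RiemMetric n M) (Y : VField n M) (x : M) : ℝ :=
  (volDensity g x (extChartAt (𝓡 n) x x))⁻¹ *
    ∑ i : Fin n, fderiv ℝ (fun y => volDensity g x y * coord x Y y i)
      (extChartAt (𝓡 n) x x) (EuclideanSpace.single i (1 : ℝ))

/-! ### Test functions and distributions -/

/-- The test functions `C_c^∞(M)`. -/
def testFunctions (n : ℕ) (M : Type*) [TopologicalSpace M]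
    [ChartedSpace (EuclideanSpace ℝ (Fin n)) M] : Set (M → ℝ) :=
  {φ | ContMDiff (𝓡 n) 𝓘(ℝ, ℝ) ∞ φ ∧ HasCompactSupport φ}

/-- The smooth vector fields of compact support. -/
def testFields (n : ℕ) (M : Type*) [TopologicalSpace M]
    [ChartedSpace (EuclideanSpace ℝ (Fin n)) M] [IsManifold (𝓡 n) ∞ M] : Set (VField n M) :=
  {Y | ContMDiff (𝓡 n) (𝓡 n).tangent ∞ (fun x => (⟨x, Y x⟩ : TangentBundle (𝓡 n) M)) ∧
    IsCompact (closure {x | Y x ≠ 0})}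

/-- The function `f`, identified with the distribution `φ ↦ ∫ f φ dvol_g`. A distribution is
given by its pairing with functions; only its values on test functions matter. -/
noncomputable def toDist [MeasurableSpace M] (g : RiemMetric n M) (f : M → ℝ) : (M → ℝ) → ℝ :=
  fun φ => ∫ x, f x * φ x ∂(vol g)

/-- The vector field `X`, identified with the distributional vector field
`Y ↦ ∫ g(X, Y) dvol_g`. -/
noncomputable def toFieldDist [MeasurableSpace M] (g : RiemMetric n M) (X : VField n M) :
    VField n M → ℝ :=
  fun Y => ∫ x, g.inner x (X x) (Y x) ∂(vol g)

/-- The distributional gradient: `⟨∇u, Y⟩ = -⟨u, div Y⟩`. -/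
noncomputable def distGrad (g : RiemMetric n M) (u : (M → ℝ) → ℝ) : VField n M → ℝ :=
  fun Y => - u (div g Y)

/-- The distributional divergence: `⟨div X, φ⟩ = -⟨X, ∇φ⟩`. -/
noncomputable def distDiv (g : RiemMetric n M) (X : VField n M → ℝ) : (M → ℝ) → ℝ :=
  fun φ => - X (grad g φ)

/-- The product of a distribution with a smooth function: `⟨a u, φ⟩ = ⟨u, a φ⟩`. -/
def mulDist (a : M → ℝ) (u : (M → ℝ) → ℝ) : (M → ℝ) → ℝ :=
  fun φ => u (a * φ)

/-- The product of a distributional vector field with a smooth function. -/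
noncomputable def mulFieldDist (a : M → ℝ) (X : VField n M → ℝ) : VField n M → ℝ :=
  fun Y => X (fun x => a x • Y x)

/-- The weighted Laplacian `Δ u = Ψ⁻¹ div (Ψ ∇u)` on distributions. -/
noncomputable def laplacian (g : RiemMetric n M) (Ψ : M → ℝ) (u : (M → ℝ) → ℝ) : (M → ℝ) → ℝ :=
  mulDist Ψ⁻¹ (distDiv g (mulFieldDist Ψ (distGrad g u)))

/-- The Schrödinger operator `ℒ u = ρ⁻¹ Δ u - ρ⁻¹ V u` on distributions. -/
noncomputable def schrodinger (g : RiemMetric n M) (Ψ ρ V : M → ℝ) (u : (M → ℝ) → ℝ) :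
    (M → ℝ) → ℝ :=
  mulDist ρ⁻¹ (laplacian g Ψ u) - mulDist ρ⁻¹ (mulDist V u)

/-- `0 ≤ u` in the sense of distributions. -/
def DistNonneg (n : ℕ) {M : Type*} [TopologicalSpace M]
    [ChartedSpace (EuclideanSpace ℝ (Fin n)) M] (u : (M → ℝ) → ℝ) : Prop :=
  ∀ φ ∈ testFunctions n M, (∀ x, 0 ≤ φ x) → 0 ≤ u φ

/-! ### Sobolev spaces -/

/-- The weighted measure `μ = Ψ vol_g`. -/
noncomputable def weightedMeasure [MeasurableSpace M] (g : RiemMetric n M) (Ψ : M → ℝ) : Measure M :=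
  densityMeasure (vol g) Ψ

/-- `X` is a measurable vector field (its coordinates in every chart are measurable up to null
sets) with `∫ |X|² dμ < ∞`. -/
def MemVecL2 [MeasurableSpace M] (g : RiemMetric n M) (Ψ : M → ℝ) (X : VField n M) : Prop :=
  (∀ c : M, AEMeasurable
    (fun x => (mfderiv (𝓡 n) (𝓡 n) (extChartAt (𝓡 n) c) x (X x) : EuclideanSpace ℝ (Fin n)))
    ((weightedMeasure g Ψ).restrict (extChartAt (𝓡 n) c).source)) ∧
  Integrable (fun x => g.inner x (X x) (X x)) (weightedMeasure g Ψ)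

/-- The distributional gradient of `f` is the square integrable vector field `X`. -/
def HasL2Grad [MeasurableSpace M] (g : RiemMetric n M) (Ψ : M → ℝ) (f : M → ℝ) (X : VField n M) :
    Prop :=
  MemVecL2 g Ψ X ∧ ∀ Y ∈ testFields n M, distGrad g (toDist g f) Y = toFieldDist g X Y

/-- The Sobolev space `W¹(M, σ) = {f ∈ L²(M, σ μ) | ∇f ∈ L²(M, μ)}` where `μ = Ψ vol_g`. -/
def W1 [MeasurableSpace M] (g : RiemMetric n M) (Ψ σ : M → ℝ) : Set (M → ℝ) :=
  {f | MemLp f 2 (densityMeasure (weightedMeasure g Ψ) σ) ∧ ∃ X, HasL2Grad g Ψ f X}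

open Classical in
/-- The distributional gradient of `f` as a square integrable vector field (unique up to null
sets), for `f` in a Sobolev space. -/
noncomputable def weakGrad [MeasurableSpace M] (g : RiemMetric n M) (Ψ : M → ℝ) (f : M → ℝ) :
    VField n M :=
  if h : ∃ X, HasL2Grad g Ψ f X then h.choose else 0

/-- The norm `(∫ |∇f|² dμ + ∫ f² σ dμ)^(1/2)` of `W¹(M, σ)`. -/
noncomputable def W1norm [MeasurableSpace M] (g : RiemMetric n M) (Ψ σ : M → ℝ) (f : M → ℝ) : ℝ :=
  √ ((∫ x, g.inner x (weakGrad g Ψ f x) (weakGrad g Ψ f x) ∂(weightedMeasure g Ψ)) +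
    ∫ x, f x ^ 2 * σ x ∂(weightedMeasure g Ψ))

/-- `W¹₀(M, σ)`, the closure of `C_c^∞(M)` in `W¹(M, σ)`. -/
def W10 [MeasurableSpace M] (g : RiemMetric n M) (Ψ σ : M → ℝ) : Set (M → ℝ) :=
  {f | f ∈ W1 g Ψ σ ∧ ∀ ε > 0, ∃ φ ∈ testFunctions n M, W1norm g Ψ σ (f - φ) < ε}

/-- `f ≥ 0 mod W¹₀(M, σ)`. -/
def NonnegMod [MeasurableSpace M] (g : RiemMetric n M) (Ψ σ : M → ℝ) (f : M → ℝ) : Prop :=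
  ∃ h ∈ W10 g Ψ σ, ∀ᵐ x ∂(weightedMeasure g Ψ), 0 ≤ f x + h x

end

end WeightedManifold

set_option linter.unusedSectionVars false

namespace WeightedManifold

open MeasureTheory Filter Topology Set

/-! Let q = αρ + V > 0. Testing the differential inequality with Ψρψ removes all weights and gives ∫
(⟨∇f, ∇ψ⟩ + q f ψ) dμ ≥ 0 for every nonnegative test function ψ (`weak_inequality`). The classical
choice of ψ would be the negative part of f. It is replaced by ψ = p(f) r(φ_k): here p is smooth,
bounded and nonincreasing, vanishes on [-ε, ∞) and is positive below -ε; r is a smooth step that is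
0 on (-∞, 0] and 1 on [ε, ∞); and the φ_k are test functions that tend almost everywhere to h, with
∫ |∇φ_k|² dμ ≤ B (`exists_testFunctions_tendsto`). The factor r(φ_k) makes the support compact.

The term p'(f) r(φ_k) |∇f|² is nonpositive and can be dropped. Young's inequality with parameter δ
then bounds 2 ∫ q (-f p(f)) r(φ_k) dμ by δB + δ⁻¹ ∫ p(f)² r'(φ_k)² |∇f|² dμ (`two_mul_integral_le`).
Where p(f) ≠ 0 one has f < -ε, so h ≥ -f > ε, and for large k the value φ_k exceeds ε, whence r(φ_k)
= 1 and r'(φ_k) = 0. Letting k → ∞ at fixed δ leaves 2 ∫ q (-f p(f)) dμ ≤ δB, and δ → 0 shows that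
this integral of a nonnegative function is zero. Hence f ≥ -ε almost everywhere
(`ae_neg_le_of_nonnegMod`), for every ε > 0. Neither the lattice structure of W¹₀ nor weak
compactness is needed.

The technical point is that p(f) r(φ_k) is not smooth. A partition of unity reduces the claim to one
chart, where f is mollified and the inequality passes to the limit
(`exists_contDiff_tendsto_setIntegral`, `truncated_inequality`). This requires that the weak
gradient on M give Euclidean weak derivatives in charts (`HasL2Grad.integral_mul_fderiv`), which in
turn rests on the chart formula for the volume (`vol_restrict_source`) and on the chart independence
of the divergence (`div_eq_chartDiv`). -/

/-- Dominated convergence with a convergent sequence of dominating functions. -/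
theorem _root_.tendsto_integral_of_abs_le_of_tendsto {X : Type*} [MeasurableSpace X] {μ : Measure X}
    {u h : ℕ → X → ℝ} {u₀ h₀ : X → ℝ}
    (hu : ∀ j, AEStronglyMeasurable (u j) μ) (hu₀ : AEStronglyMeasurable u₀ μ)
    (hh : ∀ j, Integrable (h j) μ) (hh₀ : Integrable h₀ μ)
    (hle : ∀ j, ∀ᵐ x ∂μ, |u j x| ≤ h j x)
    (hulim : ∀ᵐ x ∂μ, Tendsto (fun j => u j x) atTop (𝓝 (u₀ x)))
    (hhlim : ∀ᵐ x ∂μ, Tendsto (fun j => h j x) atTop (𝓝 (h₀ x)))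
    (hint : Tendsto (fun j => ∫ x, h j x ∂μ) atTop (𝓝 (∫ x, h₀ x ∂μ))) :
    Tendsto (fun j => ∫ x, u j x ∂μ) atTop (𝓝 (∫ x, u₀ x ∂μ)) := by
  have hle₀ : ∀ᵐ x ∂μ, |u₀ x| ≤ h₀ x := by
    filter_upwards [ae_all_iff.2 hle, hulim, hhlim] with x h1 h2 h3
    exact le_of_tendsto_of_tendsto' h2.abs h3 h1
  have hui : ∀ j, Integrable (u j) μ := fun j => (hh j).mono' (hu j) (hle j)
  have hui₀ : Integrable u₀ μ := hh₀.mono' hu₀ hle₀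
  -- The lower half of the convergence, by Fatou's lemma for the nonnegative functions `h j + w j`.
  -- Applied to `u` and to `-u` it gives both halves.
  have key : ∀ (w : ℕ → X → ℝ) (w₀ : X → ℝ), (∀ j, Integrable (w j) μ) → Integrable w₀ μ →
      (∀ j, ∀ᵐ x ∂μ, |w j x| ≤ h j x) → (∀ᵐ x ∂μ, |w₀ x| ≤ h₀ x) →
      (∀ᵐ x ∂μ, Tendsto (fun j => w j x) atTop (𝓝 (w₀ x))) → ∀ c < ∫ x, w₀ x ∂μ,
      ∀ᶠ j in atTop, c < ∫ x, w j x ∂μ := by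
    intro w w₀ hw hw₀ hwl hwl₀ hwlim c hc
    have hnn : ∀ j, 0 ≤ᵐ[μ] fun x => h j x + w j x := fun j => by
      filter_upwards [hwl j] with x hx
      have := neg_abs_le (w j x)
      simp only [Pi.zero_apply]; linarith
    have hnn₀ : 0 ≤ᵐ[μ] fun x => h₀ x + w₀ x := by
      filter_upwards [hwl₀] with x hx
      have := neg_abs_le (w₀ x)
      simp only [Pi.zero_apply]; linarith
    have hmeas : ∀ j : ℕ, AEMeasurable (fun x => ENNReal.ofReal (h j x + w j x)) μ := fun j =>
      ((hh j).add (hw j)).aestronglyMeasurable.aemeasurable.ennreal_ofReal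
    have hfat := lintegral_liminf_le' (μ := μ) (u := atTop) hmeas
    have heq : ∫⁻ x, liminf (fun j => ENNReal.ofReal (h j x + w j x)) atTop ∂μ =
        ENNReal.ofReal (∫ x, h₀ x + w₀ x ∂μ) := by
      rw [ofReal_integral_eq_lintegral_ofReal (hh₀.fun_add hw₀) hnn₀]
      refine lintegral_congr_ae ?_
      filter_upwards [hwlim, hhlim] with x h1 h2
      exact (ENNReal.tendsto_ofReal (h2.add h1)).liminf_eq
    have heq' : ∀ j, ∫⁻ x, ENNReal.ofReal (h j x + w j x) ∂μ =
        ENNReal.ofReal (∫ x, h j x ∂μ + ∫ x, w j x ∂μ) := fun j => by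
      rw [← integral_add (hh j) (hw j),
        ofReal_integral_eq_lintegral_ofReal ((hh j).fun_add (hw j)) (hnn j)]
    rw [heq] at hfat
    simp only [heq'] at hfat
    rw [integral_add hh₀ hw₀] at hfat
    -- The gap `d - c` absorbs the error made in replacing `∫ h j` by its limit.
    obtain ⟨d, hcd, hd⟩ := exists_between hc
    have hev : ∀ᶠ j in atTop, ∫ x, h j x ∂μ < ∫ x, h₀ x ∂μ + (d - c) :=
      hint.eventually_lt_const (by linarith)
    have hge' : ∀ j, 0 ≤ ∫ x, h j x ∂μ + ∫ x, w j x ∂μ := fun j => by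
      rw [← integral_add (hh j) (hw j)]; exact integral_nonneg_of_ae (hnn j)
    -- `ENNReal.ofReal` loses negative values. If `∫ h₀ + d` is negative, the bound follows already
    -- from `0 ≤ ∫ h j + ∫ w j`.
    by_cases hs : ∫ x, h₀ x ∂μ + d < 0
    · filter_upwards [hev] with j hj
      have := hge' j
      linarith
    · have hlt : ENNReal.ofReal (∫ x, h₀ x ∂μ + d) <
          liminf (fun j => ENNReal.ofReal (∫ x, h j x ∂μ + ∫ x, w j x ∂μ)) atTop :=
        lt_of_lt_of_le ((ENNReal.ofReal_lt_ofReal_iff (by linarith)).2 (by linarith)) hfat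
      filter_upwards [hev, eventually_lt_of_lt_liminf hlt] with j hj hj'
      have := (ENNReal.ofReal_lt_ofReal_iff_of_nonneg (by linarith)).1 hj'
      linarith
  refine tendsto_order.2 ⟨fun c hc => key u u₀ hui hui₀ hle hle₀ hulim c hc, fun c hc => ?_⟩
  have := key (fun j x => - u j x) (fun x => - u₀ x) (fun j => (hui j).neg) hui₀.neg
    (by simpa using hle) (by simpa using hle₀)
    (by filter_upwards [hulim] with x hx using hx.neg) (-c) (by rw [integral_neg]; linarith)
  filter_upwards [this] with j hj
  rw [integral_neg] at hj
  linarith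

/-! ### Mollification in a Euclidean space -/

section Mollify

variable {E : Type*} [NormedAddCommGroup E] [InnerProductSpace ℝ E] [FiniteDimensional ℝ E]
  [MeasurableSpace E] [BorelSpace E]

open ContinuousLinearMap (lsmul)
open scoped Convolution

/-- Jensen's inequality: the normed bump is a probability density, and the variance of `F (x - ·)`
with respect to it is nonnegative. -/
theorem _root_.ContDiffBump.sq_normed_convolution_le (φ : ContDiffBump (0 : E)) {F : E → ℝ}
    (hF : LocallyIntegrable F volume) (hF2 : LocallyIntegrable (fun x => F x ^ 2) volume) (x : E) :
    ((φ.normed volume ⋆[lsmul ℝ ℝ, volume] F) x) ^ 2 ≤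
      (φ.normed volume ⋆[lsmul ℝ ℝ, volume] fun x => F x ^ 2) x := by
  have hφc : Continuous (φ.normed (volume : Measure E)) := φ.continuous_normed
  have h1 := (φ.hasCompactSupport_normed (μ := (volume : Measure E))).convolutionExists_left
    (lsmul ℝ ℝ) hφc hF x
  have h2 := (φ.hasCompactSupport_normed (μ := (volume : Measure E))).convolutionExists_left
    (lsmul ℝ ℝ) hφc hF2 x
  have h0 : Integrable (φ.normed (volume : Measure E)) volume := φ.integrable_normed
  set m := (φ.normed volume ⋆[lsmul ℝ ℝ, volume] F) x with hm
  have h1' : Integrable (fun t => φ.normed volume t * F (x - t)) volume := h1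
  have h2' : Integrable (fun t => φ.normed volume t * F (x - t) ^ 2) volume := h2
  have hnn : 0 ≤ ∫ t, φ.normed volume t * (F (x - t) - m) ^ 2 :=
    integral_nonneg fun t => mul_nonneg (φ.nonneg_normed t) (sq_nonneg _)
  have hexp : ∫ t, φ.normed volume t * (F (x - t) - m) ^ 2 =
      (∫ t, φ.normed volume t * F (x - t) ^ 2) - 2 * m * (∫ t, φ.normed volume t * F (x - t))
        + m ^ 2 * ∫ t, φ.normed volume t := by
    rw [← integral_const_mul, ← integral_const_mul, ← integral_sub h2' (h1'.const_mul _)]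
    refine Eq.trans ?_ (integral_add (h2'.sub (h1'.const_mul (2 * m))) (h0.const_mul (m ^ 2)))
    refine integral_congr_ae (Eventually.of_forall fun t => ?_)
    simp only
    ring
  have e1 : ∫ t, φ.normed volume t * F (x - t) = m := by
    simp [hm, convolution]
  have e2 : ∫ t, φ.normed volume t * F (x - t) ^ 2 =
      (φ.normed volume ⋆[lsmul ℝ ℝ, volume] fun x => F x ^ 2) x := by
    simp [convolution]
  rw [hexp, e1, e2, φ.integral_normed] at hnn
  nlinarith

theorem _root_.ContDiffBump.integral_normed_convolution (φ : ContDiffBump (0 : E)) {F : E → ℝ}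
    (hF : Integrable F volume) :
    ∫ x, (φ.normed volume ⋆[lsmul ℝ ℝ, volume] F) x = ∫ x, F x := by
  rw [integral_convolution (lsmul ℝ ℝ) φ.integrable_normed hF, φ.integral_normed]
  simp

/-- A weak derivative is turned by mollification into the derivative. -/
theorem _root_.ContDiffBump.fderiv_normed_convolution_indicator (φ : ContDiffBump (0 : E)) {T K' : Set E}
    {f D : E → ℝ} {v : E} (hK'T : K' ⊆ T) (hK' : IsCompact K') (hf : IntegrableOn f K' volume)
    (hweak : ∀ u : E → ℝ, ContDiff ℝ ∞ u → HasCompactSupport u → tsupport u ⊆ T →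
      ∫ z, f z * fderiv ℝ u z v = - ∫ z, u z * D z)
    {x : E} (hx : Metric.closedBall x φ.rOut ⊆ K') :
    fderiv ℝ (φ.normed volume ⋆[lsmul ℝ ℝ, volume] K'.indicator f) x v =
      (φ.normed volume ⋆[lsmul ℝ ℝ, volume] K'.indicator D) x := by
  have hloc : LocallyIntegrable (K'.indicator f) volume :=
    ((integrable_indicator_iff hK'.measurableSet).2 hf).locallyIntegrable
  have hcs := φ.hasCompactSupport_normed (μ := (volume : Measure E))
  have hsm : ContDiff ℝ ∞ (φ.normed (volume : Measure E)) := φ.contDiff_normed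
  rw [(hcs.hasFDerivAt_convolution_left (lsmul ℝ ℝ) (hsm.of_le (by simp)) hloc x).fderiv]
  have hex : ConvolutionExistsAt (fderiv ℝ (φ.normed (volume : Measure E))) (K'.indicator f) x
      ((lsmul ℝ ℝ).precompL E) volume :=
    (hcs.fderiv (𝕜 := ℝ)).convolutionExists_left _ (hsm.continuous_fderiv (by simp)) hloc x
  -- The weak derivative is tested with the reflected bump `z ↦ φ (x - z)`. Its support lies in the
  -- closed ball around `x`, hence in `K'`, so the cutoff by `K'` is not felt at `x`. The sign from
  -- the reflection cancels the sign in the weak derivative.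
  have hu : ContDiff ℝ ∞ fun z => φ.normed (volume : Measure E) (x - z) :=
    hsm.comp (contDiff_const.sub contDiff_id)
  have hts : tsupport (fun z => φ.normed (volume : Measure E) (x - z)) ⊆
      Metric.closedBall x φ.rOut := by
    refine closure_minimal (fun z hz => ?_) Metric.isClosed_closedBall
    have hz' : x - z ∈ Function.support (φ.normed (volume : Measure E)) := hz
    rw [φ.support_normed_eq, mem_ball_zero_iff] at hz'
    rw [Metric.mem_closedBall, dist_comm, dist_eq_norm]
    exact hz'.le
  have hucs : HasCompactSupport fun z => φ.normed (volume : Measure E) (x - z) :=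
    (isCompact_closedBall x φ.rOut).of_isClosed_subset (isClosed_tsupport _) hts
  have hw := hweak _ hu hucs (hts.trans (hx.trans hK'T))
  have hder : ∀ z, fderiv ℝ (fun z => φ.normed (volume : Measure E) (x - z)) z v =
      - fderiv ℝ (φ.normed (volume : Measure E)) (x - z) v := fun z => by
    have h1 : HasFDerivAt (fun z : E => x - z) (- ContinuousLinearMap.id ℝ E) z := by
      simpa using (hasFDerivAt_id z).const_sub x
    have h2 := ((hsm.differentiable (by simp)) (x - z)).hasFDerivAt.comp z h1
    have h3 := h2.fderiv
    simp only [Function.comp_def] at h3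
    rw [h3]
    simp
  have hzero : ∀ z, z ∉ K' → φ.normed (volume : Measure E) (x - z) = 0 := fun z hz =>
    image_eq_zero_of_notMem_tsupport (f := fun z => φ.normed (volume : Measure E) (x - z))
      fun h => hz (hx (hts h))
  have hzero' : ∀ z, z ∉ K' →
      fderiv ℝ (fun z => φ.normed (volume : Measure E) (x - z)) z = 0 := fun z hz =>
    image_eq_zero_of_notMem_tsupport fun h => hz (hx (hts (tsupport_fderiv_subset ℝ h)))
  have e1 : (fderiv ℝ (φ.normed (volume : Measure E)) ⋆[(lsmul ℝ ℝ).precompL E, volume]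
      K'.indicator f) x v = ∫ z, fderiv ℝ (φ.normed (volume : Measure E)) (x - z) v *
        K'.indicator f z := by
    rw [convolution_eq_swap, ContinuousLinearMap.integral_apply hex.integrable_swap]
    rfl
  rw [e1, convolution_eq_swap]
  have e2 : ∀ z, fderiv ℝ (φ.normed (volume : Measure E)) (x - z) v * K'.indicator f z =
      - (f z * fderiv ℝ (fun z => φ.normed (volume : Measure E) (x - z)) z v) := fun z => by
    by_cases hz : z ∈ K'
    · rw [indicator_of_mem hz, hder]; ring
    · rw [indicator_of_notMem hz, hzero' z hz]; simp
  have e3 : ∀ z, lsmul ℝ ℝ (φ.normed (volume : Measure E) (x - z)) (K'.indicator D z) =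
      φ.normed (volume : Measure E) (x - z) * D z := fun z => by
    by_cases hz : z ∈ K'
    · rw [indicator_of_mem hz]; rfl
    · rw [hzero z hz]; simp
  simp only [e2, e3, integral_neg, hw, neg_neg]

/-- Truncations `p ∘ f` of a function `f` with square integrable weak derivatives `D i` may be
approximated by `p ∘ f j` with `f j` smooth, in the sense of weak convergence of `p ∘ f j` and of
its first derivatives. -/
theorem _root_.exists_contDiff_tendsto_setIntegral {ι : Type*} [Fintype ι] {T K : Set E} (hT : IsOpen T)
    (hK : IsCompact K) (hKT : K ⊆ T) {f : E → ℝ} {D : ι → E → ℝ} (v : ι → E)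
    (hf : ∀ L ⊆ T, IsCompact L → IntegrableOn f L volume)
    (hD : ∀ i, ∀ L ⊆ T, IsCompact L → MemLp (D i) 2 (volume.restrict L))
    (hweak : ∀ i, ∀ u : E → ℝ, ContDiff ℝ ∞ u → HasCompactSupport u → tsupport u ⊆ T →
      ∫ z, f z * fderiv ℝ u z (v i) = - ∫ z, u z * D i z)
    {p p' : ℝ → ℝ} (hp : Continuous p) (hp' : Continuous p') {C : ℝ} (hpC : ∀ t, |p t| ≤ C)
    (hpC' : ∀ t, |p' t| ≤ C) {a : E → ℝ} {b : ι → E → ℝ} (ha : IntegrableOn a K volume)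
    (hb : ∀ i, MemLp (b i) 2 (volume.restrict K)) :
    ∃ F : ℕ → E → ℝ, (∀ j, ContDiff ℝ ∞ (F j)) ∧
      Tendsto (fun j => ∫ y in K, (p' (F j y) * ∑ i, fderiv ℝ (F j) y (v i) * b i y) +
        p (F j y) * a y) atTop
      (𝓝 (∫ y in K, (p' (f y) * ∑ i, D i y * b i y) + p (f y) * a y)) := by
  -- A margin around `K`: mollifiers of radius at most `δ` see only values on the compact set `K' ⊆
  -- T` when evaluated on `K`.
  obtain ⟨δ, hδ, hδT⟩ := hK.exists_cthickening_subset_open hT hKT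
  set K' := Metric.cthickening δ K with hK'
  have hK'c : IsCompact K' := hK.cthickening
  have hKK' : K ⊆ K' := Metric.self_subset_cthickening K
  have hC : 0 ≤ C := (abs_nonneg _).trans (hpC 0)
  have hfi : Integrable (K'.indicator f) volume :=
    (integrable_indicator_iff hK'c.measurableSet).2 (hf _ hδT hK'c)
  have hDm : ∀ i, MemLp (K'.indicator (D i)) 2 volume := fun i =>
    (memLp_indicator_iff_restrict hK'c.measurableSet).2 (hD i _ hδT hK'c)
  have hDi : ∀ i, Integrable (K'.indicator (D i)) volume := fun i => by
    rw [integrable_indicator_iff hK'c.measurableSet]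
    have : IsFiniteMeasure (volume.restrict K') := ⟨by simpa using hK'c.measure_lt_top⟩
    exact (hD i _ hδT hK'c).integrable (by norm_num)
  have hD2 : ∀ i, Integrable (fun y => K'.indicator (D i) y ^ 2) volume := fun i =>
    (hDm i).integrable_sq
  -- The outer radii tend to zero while the ratio of outer to inner radius stays 2; a bounded ratio
  -- is what almost everywhere convergence of the mollifications requires.
  let φ : ℕ → ContDiffBump (0 : E) := fun j =>
    ⟨δ / (j + 1) / 2, δ / (j + 1), by positivity, half_lt_self (by positivity)⟩
  have hφ0 : Tendsto (fun j => (φ j).rOut) atTop (𝓝 0) := by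
    have := (tendsto_const_div_atTop_nhds_zero_nat δ).comp (tendsto_add_atTop_nat 1)
    refine this.congr fun j => ?_
    simp [φ]
  have hφδ : ∀ j, (φ j).rOut ≤ δ := fun j => by
    simp only [φ]
    exact div_le_self hδ.le (by linarith [(Nat.cast_nonneg j : (0 : ℝ) ≤ j)])
  have hφ2 : ∀ᶠ j in atTop, (φ j).rOut ≤ 2 * (φ j).rIn :=
    Eventually.of_forall fun j => by simp only [φ]; linarith
  have hball : ∀ j, ∀ x ∈ K, Metric.closedBall x (φ j).rOut ⊆ K' := fun j x hx =>
    (Metric.closedBall_subset_closedBall (hφδ j)).trans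
      (Metric.closedBall_subset_cthickening hx δ)
  set F : ℕ → E → ℝ := fun j => (φ j).normed volume ⋆[lsmul ℝ ℝ, volume] K'.indicator f with hFdef
  have hFsm : ∀ j, ContDiff ℝ ∞ (F j) := fun j =>
    ((φ j).hasCompactSupport_normed (μ := (volume : Measure E))).contDiff_convolution_left
      (lsmul ℝ ℝ) (φ j).contDiff_normed hfi.locallyIntegrable
  set G : ι → ℕ → E → ℝ := fun i j =>
    (φ j).normed volume ⋆[lsmul ℝ ℝ, volume] K'.indicator (D i) with hGdef
  set H : ι → ℕ → E → ℝ := fun i j =>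
    (φ j).normed volume ⋆[lsmul ℝ ℝ, volume] fun y => K'.indicator (D i) y ^ 2 with hHdef
  have hGe : ∀ i j, ∀ x ∈ K, fderiv ℝ (F j) x (v i) = G i j x := fun i j x hx =>
    (φ j).fderiv_normed_convolution_indicator hδT hK'c (hf _ hδT hK'c) (hweak i) (hball j x hx)
  have hFlim : ∀ᵐ x, Tendsto (fun j => F j x) atTop (𝓝 (K'.indicator f x)) :=
    ContDiffBump.ae_convolution_tendsto_right_of_locallyIntegrable hφ0 hφ2
      hfi.locallyIntegrable
  have hGlim : ∀ᵐ x, ∀ i, Tendsto (fun j => G i j x) atTop (𝓝 (K'.indicator (D i) x)) :=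
    ae_all_iff.2 fun i =>
    ContDiffBump.ae_convolution_tendsto_right_of_locallyIntegrable hφ0 hφ2
      (hDi i).locallyIntegrable
  have hHlim : ∀ᵐ x, ∀ i, Tendsto (fun j => H i j x) atTop (𝓝 (K'.indicator (D i) x ^ 2)) :=
    ae_all_iff.2 fun i =>
    ContDiffBump.ae_convolution_tendsto_right_of_locallyIntegrable hφ0 hφ2
      (hD2 i).locallyIntegrable
  have hGH : ∀ i j x, G i j x ^ 2 ≤ H i j x := fun i j x =>
    (φ j).sq_normed_convolution_le (hDi i).locallyIntegrable (hD2 i).locallyIntegrable x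
  have hHi : ∀ i j, Integrable (H i j) volume := fun i j =>
    (φ j).integrable_normed.integrable_convolution (lsmul ℝ ℝ) (hD2 i)
  have hHint : ∀ i j, ∫ x, H i j x = ∫ x, K'.indicator (D i) x ^ 2 := fun i j =>
    (φ j).integral_normed_convolution (hD2 i)
  have hbm : ∀ i, MemLp (K.indicator (b i)) 2 volume := fun i =>
    (memLp_indicator_iff_restrict hK.measurableSet).2 (hb i)
  have ham : Integrable (K.indicator a) volume := (integrable_indicator_iff hK.measurableSet).2 ha
  have hmain : Tendsto (fun j => ∫ y, (p' (F j y) * ∑ i, G i j y * K.indicator (b i) y) +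
        p (F j y) * K.indicator a y) atTop
      (𝓝 (∫ y, (p' (K'.indicator f y) * ∑ i, K'.indicator (D i) y * K.indicator (b i) y) +
        p (K'.indicator f y) * K.indicator a y)) := by
    have hdi : ∀ i, Integrable (fun y => K.indicator (b i) y ^ 2) volume := fun i =>
      (hbm i).integrable_sq
    have hGc : ∀ i j, Continuous (G i j) := fun i j =>
      (((φ j).hasCompactSupport_normed (μ := (volume : Measure E))).contDiff_convolution_left
        (n := ⊤) (lsmul ℝ ℝ) (φ j).contDiff_normed (hDi i).locallyIntegrable).continuous
    -- No fixed dominating function is at hand for the mollified derivatives `G i j`. Instead `|G b|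
    -- ≤ G² + b² ≤ H + b²`, where `H i j` is the mollification of the square of `D i`: it converges
    -- almost everywhere, and its integral does not depend on `j`.
    refine tendsto_integral_of_abs_le_of_tendsto
      (h := fun j y => (C * ∑ i, (H i j y + K.indicator (b i) y ^ 2)) + C * |K.indicator a y|)
      (h₀ := fun y => (C * ∑ i, (K'.indicator (D i) y ^ 2 + K.indicator (b i) y ^ 2)) +
        C * |K.indicator a y|) ?_ ?_ ?_ ?_ ?_ ?_ ?_ ?_
    · intro j
      refine ((hp'.comp (hFsm j).continuous).aestronglyMeasurable.mul
        (Finset.aestronglyMeasurable_fun_sum _ fun i _ =>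
          (hGc i j).aestronglyMeasurable.mul (hbm i).1)).add
        ((hp.comp (hFsm j).continuous).aestronglyMeasurable.mul ham.1)
    · refine ((hp'.comp_aestronglyMeasurable hfi.1).mul
        (Finset.aestronglyMeasurable_fun_sum _ fun i _ => (hDm i).1.mul (hbm i).1)).add
        ((hp.comp_aestronglyMeasurable hfi.1).mul ham.1)
    · intro j
      exact ((integrable_finsetSum _ fun i _ => (hHi i j).add (hdi i)).const_mul C).add
        (ham.abs.const_mul C)
    · exact ((integrable_finsetSum _ fun i _ => (hD2 i).add (hdi i)).const_mul C).add
        (ham.abs.const_mul C)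
    · refine fun j => Eventually.of_forall fun y => (abs_add_le _ _).trans (add_le_add ?_ ?_)
      · rw [abs_mul]
        refine mul_le_mul (hpC' _) ((Finset.abs_sum_le_sum_abs _ _).trans
          (Finset.sum_le_sum fun i _ => ?_)) (abs_nonneg _) hC
        have h1 := hGH i j y
        refine abs_le.2 ⟨?_, ?_⟩ <;>
          nlinarith [sq_nonneg (G i j y + K.indicator (b i) y),
            sq_nonneg (G i j y - K.indicator (b i) y), sq_nonneg (G i j y),
            sq_nonneg (K.indicator (b i) y)]
      · rw [abs_mul]
        exact mul_le_mul_of_nonneg_right (hpC _) (abs_nonneg _)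
    · filter_upwards [hFlim, hGlim] with y h1 h2
      exact (((hp'.tendsto _).comp h1).mul (tendsto_finsetSum _ fun i _ =>
        (h2 i).mul_const _)).add (((hp.tendsto _).comp h1).mul_const _)
    · filter_upwards [hHlim] with y h1
      exact ((tendsto_finsetSum _ fun i _ => (h1 i).add_const _).const_mul _).add_const _
    -- Mollification preserves the integral, so the integrals of the dominating functions form a
    -- constant sequence.
    · refine Eq.subst (motive := fun s => Tendsto s atTop _) ?_ tendsto_const_nhds
      funext j
      rw [integral_add (((integrable_finsetSum _ fun i _ => (hHi i j).fun_add (hdi i)).const_mul C))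
        (ham.abs.const_mul C), integral_add
        (((integrable_finsetSum _ fun i _ => (hD2 i).fun_add (hdi i)).const_mul C))
        (ham.abs.const_mul C), integral_const_mul, integral_const_mul, integral_const_mul,
        integral_finsetSum _ fun i _ => (hHi i j).fun_add (hdi i),
        integral_finsetSum _ fun i _ => (hD2 i).fun_add (hdi i)]
      congr 2
      refine Finset.sum_congr rfl fun i _ => ?_
      rw [integral_add (hHi i j) (hdi i), integral_add (hD2 i) (hdi i), hHint]
  refine ⟨F, hFsm, ?_⟩
  have e1 : ∀ j, ∫ y in K, (p' (F j y) * ∑ i, fderiv ℝ (F j) y (v i) * b i y) +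
        p (F j y) * a y = ∫ y, (p' (F j y) * ∑ i, G i j y * K.indicator (b i) y) +
        p (F j y) * K.indicator a y := fun j => by
    rw [← integral_indicator hK.measurableSet]
    refine integral_congr_ae (Eventually.of_forall fun y => ?_)
    by_cases hy : y ∈ K
    · simp only [indicator_of_mem hy, hGe _ j y hy]
    · simp [indicator_of_notMem hy]
  have e2 : ∫ y in K, (p' (f y) * ∑ i, D i y * b i y) + p (f y) * a y =
      ∫ y, (p' (K'.indicator f y) * ∑ i, K'.indicator (D i) y * K.indicator (b i) y) +
        p (K'.indicator f y) * K.indicator a y := by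
    rw [← integral_indicator hK.measurableSet]
    refine integral_congr_ae (Eventually.of_forall fun y => ?_)
    by_cases hy : y ∈ K
    · simp only [indicator_of_mem hy, indicator_of_mem (hKK' hy)]
    · simp [indicator_of_notMem hy]
  rw [e2]
  simpa only [e1] using hmain

end Mollify

section

variable {n : ℕ} {M : Type*} [TopologicalSpace M] [ChartedSpace (EuclideanSpace ℝ (Fin n)) M]
  [IsManifold (𝓡 n) ∞ M]

/-! ### Derivatives of charts -/

theorem contMDiffOn_extChartAt_symm' (c : M) :
    ContMDiffOn (𝓡 n) (𝓡 n) ∞ (extChartAt (𝓡 n) c).symm (extChartAt (𝓡 n) c).target :=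
  contMDiffOn_extChartAt_symm c

theorem contMDiffOn_extChartAt_source (c : M) :
    ContMDiffOn (𝓡 n) (𝓡 n) ∞ (extChartAt (𝓡 n) c) (extChartAt (𝓡 n) c).source := by
  rw [extChartAt_source]
  exact contMDiffOn_extChartAt

theorem mdifferentiableAt_extChartAt_source {c x : M} (hx : x ∈ (extChartAt (𝓡 n) c).source) :
    MDifferentiableAt (𝓡 n) (𝓡 n) (extChartAt (𝓡 n) c) x :=
  (((contMDiffOn_extChartAt_source c) x hx).contMDiffAt
    ((isOpen_extChartAt_source c).mem_nhds hx)).mdifferentiableAt (by simp)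

theorem mdifferentiableAt_extChartAt_symm {c : M} {y : EuclideanSpace ℝ (Fin n)}
    (hy : y ∈ (extChartAt (𝓡 n) c).target) :
    MDifferentiableAt (𝓡 n) (𝓡 n) (extChartAt (𝓡 n) c).symm y :=
  (((contMDiffOn_extChartAt_symm' c) y hy).contMDiffAt
    ((isOpen_extChartAt_target c).mem_nhds hy)).mdifferentiableAt (by simp)

/-- The derivative of the chart around `c` inverts the derivative of its inverse. -/
theorem mfderiv_extChartAt_symm_apply {c x : M} (hx : x ∈ (extChartAt (𝓡 n) c).source)
    (v : TangentSpace (𝓡 n) x) :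
    mfderiv (𝓡 n) (𝓡 n) (extChartAt (𝓡 n) c).symm (extChartAt (𝓡 n) c x)
      (mfderiv (𝓡 n) (𝓡 n) (extChartAt (𝓡 n) c) x v) = v := by
  have hy := (extChartAt (𝓡 n) c).map_source hx
  have h1 := mfderiv_comp x (mdifferentiableAt_extChartAt_symm hy)
    (mdifferentiableAt_extChartAt_source hx)
  have h2 : mfderiv (𝓡 n) (𝓡 n) ((extChartAt (𝓡 n) c).symm ∘ extChartAt (𝓡 n) c) x =
      ContinuousLinearMap.id ℝ (TangentSpace (𝓡 n) x) := by
    refine ((hasMFDerivAt_id (I := 𝓡 n) x).congr_of_eventuallyEq ?_).mfderiv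
    filter_upwards [(isOpen_extChartAt_source c).mem_nhds hx] with z hz
    exact ((extChartAt (𝓡 n) c).left_inv hz)
  have h3 := congrArg (fun l => l v) (h1.symm.trans h2)
  exact h3

theorem mfderiv_extChartAt_apply_symm {c : M} {y : EuclideanSpace ℝ (Fin n)}
    (hy : y ∈ (extChartAt (𝓡 n) c).target) (v : EuclideanSpace ℝ (Fin n)) :
    mfderiv (𝓡 n) (𝓡 n) (extChartAt (𝓡 n) c) ((extChartAt (𝓡 n) c).symm y)
      (mfderiv (𝓡 n) (𝓡 n) (extChartAt (𝓡 n) c).symm y v) = v := by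
  have hx := (extChartAt (𝓡 n) c).map_target hy
  have h1 := mfderiv_comp y (mdifferentiableAt_extChartAt_source hx)
    (mdifferentiableAt_extChartAt_symm hy)
  have h2 : mfderiv (𝓡 n) (𝓡 n) (extChartAt (𝓡 n) c ∘ (extChartAt (𝓡 n) c).symm) y =
      ContinuousLinearMap.id ℝ (TangentSpace (𝓡 n) y) := by
    refine ((hasMFDerivAt_id (I := 𝓡 n) y).congr_of_eventuallyEq ?_).mfderiv
    filter_upwards [(isOpen_extChartAt_target c).mem_nhds hy] with z hz
    exact ((extChartAt (𝓡 n) c).right_inv hz)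
  have h3 := congrArg (fun l => l v) (h1.symm.trans h2)
  exact h3

theorem mfderiv_extChartAt_symm_coord {c : M} {y : EuclideanSpace ℝ (Fin n)}
    (hy : y ∈ (extChartAt (𝓡 n) c).target) (Y : VField n M) :
    mfderiv (𝓡 n) (𝓡 n) (extChartAt (𝓡 n) c).symm y (coord c Y y) =
      Y ((extChartAt (𝓡 n) c).symm y) := by
  have h := mfderiv_extChartAt_symm_apply ((extChartAt (𝓡 n) c).map_target hy)
    (Y ((extChartAt (𝓡 n) c).symm y))
  rw [(extChartAt (𝓡 n) c).right_inv hy] at h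
  exact h

theorem fderiv_comp_extChartAt_symm {c : M} {y : EuclideanSpace ℝ (Fin n)}
    (hy : y ∈ (extChartAt (𝓡 n) c).target) {φ : M → ℝ}
    (hφ : MDifferentiableAt (𝓡 n) 𝓘(ℝ, ℝ) φ ((extChartAt (𝓡 n) c).symm y))
    (v : EuclideanSpace ℝ (Fin n)) :
    fderiv ℝ (φ ∘ (extChartAt (𝓡 n) c).symm) y v =
      mfderiv (𝓡 n) 𝓘(ℝ, ℝ) φ ((extChartAt (𝓡 n) c).symm y)
        (mfderiv (𝓡 n) (𝓡 n) (extChartAt (𝓡 n) c).symm y v) := by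
  have h1 := mfderiv_comp y hφ (mdifferentiableAt_extChartAt_symm hy)
  rw [← mfderiv_eq_fderiv, h1]
  rfl

theorem mfderiv_eq_fderiv_coord {c : M} {y : EuclideanSpace ℝ (Fin n)}
    (hy : y ∈ (extChartAt (𝓡 n) c).target) {φ : M → ℝ}
    (hφ : MDifferentiableAt (𝓡 n) 𝓘(ℝ, ℝ) φ ((extChartAt (𝓡 n) c).symm y)) (Y : VField n M) :
    mfderiv (𝓡 n) 𝓘(ℝ, ℝ) φ ((extChartAt (𝓡 n) c).symm y) (Y ((extChartAt (𝓡 n) c).symm y)) =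
      fderiv ℝ (φ ∘ (extChartAt (𝓡 n) c).symm) y (coord c Y y) := by
  rw [fderiv_comp_extChartAt_symm hy hφ, mfderiv_extChartAt_symm_coord hy]

theorem contDiffOn_comp_extChartAt_symm {φ : M → ℝ} {c : M} {k : ℕ∞ω} (hk : k ≤ ∞)
    (hφ : ContMDiffOn (𝓡 n) 𝓘(ℝ, ℝ) k φ (extChartAt (𝓡 n) c).source) :
    ContDiffOn ℝ k (φ ∘ (extChartAt (𝓡 n) c).symm) (extChartAt (𝓡 n) c).target :=
  contMDiffOn_iff_contDiffOn.1
    (hφ.comp ((contMDiffOn_extChartAt_symm' c).of_le hk) fun _ hy => (extChartAt (𝓡 n) c).map_target hy)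

/-- On the domain of a chart the trivialization of the tangent bundle is the derivative of the
chart, so smoothness of a section can be checked on its coordinates. -/
theorem contMDiffOn_section_iff (c : M) (Y : VField n M) :
    ContMDiffOn (𝓡 n) (𝓡 n).tangent ∞ (fun x => (⟨x, Y x⟩ : TangentBundle (𝓡 n) M))
      (extChartAt (𝓡 n) c).source ↔
    ContDiffOn ℝ ∞ (coord c Y) (extChartAt (𝓡 n) c).target := by
  have h := (trivializationAt (EuclideanSpace ℝ (Fin n)) (TangentSpace (𝓡 n)) c
    ).contMDiffOn_section_baseSet_iff (IB := 𝓡 n) (n := ∞) (s := Y)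
  have hb : (trivializationAt (EuclideanSpace ℝ (Fin n)) (TangentSpace (𝓡 n)) c).baseSet =
      (extChartAt (𝓡 n) c).source := by
    rw [TangentBundle.trivializationAt_baseSet, extChartAt_source]
  rw [hb] at h
  have he : ∀ x ∈ (extChartAt (𝓡 n) c).source,
      (trivializationAt (EuclideanSpace ℝ (Fin n)) (TangentSpace (𝓡 n)) c
        (⟨x, Y x⟩ : TangentBundle (𝓡 n) M)).2 =
      mfderiv (𝓡 n) (𝓡 n) (extChartAt (𝓡 n) c) x (Y x) := fun x hx => by
    have hx' : x ∈ (chartAt (EuclideanSpace ℝ (Fin n)) c).source := by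
      rwa [extChartAt_source] at hx
    have h1 := (trivializationAt (EuclideanSpace ℝ (Fin n)) (TangentSpace (𝓡 n)) c
      ).continuousLinearMapAt_apply_of_mem ℝ (b := x) (by rw [hb]; exact hx) (Y x)
    exact h1.symm.trans (congrArg (fun l => l (Y x))
      (TangentBundle.continuousLinearMapAt_trivializationAt (I := 𝓡 n) hx'))
  refine h.trans ((contMDiffOn_congr he).trans ⟨fun H => ?_, fun H => ?_⟩)
  · exact contMDiffOn_iff_contDiffOn.1
      (H.comp (contMDiffOn_extChartAt_symm' c) fun _ hy => (extChartAt (𝓡 n) c).map_target hy)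
  · have H' := (contMDiffOn_iff_contDiffOn.2 H).comp (contMDiffOn_extChartAt_source c)
      fun _ hx => (extChartAt (𝓡 n) c).map_source hx
    refine H'.congr fun x hx => ?_
    simp only [Function.comp_def, coord]
    rw [(extChartAt (𝓡 n) c).left_inv hx]

theorem contDiffOn_coord (c : M) {Y : VField n M} (hY : ContMDiff (𝓡 n) (𝓡 n).tangent ∞
      (fun x => (⟨x, Y x⟩ : TangentBundle (𝓡 n) M))) :
    ContDiffOn ℝ ∞ (coord c Y) (extChartAt (𝓡 n) c).target :=
  (contMDiffOn_section_iff c Y).1 hY.contMDiffOn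

/-! ### The metric in a chart -/

/-- The coordinate vector field of the chart around `c` with constant coordinates `v`. -/
noncomputable def chartField (c : M) (v : EuclideanSpace ℝ (Fin n)) : VField n M := fun x =>
  mfderiv (𝓡 n) (𝓡 n) (extChartAt (𝓡 n) c).symm (extChartAt (𝓡 n) c x) v

theorem coord_chartField {c : M} {y : EuclideanSpace ℝ (Fin n)}
    (hy : y ∈ (extChartAt (𝓡 n) c).target) (v : EuclideanSpace ℝ (Fin n)) :
    coord c (chartField c v) y = v := by
  have h := mfderiv_extChartAt_apply_symm hy v
  simp only [coord, chartField]
  rw [(extChartAt (𝓡 n) c).right_inv hy]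
  exact h

theorem contMDiffOn_chartField (c : M) (v : EuclideanSpace ℝ (Fin n)) :
    ContMDiffOn (𝓡 n) (𝓡 n).tangent ∞
      (fun x => (⟨x, chartField c v x⟩ : TangentBundle (𝓡 n) M)) (extChartAt (𝓡 n) c).source :=
  (contMDiffOn_section_iff c _).2 (contDiffOn_const.congr fun _ hy => coord_chartField hy v)

theorem contMDiffOn_inner (g : RiemMetric n M) {X Y : VField n M} {s : Set M}
    (hX : ContMDiffOn (𝓡 n) (𝓡 n).tangent ∞
      (fun x => (⟨x, X x⟩ : TangentBundle (𝓡 n) M)) s)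
    (hY : ContMDiffOn (𝓡 n) (𝓡 n).tangent ∞
      (fun x => (⟨x, Y x⟩ : TangentBundle (𝓡 n) M)) s) :
    ContMDiffOn (𝓡 n) 𝓘(ℝ, ℝ) ∞ (fun x => g.inner x (X x) (Y x)) s := by
  intro x hx
  have : ContMDiffWithinAt (𝓡 n) ((𝓡 n).prod 𝓘(ℝ)) ∞
      (fun m ↦ Bundle.TotalSpace.mk' ℝ (E := Bundle.Trivial M ℝ) m (g.inner m (X m) (Y m)))
      s x := by
    apply ContMDiffWithinAt.clm_bundle_apply₂ (F₁ := EuclideanSpace ℝ (Fin n))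
      (F₂ := EuclideanSpace ℝ (Fin n))
    · exact (g.contMDiff x).contMDiffWithinAt
    · exact hX x hx
    · exact hY x hx
  simp only [Bundle.contMDiffWithinAt_totalSpace] at this
  exact this.2

theorem gram_eq (g : RiemMetric n M) {c : M} {y : EuclideanSpace ℝ (Fin n)}
    (hy : y ∈ (extChartAt (𝓡 n) c).target) (i j : Fin n) :
    gram g c y i j = g.inner ((extChartAt (𝓡 n) c).symm y)
      (chartField c (EuclideanSpace.single i 1) ((extChartAt (𝓡 n) c).symm y))
      (chartField c (EuclideanSpace.single j 1) ((extChartAt (𝓡 n) c).symm y)) := by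
  simp only [gram, chartField, Matrix.of_apply]
  rw [(extChartAt (𝓡 n) c).right_inv hy]

theorem contDiffOn_gram (g : RiemMetric n M) (c : M) (i j : Fin n) :
    ContDiffOn ℝ ∞ (fun y => gram g c y i j) (extChartAt (𝓡 n) c).target :=
  (contDiffOn_comp_extChartAt_symm le_rfl (contMDiffOn_inner g (contMDiffOn_chartField c _)
    (contMDiffOn_chartField c _))).congr fun _ hy => gram_eq g hy i j

/-- The metric in coordinates. -/
theorem inner_mfderiv_symm (g : RiemMetric n M) (c : M) (y v w : EuclideanSpace ℝ (Fin n)) :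
    g.inner ((extChartAt (𝓡 n) c).symm y)
      (mfderiv (𝓡 n) (𝓡 n) (extChartAt (𝓡 n) c).symm y v)
      (mfderiv (𝓡 n) (𝓡 n) (extChartAt (𝓡 n) c).symm y w) =
    ∑ i, ∑ j, v i * w j * gram g c y i j := by
  let A : EuclideanSpace ℝ (Fin n) →L[ℝ] EuclideanSpace ℝ (Fin n) :=
    mfderiv (𝓡 n) (𝓡 n) (extChartAt (𝓡 n) c).symm y
  let B : EuclideanSpace ℝ (Fin n) →L[ℝ] EuclideanSpace ℝ (Fin n) →L[ℝ] ℝ :=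
    g.inner ((extChartAt (𝓡 n) c).symm y)
  change B (A v) (A w) = ∑ i, ∑ j, v i * w j *
    B (A (EuclideanSpace.single i 1)) (A (EuclideanSpace.single j 1))
  have hexp : ∀ u : EuclideanSpace ℝ (Fin n),
      u = ∑ i, u i • EuclideanSpace.single i (1 : ℝ) := fun u => by
    simpa using ((EuclideanSpace.basisFun (Fin n) ℝ).sum_repr u).symm
  conv_lhs => rw [hexp v, hexp w]
  simp only [map_sum, map_smul, sum_apply, smul_apply,
    smul_eq_mul, Finset.mul_sum]
  rw [Finset.sum_comm]
  refine Finset.sum_congr rfl fun i _ => Finset.sum_congr rfl fun j _ => ?_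
  ring

/-- The derivative of the inverse chart has a left inverse, so it sends a nonzero coordinate vector
to a nonzero tangent vector, on which the metric is positive. -/
theorem posDef_gram (g : RiemMetric n M) {c : M} {y : EuclideanSpace ℝ (Fin n)}
    (hy : y ∈ (extChartAt (𝓡 n) c).target) : (gram g c y).PosDef := by
  refine Matrix.PosDef.of_dotProduct_mulVec_pos ?_ fun v hv => ?_
  · ext i j
    simp only [Matrix.conjTranspose_apply, star_trivial, gram, Matrix.of_apply]
    exact g.symm _ _ _
  · have h := inner_mfderiv_symm g c y (WithLp.toLp 2 v) (WithLp.toLp 2 v)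
    have hne : mfderiv (𝓡 n) (𝓡 n) (extChartAt (𝓡 n) c).symm y (WithLp.toLp 2 v) ≠ 0 := by
      intro h0
      have h1 := mfderiv_extChartAt_apply_symm hy (WithLp.toLp 2 v)
      rw [h0] at h1
      have h2 := (map_zero (mfderiv (𝓡 n) (𝓡 n) (extChartAt (𝓡 n) c)
        ((extChartAt (𝓡 n) c).symm y))).symm.trans h1
      exact hv (congrArg (WithLp.ofLp) h2.symm)
    have h2 := g.pos _ _ hne
    rw [h] at h2
    simpa [dotProduct, Matrix.mulVec, Finset.mul_sum, mul_assoc, mul_comm, mul_left_comm] using h2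

theorem det_gram_pos (g : RiemMetric n M) {c : M} {y : EuclideanSpace ℝ (Fin n)}
    (hy : y ∈ (extChartAt (𝓡 n) c).target) : 0 < (gram g c y).det :=
  (posDef_gram g hy).det_pos

theorem contDiffOn_det {F : Type*} [NormedAddCommGroup F] [NormedSpace ℝ F] {m : ℕ} {k : ℕ∞ω}
    {A : F → Matrix (Fin m) (Fin m) ℝ} {s : Set F}
    (hA : ∀ i j, ContDiffOn ℝ k (fun y => A y i j) s) : ContDiffOn ℝ k (fun y => (A y).det) s := by
  simp only [Matrix.det_apply']
  exact ContDiffOn.sum fun σ _ => contDiffOn_const.mul (contDiffOn_prod fun i _ => hA _ _)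

theorem volDensity_pos (g : RiemMetric n M) {c : M} {y : EuclideanSpace ℝ (Fin n)}
    (hy : y ∈ (extChartAt (𝓡 n) c).target) : 0 < volDensity g c y :=
  Real.sqrt_pos.2 (det_gram_pos g hy)

theorem contDiffOn_volDensity (g : RiemMetric n M) (c : M) :
    ContDiffOn ℝ ∞ (volDensity g c) (extChartAt (𝓡 n) c).target :=
  (contDiffOn_det fun i j => contDiffOn_gram g c i j).sqrt fun _ hy => (det_gram_pos g hy).ne'

end

section

variable {n : ℕ} {M : Type*} [TopologicalSpace M] [ChartedSpace (EuclideanSpace ℝ (Fin n)) M]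
  [IsManifold (𝓡 n) ∞ M]

/-! ### Smoothness of the gradient -/

/-- Cramer's rule: the entries of the adjugate are determinants of matrices in which one row has
been replaced by a constant one. -/
theorem contDiffOn_matrix_inv {F : Type*} [NormedAddCommGroup F] [NormedSpace ℝ F] {m : ℕ}
    {k : ℕ∞ω} {A : F → Matrix (Fin m) (Fin m) ℝ} {s : Set F}
    (hA : ∀ i j, ContDiffOn ℝ k (fun y => A y i j) s) (hdet : ∀ y ∈ s, (A y).det ≠ 0)
    (i j : Fin m) : ContDiffOn ℝ k (fun y => (A y)⁻¹ i j) s := by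
  simp only [Matrix.inv_def, Matrix.smul_apply, Ring.inverse_eq_inv', smul_eq_mul,
    Matrix.adjugate_apply]
  refine ((contDiffOn_det hA).inv hdet).mul (contDiffOn_det fun a b => ?_)
  by_cases h : a = j
  · subst h
    simp only [Matrix.updateRow_self]
    exact contDiffOn_const
  · simp only [Matrix.updateRow_ne h]
    exact hA a b

/-- The coordinate vector `u` of the gradient, as a row, satisfies `u * gram = dφ`; multiplication
by the inverse Gram matrix solves for `u`. -/
theorem coord_grad (g : RiemMetric n M) {c : M} {y : EuclideanSpace ℝ (Fin n)}
    (hy : y ∈ (extChartAt (𝓡 n) c).target) {φ : M → ℝ}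
    (hφ : MDifferentiableAt (𝓡 n) 𝓘(ℝ, ℝ) φ ((extChartAt (𝓡 n) c).symm y)) (i : Fin n) :
    coord c (grad g φ) y i = ∑ j, fderiv ℝ (φ ∘ (extChartAt (𝓡 n) c).symm) y
      (EuclideanSpace.single j 1) * (gram g c y)⁻¹ j i := by
  set u := coord c (grad g φ) y with hu
  have h1 : ∀ j, fderiv ℝ (φ ∘ (extChartAt (𝓡 n) c).symm) y (EuclideanSpace.single j 1) =
      Matrix.vecMul u.ofLp (gram g c y) j := fun j => by
    have h := inner_mfderiv_symm g c y u (EuclideanSpace.single j 1)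
    rw [hu, mfderiv_extChartAt_symm_coord hy (grad g φ), inner_grad, ← hu] at h
    rw [fderiv_comp_extChartAt_symm hy hφ]
    refine h.trans ?_
    simp [Matrix.vecMul, dotProduct]
  have h2 : Matrix.vecMul (Matrix.vecMul u.ofLp (gram g c y)) (gram g c y)⁻¹ = u.ofLp := by
    rw [Matrix.vecMul_vecMul, Matrix.mul_nonsing_inv _ (isUnit_iff_ne_zero.2
      (det_gram_pos g hy).ne'), Matrix.vecMul_one]
  rw [← congrFun h2 i]
  simp only [h1]
  rfl

theorem contMDiff_section_of_coord {Y : VField n M}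
    (h : ∀ c, ContDiffOn ℝ ∞ (coord c Y) (extChartAt (𝓡 n) c).target) :
    ContMDiff (𝓡 n) (𝓡 n).tangent ∞ (fun x => (⟨x, Y x⟩ : TangentBundle (𝓡 n) M)) := fun x =>
  ((contMDiffOn_section_iff x Y).2 (h x)).contMDiffAt (extChartAt_source_mem_nhds x)

theorem contMDiff_grad (g : RiemMetric n M) {φ : M → ℝ} (hφ : ContMDiff (𝓡 n) 𝓘(ℝ, ℝ) ∞ φ) :
    ContMDiff (𝓡 n) (𝓡 n).tangent ∞
      (fun x => (⟨x, grad g φ x⟩ : TangentBundle (𝓡 n) M)) := by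
  refine contMDiff_section_of_coord fun c => ?_
  rw [contDiffOn_euclidean]
  intro i
  refine ContDiffOn.congr ?_ fun y hy => coord_grad g hy ((hφ _).mdifferentiableAt (by simp)) i
  refine ContDiffOn.sum fun j _ => ContDiffOn.mul ?_ ?_
  · exact ((contDiffOn_comp_extChartAt_symm le_rfl hφ.contMDiffOn).fderiv_of_isOpen
      (isOpen_extChartAt_target c) (by simp)).clm_apply contDiffOn_const
  · exact contDiffOn_matrix_inv (fun i j => contDiffOn_gram g c i j)
      (fun y hy => (det_gram_pos g hy).ne') j i

theorem grad_eq_zero_of_notMem_tsupport (g : RiemMetric n M) {φ : M → ℝ} {x : M}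
    (hx : x ∉ tsupport φ) : grad g φ x = 0 := by
  have h : φ =ᶠ[𝓝 x] fun _ => (0 : ℝ) := notMem_tsupport_iff_eventuallyEq.1 hx
  have h' : mfderiv (𝓡 n) 𝓘(ℝ, ℝ) φ x = 0 :=
    ((hasMFDerivAt_const (0 : ℝ) x).congr_of_eventuallyEq h).mfderiv
  exact (congrArg (g.inner x).inverse h').trans (map_zero _)

/-! ### Constructions of test functions and test fields -/

theorem coord_smul (c : M) (h : M → ℝ) (Y : VField n M) (y : EuclideanSpace ℝ (Fin n)) :
    coord c (fun x => h x • Y x) y = h ((extChartAt (𝓡 n) c).symm y) • coord c Y y :=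
  map_smul (mfderiv (𝓡 n) (𝓡 n) (extChartAt (𝓡 n) c) ((extChartAt (𝓡 n) c).symm y)) _ _

/-- Near a point outside `U` the product is the zero section, which is smooth, so `Y` may behave
arbitrarily there. -/
theorem contMDiff_smul_of_tsupport_subset {h : M → ℝ} {Y : VField n M} {U : Set M}
    (hU : IsOpen U) (hh : ContMDiff (𝓡 n) 𝓘(ℝ, ℝ) ∞ h) (hhU : tsupport h ⊆ U)
    (hY : ContMDiffOn (𝓡 n) (𝓡 n).tangent ∞
      (fun x => (⟨x, Y x⟩ : TangentBundle (𝓡 n) M)) U) :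
    ContMDiff (𝓡 n) (𝓡 n).tangent ∞
      (fun x => (⟨x, h x • Y x⟩ : TangentBundle (𝓡 n) M)) := by
  intro x
  by_cases hx : x ∈ U
  · exact (hh.contMDiffOn.smul_section hY).contMDiffAt (hU.mem_nhds hx)
  · have h0 : ContMDiffAt (𝓡 n) (𝓡 n).tangent ∞
        (fun x => (⟨x, 0⟩ : TangentBundle (𝓡 n) M)) x :=
      (Bundle.contMDiff_zeroSection ℝ (TangentSpace (𝓡 n) (M := M))) x
    refine h0.congr_of_eventuallyEq ?_
    filter_upwards [notMem_tsupport_iff_eventuallyEq.1 fun hx' => hx (hhU hx')] with z hz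
    rw [hz]
    simp

theorem smul_mem_testFields [T2Space M] {h : M → ℝ} {Y : VField n M} {U : Set M}
    (hU : IsOpen U) (hh : h ∈ testFunctions n M) (hhU : tsupport h ⊆ U)
    (hY : ContMDiffOn (𝓡 n) (𝓡 n).tangent ∞
      (fun x => (⟨x, Y x⟩ : TangentBundle (𝓡 n) M)) U) :
    (fun x => h x • Y x) ∈ testFields n M := by
  refine ⟨contMDiff_smul_of_tsupport_subset hU hh.1 hhU hY, ?_⟩
  refine IsCompact.closure_of_subset hh.2 fun x hx => subset_tsupport _ fun h0 => hx ?_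
  simp only [h0, zero_smul]

theorem smul_grad_mem_testFields [T2Space M] (g : RiemMetric n M) {Ψ φ : M → ℝ}
    (hΨ : ContMDiff (𝓡 n) 𝓘(ℝ, ℝ) ∞ Ψ) (hφ : φ ∈ testFunctions n M) :
    (fun x => Ψ x • grad g φ x) ∈ testFields n M := by
  refine ⟨hΨ.smul_section (contMDiff_grad g hφ.1), ?_⟩
  refine IsCompact.closure_of_subset hφ.2 fun x hx => ?_
  by_contra h0
  exact hx (by simp only [grad_eq_zero_of_notMem_tsupport g h0, smul_zero])

/-- A function on the chart target, transported to `M` and extended by zero. -/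
noncomputable def chartExtend (c : M) (u : EuclideanSpace ℝ (Fin n) → ℝ) : M → ℝ :=
  (extChartAt (𝓡 n) c).source.indicator (u ∘ extChartAt (𝓡 n) c)

theorem chartExtend_of_mem {c x : M} (hx : x ∈ (extChartAt (𝓡 n) c).source)
    (u : EuclideanSpace ℝ (Fin n) → ℝ) : chartExtend c u x = u (extChartAt (𝓡 n) c x) :=
  indicator_of_mem hx _

theorem chartExtend_symm {c : M} {y : EuclideanSpace ℝ (Fin n)}
    (hy : y ∈ (extChartAt (𝓡 n) c).target) (u : EuclideanSpace ℝ (Fin n) → ℝ) :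
    chartExtend c u ((extChartAt (𝓡 n) c).symm y) = u y := by
  rw [chartExtend_of_mem ((extChartAt (𝓡 n) c).map_target hy), (extChartAt (𝓡 n) c).right_inv hy]

theorem isCompact_image_extChartAt_symm {c : M} {K : Set (EuclideanSpace ℝ (Fin n))}
    (hK : IsCompact K) (hKc : K ⊆ (extChartAt (𝓡 n) c).target) :
    IsCompact ((extChartAt (𝓡 n) c).symm '' K) :=
  hK.image_of_continuousOn ((continuousOn_extChartAt_symm c).mono hKc)

theorem image_extChartAt_symm_subset {c : M} {K : Set (EuclideanSpace ℝ (Fin n))}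
    (hKc : K ⊆ (extChartAt (𝓡 n) c).target) :
    (extChartAt (𝓡 n) c).symm '' K ⊆ (extChartAt (𝓡 n) c).source := by
  rintro _ ⟨y, hy, rfl⟩
  exact (extChartAt (𝓡 n) c).map_target (hKc hy)

theorem tsupport_chartExtend_subset [T2Space M] {c : M} {u : EuclideanSpace ℝ (Fin n) → ℝ}
    (hu : HasCompactSupport u) (huc : tsupport u ⊆ (extChartAt (𝓡 n) c).target) :
    tsupport (chartExtend c u) ⊆ (extChartAt (𝓡 n) c).symm '' tsupport u := by
  refine closure_minimal (fun x hx => ?_) (isCompact_image_extChartAt_symm hu huc).isClosed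
  have hxS : x ∈ (extChartAt (𝓡 n) c).source := by
    by_contra h
    exact hx (indicator_of_notMem h _)
  refine ⟨extChartAt (𝓡 n) c x, subset_tsupport _ fun h0 => hx ?_,
    (extChartAt (𝓡 n) c).left_inv hxS⟩
  rw [chartExtend_of_mem hxS, h0]

theorem contMDiff_of_tsupport_subset {h : M → ℝ} {U : Set M} (hU : IsOpen U)
    (hh : ContMDiffOn (𝓡 n) 𝓘(ℝ, ℝ) ∞ h U) (hhU : tsupport h ⊆ U) :
    ContMDiff (𝓡 n) 𝓘(ℝ, ℝ) ∞ h :=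
  contMDiff_of_tsupport fun _ hx => hh.contMDiffAt (hU.mem_nhds (hhU hx))

theorem chartExtend_mem_testFunctions [T2Space M] {c : M} {u : EuclideanSpace ℝ (Fin n) → ℝ}
    (hu : ContDiffOn ℝ ∞ u (extChartAt (𝓡 n) c).target) (hucs : HasCompactSupport u)
    (huc : tsupport u ⊆ (extChartAt (𝓡 n) c).target) :
    chartExtend c u ∈ testFunctions n M := by
  have hsub := tsupport_chartExtend_subset hucs huc
  refine ⟨contMDiff_of_tsupport_subset (isOpen_extChartAt_source c) ?_
    (hsub.trans (image_extChartAt_symm_subset huc)), ?_⟩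
  · exact ((contMDiffOn_iff_contDiffOn.2 hu).comp (contMDiffOn_extChartAt_source c)
      fun _ hx => (extChartAt (𝓡 n) c).map_source hx).congr fun x hx => chartExtend_of_mem hx u
  · exact (isCompact_image_extChartAt_symm hucs huc).of_isClosed_subset (isClosed_tsupport _) hsub

end

section

variable {n : ℕ} {M : Type*} [TopologicalSpace M] [ChartedSpace (EuclideanSpace ℝ (Fin n)) M]
  [IsManifold (𝓡 n) ∞ M]

/-! ### The Riemannian volume in a chart -/

/-- The transition map between two charts. -/
noncomputable def transition (c c' : M) (y : EuclideanSpace ℝ (Fin n)) :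
    EuclideanSpace ℝ (Fin n) :=
  extChartAt (𝓡 n) c' ((extChartAt (𝓡 n) c).symm y)

theorem fderiv_transition_apply {c c' : M} {y : EuclideanSpace ℝ (Fin n)}
    (hy : y ∈ (extChartAt (𝓡 n) c).target)
    (hy' : (extChartAt (𝓡 n) c).symm y ∈ (extChartAt (𝓡 n) c').source)
    (v : EuclideanSpace ℝ (Fin n)) :
    fderiv ℝ (transition c c') y v =
      mfderiv (𝓡 n) (𝓡 n) (extChartAt (𝓡 n) c') ((extChartAt (𝓡 n) c).symm y)
        (mfderiv (𝓡 n) (𝓡 n) (extChartAt (𝓡 n) c).symm y v) := by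
  have h1 := mfderiv_comp y (mdifferentiableAt_extChartAt_source hy')
    (mdifferentiableAt_extChartAt_symm hy)
  rw [← mfderiv_eq_fderiv]
  exact congrArg (fun l => l v) h1

theorem differentiableAt_transition {c c' : M} {y : EuclideanSpace ℝ (Fin n)}
    (hy : y ∈ (extChartAt (𝓡 n) c).target)
    (hy' : (extChartAt (𝓡 n) c).symm y ∈ (extChartAt (𝓡 n) c').source) :
    DifferentiableAt ℝ (transition c c') y :=
  mdifferentiableAt_iff_differentiableAt.1 ((mdifferentiableAt_extChartAt_source hy').comp y
    (mdifferentiableAt_extChartAt_symm hy))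

theorem mfderiv_symm_transition {c c' : M} {y : EuclideanSpace ℝ (Fin n)}
    (hy : y ∈ (extChartAt (𝓡 n) c).target)
    (hy' : (extChartAt (𝓡 n) c).symm y ∈ (extChartAt (𝓡 n) c').source)
    (v : EuclideanSpace ℝ (Fin n)) :
    mfderiv (𝓡 n) (𝓡 n) (extChartAt (𝓡 n) c').symm (transition c c' y)
      (fderiv ℝ (transition c c') y v) =
      mfderiv (𝓡 n) (𝓡 n) (extChartAt (𝓡 n) c).symm y v := by
  rw [fderiv_transition_apply hy hy']
  exact mfderiv_extChartAt_symm_apply hy' _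

/-- The Jacobian `J` of the transition map expresses one coordinate frame in the other at the same
point of `M`, so the Gram matrices are congruent by `J`. Taking determinants, the volume densities
differ by `|det J|`. -/
theorem gram_transition (g : RiemMetric n M) {c c' : M} {y : EuclideanSpace ℝ (Fin n)}
    (hy : y ∈ (extChartAt (𝓡 n) c).target)
    (hy' : (extChartAt (𝓡 n) c).symm y ∈ (extChartAt (𝓡 n) c').source) :
    gram g c y = (LinearMap.toMatrix (EuclideanSpace.basisFun (Fin n) ℝ).toBasis
        (EuclideanSpace.basisFun (Fin n) ℝ).toBasis
        (fderiv ℝ (transition c c') y).toLinearMap).transpose * gram g c' (transition c c' y) *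
      LinearMap.toMatrix (EuclideanSpace.basisFun (Fin n) ℝ).toBasis
        (EuclideanSpace.basisFun (Fin n) ℝ).toBasis
        (fderiv ℝ (transition c c') y).toLinearMap := by
  ext i j
  have h := inner_mfderiv_symm g c' (transition c c' y)
    (fderiv ℝ (transition c c') y (EuclideanSpace.single i 1))
    (fderiv ℝ (transition c c') y (EuclideanSpace.single j 1))
  rw [mfderiv_symm_transition hy hy', mfderiv_symm_transition hy hy'] at h
  have hx : (extChartAt (𝓡 n) c').symm (transition c c' y) = (extChartAt (𝓡 n) c).symm y :=
    (extChartAt (𝓡 n) c').left_inv hy'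
  rw [hx] at h
  refine (Eq.trans (by rfl) h).trans ?_
  simp only [Matrix.mul_apply, Matrix.transpose_apply, LinearMap.toMatrix_apply,
    OrthonormalBasis.coe_toBasis, EuclideanSpace.basisFun_apply,
    OrthonormalBasis.coe_toBasis_repr_apply, EuclideanSpace.basisFun_repr, Finset.sum_mul]
  rw [Finset.sum_comm]
  refine Finset.sum_congr rfl fun k _ => Finset.sum_congr rfl fun l _ => ?_
  simp only [ContinuousLinearMap.coe_coe]
  ring

theorem volDensity_transition (g : RiemMetric n M) {c c' : M} {y : EuclideanSpace ℝ (Fin n)}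
    (hy : y ∈ (extChartAt (𝓡 n) c).target)
    (hy' : (extChartAt (𝓡 n) c).symm y ∈ (extChartAt (𝓡 n) c').source) :
    volDensity g c y = |(fderiv ℝ (transition c c') y).det| *
      volDensity g c' (transition c c' y) := by
  have hd : (fderiv ℝ (transition c c') y).det =
      (LinearMap.toMatrix (EuclideanSpace.basisFun (Fin n) ℝ).toBasis
        (EuclideanSpace.basisFun (Fin n) ℝ).toBasis
        (fderiv ℝ (transition c c') y).toLinearMap).det := (LinearMap.det_toMatrix _ _).symm
  rw [volDensity, gram_transition g hy hy', Matrix.det_mul, Matrix.det_mul,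
    Matrix.det_transpose, ← hd, volDensity, ← Real.sqrt_sq_eq_abs, ← Real.sqrt_mul (sq_nonneg _)]
  congr 1
  ring

variable [MeasurableSpace M] [BorelSpace M]

theorem aemeasurable_extChartAt_symm (c : M) :
    AEMeasurable (extChartAt (𝓡 n) c).symm
      ((volume : Measure (EuclideanSpace ℝ (Fin n))).restrict (extChartAt (𝓡 n) c).target) :=
  (continuousOn_extChartAt_symm c).aemeasurable (isOpen_extChartAt_target c).measurableSet

theorem volDensity_nonneg (g : RiemMetric n M) (c : M) (y : EuclideanSpace ℝ (Fin n)) :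
    0 ≤ volDensity g c y :=
  Real.sqrt_nonneg _

theorem aemeasurable_volDensity (g : RiemMetric n M) (c : M) :
    AEMeasurable (volDensity g c)
      ((volume : Measure (EuclideanSpace ℝ (Fin n))).restrict (extChartAt (𝓡 n) c).target) :=
  (contDiffOn_volDensity g c).continuousOn.aemeasurable (isOpen_extChartAt_target c).measurableSet

theorem chartVol_apply (g : RiemMetric n M) (c : M) {A : Set M} (hA : MeasurableSet A) :
    chartVol g c A = ∫⁻ y in (extChartAt (𝓡 n) c).target ∩ (extChartAt (𝓡 n) c).symm ⁻¹' A,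
      ENNReal.ofReal (volDensity g c y) := by
  have hs := (aemeasurable_extChartAt_symm (n := n) c).nullMeasurableSet_preimage hA
  rw [chartVol, Measure.map_apply_of_aemeasurable
    ((aemeasurable_extChartAt_symm (n := n) c).mono_ac (withDensity_absolutelyContinuous _ _)) hA,
    withDensity_apply₀ _ hs, Measure.restrict_restrict₀ hs, inter_comm]

/-- The change of variables formula for the transition map; the Jacobian factor is exactly the ratio
of the two volume densities. -/
theorem chartVol_eq_of_subset (g : RiemMetric n M) (c c' : M) {A : Set M} (hA : MeasurableSet A)
    (hAc : A ⊆ (extChartAt (𝓡 n) c).source) (hAc' : A ⊆ (extChartAt (𝓡 n) c').source) :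
    chartVol g c A = chartVol g c' A := by
  rw [chartVol_apply g c hA, chartVol_apply g c' hA]
  set B := (extChartAt (𝓡 n) c).target ∩ (extChartAt (𝓡 n) c).symm ⁻¹' A with hB
  have hBm : MeasurableSet B := by
    -- The inverse chart is controlled only on the target, so for measurability of `B` it is
    -- replaced off the target by a constant.
    obtain ⟨u, hu, hu'⟩ : ∃ u : EuclideanSpace ℝ (Fin n) → M, Measurable u ∧
        EqOn u (extChartAt (𝓡 n) c).symm (extChartAt (𝓡 n) c).target := by
      classical
      have : Nonempty M := ⟨c⟩
      exact ⟨(extChartAt (𝓡 n) c).target.piecewise (extChartAt (𝓡 n) c).symm (fun _ => c),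
        (continuousOn_extChartAt_symm c).measurable_piecewise continuous_const.continuousOn
          (isOpen_extChartAt_target c).measurableSet, piecewise_eqOn _ _ _⟩
    have : B = (extChartAt (𝓡 n) c).target ∩ u ⁻¹' A := by
      ext y
      simp only [hB, mem_inter_iff, mem_preimage]
      exact and_congr_right fun hy => by rw [hu' hy]
    rw [this]
    exact (isOpen_extChartAt_target c).measurableSet.inter (hu hA)
  have himg : transition c c' '' B =
      (extChartAt (𝓡 n) c').target ∩ (extChartAt (𝓡 n) c').symm ⁻¹' A := by
    ext z
    constructor
    · rintro ⟨y, hy, rfl⟩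
      refine ⟨(extChartAt (𝓡 n) c').map_source (hAc' hy.2), ?_⟩
      rw [mem_preimage, transition, (extChartAt (𝓡 n) c').left_inv (hAc' hy.2)]
      exact hy.2
    · rintro ⟨hz, hzA⟩
      refine ⟨extChartAt (𝓡 n) c ((extChartAt (𝓡 n) c').symm z),
        ⟨(extChartAt (𝓡 n) c).map_source (hAc hzA), ?_⟩, ?_⟩
      · rw [mem_preimage, (extChartAt (𝓡 n) c).left_inv (hAc hzA)]
        exact hzA
      · rw [transition, (extChartAt (𝓡 n) c).left_inv (hAc hzA),
          (extChartAt (𝓡 n) c').right_inv hz]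
  have hinj : InjOn (transition c c') B := fun y hy z hz h => by
    have h1 := (extChartAt (𝓡 n) c').injOn (hAc' hy.2) (hAc' hz.2) h
    exact (extChartAt (𝓡 n) c).symm.injOn hy.1 hz.1 h1
  have hder : ∀ y ∈ B, HasFDerivWithinAt (transition c c') (fderiv ℝ (transition c c') y) B y :=
    fun y hy => (differentiableAt_transition hy.1 (hAc' hy.2)).hasFDerivAt.hasFDerivWithinAt
  rw [← himg, lintegral_image_eq_lintegral_abs_det_fderiv_mul volume hBm hder hinj]
  refine setLIntegral_congr_fun hBm fun y hy => ?_
  rw [volDensity_transition g hy.1 (hAc' hy.2), ENNReal.ofReal_mul (abs_nonneg _)]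

theorem chartVol_compl_source (g : RiemMetric n M) (c : M) :
    chartVol g c (extChartAt (𝓡 n) c).sourceᶜ = 0 := by
  rw [chartVol_apply g c (isOpen_extChartAt_source c).measurableSet.compl]
  have : (extChartAt (𝓡 n) c).target ∩ (extChartAt (𝓡 n) c).symm ⁻¹'
      (extChartAt (𝓡 n) c).sourceᶜ = ∅ := by
    ext y
    simp only [mem_inter_iff, mem_preimage, mem_compl_iff, mem_empty_iff_false, iff_false, not_and,
      not_not]
    exact fun hy => (extChartAt (𝓡 n) c).map_target hy
  rw [this]
  simp

/-- The Riemannian volume restricts to `chartVol g c` on the domain of the chart around `c`. -/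
theorem vol_restrict_source (g : RiemMetric n M) (c : M) :
    (vol g).restrict (extChartAt (𝓡 n) c).source = chartVol g c := by
  have hS : MeasurableSet (extChartAt (𝓡 n) c).source :=
    (isOpen_extChartAt_source c).measurableSet
  have hself : (chartVol g c).restrict (extChartAt (𝓡 n) c).source = chartVol g c :=
    Measure.restrict_eq_self_of_ae_mem (chartVol_compl_source g c)
  refine le_antisymm ?_ ?_
  · have hle : vol g ≤ chartVol g c +
        (⊤ : Measure M).restrict (extChartAt (𝓡 n) c).sourceᶜ := by
      refine iSup_le fun c' => Measure.le_iff.2 fun A hA => ?_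
      rw [Measure.add_apply, Measure.restrict_apply hA, ← measure_inter_add_sdiff A hS]
      refine add_le_add ?_ ((le_top : chartVol g c' ≤ ⊤) _)
      have hS' : MeasurableSet (extChartAt (𝓡 n) c').source :=
        (isOpen_extChartAt_source c').measurableSet
      rw [← measure_inter_add_sdiff (A ∩ (extChartAt (𝓡 n) c).source) hS',
        measure_mono_null (s := _ \ _) (fun x hx => hx.2) (chartVol_compl_source g c'), add_zero,
        chartVol_eq_of_subset g c' c ((hA.inter hS).inter hS') (fun x hx => hx.2)
          (fun x hx => hx.1.2)]
      exact measure_mono fun x hx => hx.1.1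
    refine (Measure.restrict_mono subset_rfl hle).trans ?_
    rw [Measure.restrict_add, hself, Measure.restrict_restrict hS, inter_compl_self,
      Measure.restrict_empty, add_zero]
  · conv_lhs => rw [← hself]
    exact Measure.restrict_mono subset_rfl (le_iSup (fun c => chartVol g c) c)

theorem map_symm_withDensity (g : RiemMetric n M) (c : M) :
    (((volume : Measure (EuclideanSpace ℝ (Fin n))).restrict
      (extChartAt (𝓡 n) c).target).withDensity
        fun y => ENNReal.ofReal (volDensity g c y)).map (extChartAt (𝓡 n) c).symm =
      (vol g).restrict (extChartAt (𝓡 n) c).source :=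
  (vol_restrict_source g c).symm

theorem aemeasurable_extChartAt_symm_withDensity (g : RiemMetric n M) (c : M) :
    AEMeasurable (extChartAt (𝓡 n) c).symm
      (((volume : Measure (EuclideanSpace ℝ (Fin n))).restrict
      (extChartAt (𝓡 n) c).target).withDensity
        fun y => ENNReal.ofReal (volDensity g c y)) :=
  (aemeasurable_extChartAt_symm c).mono_ac (withDensity_absolutelyContinuous _ _)

theorem map_vol_restrict_source (g : RiemMetric n M) (c : M) :
    ((vol g).restrict (extChartAt (𝓡 n) c).source).map (extChartAt (𝓡 n) c) =
      ((volume : Measure (EuclideanSpace ℝ (Fin n))).restrict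
      (extChartAt (𝓡 n) c).target).withDensity
        fun y => ENNReal.ofReal (volDensity g c y) := by
  have hm : AEMeasurable (extChartAt (𝓡 n) c)
      ((vol g).restrict (extChartAt (𝓡 n) c).source) :=
    (continuousOn_extChartAt c).aemeasurable (isOpen_extChartAt_source c).measurableSet
  rw [← map_symm_withDensity] at hm ⊢
  rw [AEMeasurable.map_map_of_aemeasurable hm (aemeasurable_extChartAt_symm_withDensity g c)]
  refine (Measure.map_congr ?_).trans Measure.map_id
  refine (withDensity_absolutelyContinuous _ _).ae_le ?_
  filter_upwards [ae_restrict_mem (isOpen_extChartAt_target c).measurableSet] with y hy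
  exact (extChartAt (𝓡 n) c).right_inv hy

theorem integrableOn_source_iff (g : RiemMetric n M) (c : M) (F : M → ℝ) :
    IntegrableOn F (extChartAt (𝓡 n) c).source (vol g) ↔
      IntegrableOn (fun y => F ((extChartAt (𝓡 n) c).symm y) * volDensity g c y)
        (extChartAt (𝓡 n) c).target volume := by
  have hm : AEMeasurable (extChartAt (𝓡 n) c)
      ((vol g).restrict (extChartAt (𝓡 n) c).source) :=
    (continuousOn_extChartAt c).aemeasurable (isOpen_extChartAt_source c).measurableSet
  have hw : IntegrableOn (fun y => F ((extChartAt (𝓡 n) c).symm y) * volDensity g c y)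
        (extChartAt (𝓡 n) c).target volume ↔
      Integrable (F ∘ (extChartAt (𝓡 n) c).symm)
        (((volume : Measure (EuclideanSpace ℝ (Fin n))).restrict
      (extChartAt (𝓡 n) c).target).withDensity fun y => ENNReal.ofReal (volDensity g c y)) := by
    rw [integrable_withDensity_iff_integrable_smul₀' (aemeasurable_volDensity g c).ennreal_ofReal
      (Eventually.of_forall fun _ => ENNReal.ofReal_lt_top)]
    refine integrable_congr (Eventually.of_forall fun y => ?_)
    simp only [ENNReal.toReal_ofReal (volDensity_nonneg g c y), smul_eq_mul,
      Function.comp_apply, mul_comm]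
  rw [hw]
  constructor
  · intro h
    rw [IntegrableOn, ← map_symm_withDensity] at h
    exact h.comp_aemeasurable (aemeasurable_extChartAt_symm_withDensity g c)
  · intro h
    rw [← map_vol_restrict_source] at h
    refine (h.comp_aemeasurable hm).congr ?_
    filter_upwards [ae_restrict_mem (isOpen_extChartAt_source c).measurableSet] with x hx
    simp only [Function.comp_apply, (extChartAt (𝓡 n) c).left_inv hx]

theorem setIntegral_source (g : RiemMetric n M) (c : M) (F : M → ℝ) :
    ∫ x in (extChartAt (𝓡 n) c).source, F x ∂(vol g) =
      ∫ y in (extChartAt (𝓡 n) c).target,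
        F ((extChartAt (𝓡 n) c).symm y) * volDensity g c y := by
  by_cases h : IntegrableOn F (extChartAt (𝓡 n) c).source (vol g)
  · have h' := h.aestronglyMeasurable
    rw [← map_symm_withDensity] at h' ⊢
    rw [integral_map (aemeasurable_extChartAt_symm_withDensity g c) h',
      integral_withDensity_eq_integral_toReal_smul₀ (aemeasurable_volDensity g c).ennreal_ofReal
      (Eventually.of_forall fun _ => ENNReal.ofReal_lt_top)]
    refine integral_congr_ae (Eventually.of_forall fun y => ?_)
    simp only [ENNReal.toReal_ofReal (volDensity_nonneg g c y), smul_eq_mul,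
      mul_comm]
  · rw [integral_undef h, integral_undef fun h' => h ((integrableOn_source_iff g c F).2 h')]

/-- The passage from global integrals to chart integrals. Integrability need not be assumed: both
sides fail to be integrable together, and then both integrals take the default value zero. -/
theorem integral_eq_of_support_subset (g : RiemMetric n M) (c : M) {F : M → ℝ}
    (hF : ∀ x ∉ (extChartAt (𝓡 n) c).source, F x = 0) :
    ∫ x, F x ∂(vol g) = ∫ y in (extChartAt (𝓡 n) c).target,
        F ((extChartAt (𝓡 n) c).symm y) * volDensity g c y := by
  rw [← setIntegral_source, setIntegral_eq_integral_of_forall_compl_eq_zero hF]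

/-- Null sets of the volume, read in a chart. -/
theorem ae_source_iff (g : RiemMetric n M) (c : M) (P : M → Prop) :
    (∀ᵐ x ∂((vol g).restrict (extChartAt (𝓡 n) c).source), P x) ↔
      ∀ᵐ y ∂(volume.restrict (extChartAt (𝓡 n) c).target),
        P ((extChartAt (𝓡 n) c).symm y) := by
  have hw : (∀ᵐ y ∂(volume.restrict (extChartAt (𝓡 n) c).target),
        P ((extChartAt (𝓡 n) c).symm y)) ↔
      ∀ᵐ y ∂(((volume : Measure (EuclideanSpace ℝ (Fin n))).restrict
      (extChartAt (𝓡 n) c).target).withDensity fun y => ENNReal.ofReal (volDensity g c y)),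
        P ((extChartAt (𝓡 n) c).symm y) := by
    rw [ae_withDensity_iff' (aemeasurable_volDensity g c).ennreal_ofReal]
    refine eventually_congr ?_
    filter_upwards [ae_restrict_mem (isOpen_extChartAt_target c).measurableSet] with y hy
    simp [volDensity_pos g hy]
  have hm : AEMeasurable (extChartAt (𝓡 n) c)
      ((vol g).restrict (extChartAt (𝓡 n) c).source) :=
    (continuousOn_extChartAt c).aemeasurable (isOpen_extChartAt_source c).measurableSet
  rw [hw]
  constructor
  · intro h
    rw [← map_symm_withDensity] at h
    exact ae_of_ae_map (aemeasurable_extChartAt_symm_withDensity g c) h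
  · intro h
    rw [← map_vol_restrict_source] at h
    filter_upwards [ae_of_ae_map hm h,
      ae_restrict_mem (isOpen_extChartAt_source c).measurableSet] with x hx hxS
    rwa [(extChartAt (𝓡 n) c).left_inv hxS] at hx

end

section

variable {n : ℕ} {M : Type*} [TopologicalSpace M] [ChartedSpace (EuclideanSpace ℝ (Fin n)) M]
  [IsManifold (𝓡 n) ∞ M]

/-! ### Algebra of test functions and gradients -/

theorem zero_mem_testFunctions : (0 : M → ℝ) ∈ testFunctions n M :=
  ⟨contMDiff_const, HasCompactSupport.zero⟩

theorem add_mem_testFunctions {φ χ : M → ℝ} (hφ : φ ∈ testFunctions n M)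
    (hχ : χ ∈ testFunctions n M) : φ + χ ∈ testFunctions n M :=
  ⟨hφ.1.add hχ.1, hφ.2.add hχ.2⟩

theorem mul_mem_testFunctions {a φ : M → ℝ} (ha : ContMDiff (𝓡 n) 𝓘(ℝ, ℝ) ∞ a)
    (hφ : φ ∈ testFunctions n M) : a * φ ∈ testFunctions n M :=
  ⟨ha.mul hφ.1, hφ.2.mul_left⟩

theorem grad_add (g : RiemMetric n M) {φ χ : M → ℝ} {x : M}
    (hφ : MDifferentiableAt (𝓡 n) 𝓘(ℝ, ℝ) φ x) (hχ : MDifferentiableAt (𝓡 n) 𝓘(ℝ, ℝ) χ x) :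
    grad g (φ + χ) x = grad g φ x + grad g χ x :=
  (congrArg (g.inner x).inverse (mfderiv_add hφ hχ)).trans (map_add _ _ _)

theorem inner_grad_eq_fderiv (g : RiemMetric n M) {c : M} {y : EuclideanSpace ℝ (Fin n)}
    (hy : y ∈ (extChartAt (𝓡 n) c).target) {φ : M → ℝ}
    (hφ : MDifferentiableAt (𝓡 n) 𝓘(ℝ, ℝ) φ ((extChartAt (𝓡 n) c).symm y)) (Y : VField n M) :
    g.inner ((extChartAt (𝓡 n) c).symm y) (grad g φ ((extChartAt (𝓡 n) c).symm y))
      (Y ((extChartAt (𝓡 n) c).symm y)) =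
      fderiv ℝ (φ ∘ (extChartAt (𝓡 n) c).symm) y (coord c Y y) := by
  rw [inner_grad, mfderiv_eq_fderiv_coord hy hφ]

theorem contMDiff_inner (g : RiemMetric n M) {X Y : VField n M}
    (hX : ContMDiff (𝓡 n) (𝓡 n).tangent ∞ (fun x => (⟨x, X x⟩ : TangentBundle (𝓡 n) M)))
    (hY : ContMDiff (𝓡 n) (𝓡 n).tangent ∞ (fun x => (⟨x, Y x⟩ : TangentBundle (𝓡 n) M))) :
    ContMDiff (𝓡 n) 𝓘(ℝ, ℝ) ∞ (fun x => g.inner x (X x) (Y x)) :=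
  contMDiffOn_univ.1 (contMDiffOn_inner g hX.contMDiffOn hY.contMDiffOn)

theorem sigmaCompactSpace (n : ℕ) (M : Type*) [TopologicalSpace M]
    [ChartedSpace (EuclideanSpace ℝ (Fin n)) M] [SecondCountableTopology M] :
    SigmaCompactSpace M := by
  have : LocallyCompactSpace M := Manifold.locallyCompact_of_finiteDimensional (𝓡 n)
  infer_instance

/-- A property of test functions that is additive holds for all (nonnegative) test functions if it
holds for those supported in the domain of a chart. -/
theorem testFunctions_induction [T2Space M] [SecondCountableTopology M] {P : (M → ℝ) → Prop}
    (h0 : P 0)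
    (hadd : ∀ φ ∈ testFunctions n M, ∀ χ ∈ testFunctions n M, P φ → P χ → P (φ + χ))
    {φ : M → ℝ} (hφ : φ ∈ testFunctions n M)
    (hP : ∀ c : M, ∀ a : M → ℝ, ContMDiff (𝓡 n) 𝓘(ℝ, ℝ) ∞ a → (∀ x, 0 ≤ a x) →
      tsupport (a * φ) ⊆ (extChartAt (𝓡 n) c).source → P (a * φ)) : P φ := by
  have := sigmaCompactSpace n M
  obtain ⟨f, hf⟩ := SmoothPartitionOfUnity.exists_isSubordinate_chartAt_source (𝓡 n) M
  -- By local finiteness only finitely many members of the partition meet the compact support, so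
  -- `φ` is a finite sum of localized pieces.
  have hfin : {i | (Function.support (f i) ∩ tsupport φ).Nonempty}.Finite :=
    f.locallyFinite.finite_nonempty_inter_compact hφ.2
  have hsum : φ = ∑ i ∈ hfin.toFinset, (fun x => f i x) * φ := by
    funext x
    rw [Finset.sum_apply]
    simp only [Pi.mul_apply]
    rw [← Finset.sum_mul]
    by_cases hx : φ x = 0
    · simp [hx]
    have hxs : x ∈ tsupport φ := subset_tsupport _ hx
    have h1 := f.sum_eq_one (mem_univ x)
    rw [finsum_eq_sum_of_support_subset (s := hfin.toFinset)] at h1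
    · rw [h1, one_mul]
    · intro i hi
      simp only [Finite.coe_toFinset, mem_ofPred_eq]
      exact ⟨x, hi, hxs⟩
  have hterm : ∀ i, (fun x => f i x) * φ ∈ testFunctions n M := fun i =>
    mul_mem_testFunctions (f i).contMDiff hφ
  have key : ∑ i ∈ hfin.toFinset, (fun x => f i x) * φ ∈ testFunctions n M ∧
      P (∑ i ∈ hfin.toFinset, (fun x => f i x) * φ) := by
    refine Finset.sum_induction _ (fun χ => χ ∈ testFunctions n M ∧ P χ)
      (fun a b ha hb => ⟨add_mem_testFunctions ha.1 hb.1, hadd a ha.1 b hb.1 ha.2 hb.2⟩)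
      ⟨zero_mem_testFunctions, h0⟩ fun i _ => ⟨hterm i, ?_⟩
    refine hP i _ (f i).contMDiff (f.nonneg i) ?_
    rw [extChartAt_source]
    exact (tsupport_mul_subset_left).trans (hf i)
  rw [hsum]
  exact key.2

variable [MeasurableSpace M] [BorelSpace M]

/-! ### Topological properties of the volume -/

instance isLocallyFiniteMeasure_vol (g : RiemMetric n M) : IsLocallyFiniteMeasure (vol g) := by
  refine ⟨fun x => ?_⟩
  have hx : extChartAt (𝓡 n) x x ∈ (extChartAt (𝓡 n) x).target := mem_extChartAt_target x
  obtain ⟨K, hK, hxK, hKT⟩ := exists_compact_subset (isOpen_extChartAt_target x) hx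
  set U := (extChartAt (𝓡 n) x).source ∩ extChartAt (𝓡 n) x ⁻¹' interior K with hU
  have hUo : IsOpen U := (continuousOn_extChartAt x).isOpen_inter_preimage
    (isOpen_extChartAt_source x) isOpen_interior
  refine ⟨U, hUo.mem_nhds ⟨mem_extChartAt_source x, hxK⟩, ?_⟩
  have h1 : vol g U = chartVol g x U := by
    rw [← vol_restrict_source, Measure.restrict_apply hUo.measurableSet,
      inter_eq_left.2 inter_subset_left]
  rw [h1, chartVol_apply g x hUo.measurableSet]
  have hsub : (extChartAt (𝓡 n) x).target ∩ (extChartAt (𝓡 n) x).symm ⁻¹' U ⊆ K := by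
    rintro y ⟨hy, hy'⟩
    have := interior_subset hy'.2
    rwa [(extChartAt (𝓡 n) x).right_inv hy] at this
  refine (lintegral_mono_set hsub).trans_lt ?_
  have hint : IntegrableOn (volDensity g x) K volume :=
    ((contDiffOn_volDensity g x).continuousOn.mono hKT).integrableOn_compact hK
  exact hint.lintegral_lt_top

/-- The volume density is positive on the chart target, so a volume-null open set would have a
Lebesgue-null, nonempty open image. This allows continuous functions to be compared pointwise from
almost everywhere equality. -/
instance isOpenPosMeasure_vol (g : RiemMetric n M) : (vol g).IsOpenPosMeasure := by
  refine ⟨fun U hU ⟨x, hx⟩ h0 => ?_⟩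
  have h1 : ∀ᵐ z ∂((vol g).restrict (extChartAt (𝓡 n) x).source), z ∉ U :=
    ae_restrict_of_ae (measure_eq_zero_iff_ae_notMem.1 h0)
  rw [ae_source_iff, ae_restrict_iff' (isOpen_extChartAt_target x).measurableSet] at h1
  have ho : IsOpen ((extChartAt (𝓡 n) x).target ∩ (extChartAt (𝓡 n) x).symm ⁻¹' U) :=
    (continuousOn_extChartAt_symm x).isOpen_inter_preimage (isOpen_extChartAt_target x) hU
  refine ho.measure_ne_zero volume ⟨extChartAt (𝓡 n) x x, mem_extChartAt_target x, ?_⟩ ?_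
  · rw [mem_preimage, extChartAt_to_inv]
    exact hx
  · refine measure_mono_null (fun y hy => ?_) h1
    simp only [mem_compl_iff, mem_ofPred_eq, Classical.not_imp, not_not]
    exact hy

/-! ### Integration by parts -/

theorem _root_.ContinuousOn.integrable_of_tsupport_subset {X : Type*} [TopologicalSpace X]
    [T2Space X] [MeasurableSpace X] [BorelSpace X] {μ : Measure X}
    [IsFiniteMeasureOnCompacts μ] {F : X → ℝ} {K : Set X} (hF : ContinuousOn F K)
    (hK : IsCompact K) (hFK : ∀ x ∉ K, F x = 0) : Integrable F μ :=
  (integrableOn_iff_integrable_of_support_subset fun x hx => by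
    by_contra h; exact hx (hFK x h)).1 (hF.integrableOn_compact' hK hK.measurableSet)

/-- Integration by parts in an open subset of a Euclidean space. -/
theorem integral_mul_fderiv_eq_neg_of_tsupport_subset {E : Type*} [NormedAddCommGroup E]
    [NormedSpace ℝ E] [FiniteDimensional ℝ E] [MeasurableSpace E] [BorelSpace E]
    {μ : Measure E} [μ.IsAddHaarMeasure] {T : Set E} (hT : IsOpen T) {u F : E → ℝ}
    (hu : ContDiff ℝ 1 u) (hucs : HasCompactSupport u) (huT : tsupport u ⊆ T)
    (hF : ContDiffOn ℝ 1 F T) (v : E) :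
    ∫ y, u y * fderiv ℝ F y v ∂μ = - ∫ y, fderiv ℝ u y v * F y ∂μ := by
  have hF' : ContinuousOn (fun y => fderiv ℝ F y v) T :=
    (hF.continuousOn_fderiv_of_isOpen hT le_rfl).clm_apply continuousOn_const
  have hu' : Continuous fun y => fderiv ℝ u y v :=
    (hu.continuous_fderiv (by simp)).clm_apply continuous_const
  refine integral_mul_fderiv_eq_neg_fderiv_mul_of_integrable ?_ ?_ ?_
    (fun x _ => hu.differentiable (by simp) x)
    (fun x hx => (hF.differentiableOn (by simp)).differentiableAt (hT.mem_nhds (huT hx)))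
  · refine ((hu'.continuousOn).mul (hF.continuousOn.mono huT)).integrable_of_tsupport_subset hucs
      fun x hx => ?_
    have : fderiv ℝ u x = 0 :=
      image_eq_zero_of_notMem_tsupport fun h => hx (tsupport_fderiv_subset ℝ h)
    simp [this]
  · refine ((hu.continuous.continuousOn).mul (hF'.mono huT)).integrable_of_tsupport_subset hucs
      fun x hx => ?_
    simp [image_eq_zero_of_notMem_tsupport hx]
  · refine ((hu.continuous.continuousOn).mul (hF.continuousOn.mono huT)
      ).integrable_of_tsupport_subset hucs fun x hx => ?_
    simp [image_eq_zero_of_notMem_tsupport hx]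

/-- A function on `M`, read in the chart around `c` and extended by zero. -/
noncomputable def chartPull (c : M) (φ : M → ℝ) : EuclideanSpace ℝ (Fin n) → ℝ :=
  (extChartAt (𝓡 n) c).target.indicator (φ ∘ (extChartAt (𝓡 n) c).symm)

theorem chartPull_of_mem {c : M} {y : EuclideanSpace ℝ (Fin n)}
    (hy : y ∈ (extChartAt (𝓡 n) c).target) (φ : M → ℝ) :
    chartPull c φ y = φ ((extChartAt (𝓡 n) c).symm y) :=
  indicator_of_mem hy _

theorem chartPull_eventuallyEq {c : M} {y : EuclideanSpace ℝ (Fin n)}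
    (hy : y ∈ (extChartAt (𝓡 n) c).target) (φ : M → ℝ) :
    chartPull c φ =ᶠ[𝓝 y] φ ∘ (extChartAt (𝓡 n) c).symm := by
  filter_upwards [(isOpen_extChartAt_target c).mem_nhds hy] with z hz
  exact chartPull_of_mem hz φ

theorem isCompact_image_extChartAt {c : M} {K : Set M} (hK : IsCompact K)
    (hKc : K ⊆ (extChartAt (𝓡 n) c).source) : IsCompact (extChartAt (𝓡 n) c '' K) :=
  hK.image_of_continuousOn ((continuousOn_extChartAt c).mono hKc)

theorem image_extChartAt_subset {c : M} {K : Set M}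
    (hKc : K ⊆ (extChartAt (𝓡 n) c).source) :
    extChartAt (𝓡 n) c '' K ⊆ (extChartAt (𝓡 n) c).target := by
  rintro _ ⟨x, hx, rfl⟩
  exact (extChartAt (𝓡 n) c).map_source (hKc hx)

theorem tsupport_chartPull_subset {c : M} {φ : M → ℝ} (hφ : HasCompactSupport φ)
    (hφc : tsupport φ ⊆ (extChartAt (𝓡 n) c).source) :
    tsupport (chartPull (n := n) c φ) ⊆ extChartAt (𝓡 n) c '' tsupport φ := by
  refine closure_minimal (fun y hy => ?_) (isCompact_image_extChartAt hφ hφc).isClosed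
  have hyT : y ∈ (extChartAt (𝓡 n) c).target := by
    by_contra h
    exact hy (indicator_of_notMem h _)
  refine ⟨(extChartAt (𝓡 n) c).symm y, subset_tsupport _ fun h0 => hy ?_,
    (extChartAt (𝓡 n) c).right_inv hyT⟩
  rw [chartPull_of_mem hyT, h0]

theorem hasCompactSupport_chartPull {c : M} {φ : M → ℝ} (hφ : HasCompactSupport φ)
    (hφc : tsupport φ ⊆ (extChartAt (𝓡 n) c).source) : HasCompactSupport (chartPull (n := n) c φ) :=
  (isCompact_image_extChartAt hφ hφc).of_isClosed_subset (isClosed_tsupport _)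
    (tsupport_chartPull_subset hφ hφc)

theorem contDiff_chartPull {c : M} {φ : M → ℝ} (hφ : φ ∈ testFunctions n M)
    (hφc : tsupport φ ⊆ (extChartAt (𝓡 n) c).source) : ContDiff ℝ ∞ (chartPull (n := n) c φ) := by
  have hsub := (tsupport_chartPull_subset hφ.2 hφc).trans (image_extChartAt_subset hφc)
  refine contMDiff_iff_contDiff.1 (contMDiff_of_tsupport fun y hy => ?_)
  exact contMDiffAt_iff_contDiffAt.2 <| ((contDiffOn_comp_extChartAt_symm le_rfl hφ.1.contMDiffOn).contDiffAt
    ((isOpen_extChartAt_target c).mem_nhds (hsub hy))).congr_of_eventuallyEq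
    (chartPull_eventuallyEq (hsub hy) φ)

/-- The divergence of a vector field, computed in the chart around `c`. -/
noncomputable def chartDiv (g : RiemMetric n M) (c : M) (Y : VField n M)
    (y : EuclideanSpace ℝ (Fin n)) : ℝ :=
  (volDensity g c y)⁻¹ * ∑ i : Fin n, fderiv ℝ (fun y => volDensity g c y * coord c Y y i) y
    (EuclideanSpace.single i (1 : ℝ))

theorem contDiffOn_volDensity_mul_coord (g : RiemMetric n M) (c : M) {Y : VField n M}
    (hY : ContDiffOn ℝ ∞ (coord c Y) (extChartAt (𝓡 n) c).target) (i : Fin n) :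
    ContDiffOn ℝ ∞ (fun y => volDensity g c y * coord c Y y i) (extChartAt (𝓡 n) c).target :=
  (contDiffOn_volDensity g c).mul (contDiffOn_euclidean.1 hY i)

theorem continuousOn_chartDiv (g : RiemMetric n M) (c : M) {Y : VField n M}
    (hY : ContDiffOn ℝ ∞ (coord c Y) (extChartAt (𝓡 n) c).target) :
    ContinuousOn (chartDiv g c Y) (extChartAt (𝓡 n) c).target := by
  refine ((contDiffOn_volDensity g c).continuousOn.inv₀ fun y hy => (volDensity_pos g hy).ne').mul
    (continuousOn_finsetSum _ fun i _ => ?_)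
  exact ((contDiffOn_volDensity_mul_coord g c hY i).continuousOn_fderiv_of_isOpen
    (isOpen_extChartAt_target c) (by simp)).clm_apply continuousOn_const

/-- The density `w` of the volume cancels the factor `w⁻¹` of the divergence. What remains is
Euclidean integration by parts of `φ`, read in the chart, against the components `w Y^i`. -/
theorem integral_mul_chartDiv (g : RiemMetric n M) (c : M) {Y : VField n M}
    (hY : ContDiffOn ℝ ∞ (coord c Y) (extChartAt (𝓡 n) c).target) {φ : M → ℝ}
    (hφ : φ ∈ testFunctions n M) (hφc : tsupport φ ⊆ (extChartAt (𝓡 n) c).source) :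
    ∫ x, φ x * chartDiv g c Y (extChartAt (𝓡 n) c x) ∂(vol g) =
      - ∫ x, g.inner x (grad g φ x) (Y x) ∂(vol g) := by
  have hT := isOpen_extChartAt_target (I := 𝓡 n) c
  have hu := contDiff_chartPull hφ hφc
  have hucs := hasCompactSupport_chartPull hφ.2 hφc
  have huT := (tsupport_chartPull_subset hφ.2 hφc).trans (image_extChartAt_subset hφc)
  have hu1 : ContDiff ℝ 1 (chartPull c φ) := hu.of_le (by simp)
  have hWY := fun i => (contDiffOn_volDensity_mul_coord g c hY i)
  have hnot : ∀ x ∉ (extChartAt (𝓡 n) c).source, x ∉ tsupport φ := fun x hx h => hx (hφc h)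
  rw [integral_eq_of_support_subset g c
    (fun x hx => by rw [image_eq_zero_of_notMem_tsupport (hnot x hx), zero_mul]),
    integral_eq_of_support_subset g c
    (fun x hx => by rw [grad_eq_zero_of_notMem_tsupport g (hnot x hx), map_zero]; rfl)]
  have e1 : ∫ y in (extChartAt (𝓡 n) c).target, φ ((extChartAt (𝓡 n) c).symm y) *
        chartDiv g c Y (extChartAt (𝓡 n) c ((extChartAt (𝓡 n) c).symm y)) * volDensity g c y =
      ∫ y, ∑ i : Fin n, chartPull c φ y * fderiv ℝ (fun y => volDensity g c y * coord c Y y i) y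
        (EuclideanSpace.single i (1 : ℝ)) := by
    rw [← integral_indicator hT.measurableSet]
    refine integral_congr_ae (Eventually.of_forall fun y => ?_)
    by_cases hy : y ∈ (extChartAt (𝓡 n) c).target
    · have hw := (volDensity_pos g hy).ne'
      simp only [indicator_of_mem hy, (extChartAt (𝓡 n) c).right_inv hy, chartDiv,
        chartPull_of_mem hy, ← Finset.mul_sum]
      field_simp
    · have h0 : chartPull (n := n) c φ y = 0 := indicator_of_notMem hy _
      rw [indicator_of_notMem hy]
      simp [h0]
  have e2 : ∫ y in (extChartAt (𝓡 n) c).target,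
        g.inner ((extChartAt (𝓡 n) c).symm y) (grad g φ ((extChartAt (𝓡 n) c).symm y))
          (Y ((extChartAt (𝓡 n) c).symm y)) * volDensity g c y =
      ∫ y, ∑ i : Fin n, fderiv ℝ (chartPull c φ) y (EuclideanSpace.single i (1 : ℝ)) *
        (volDensity g c y * coord c Y y i) := by
    rw [← integral_indicator hT.measurableSet]
    refine integral_congr_ae (Eventually.of_forall fun y => ?_)
    by_cases hy : y ∈ (extChartAt (𝓡 n) c).target
    · simp only [indicator_of_mem hy]
      rw [inner_grad_eq_fderiv g hy ((hφ.1 _).mdifferentiableAt (by simp)),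
        ← (chartPull_eventuallyEq hy φ).fderiv_eq]
      have hexp : coord c Y y = ∑ i, coord c Y y i • EuclideanSpace.single i (1 : ℝ) := by
        simpa using ((EuclideanSpace.basisFun (Fin n) ℝ).sum_repr (coord c Y y)).symm
      conv_lhs => rw [hexp]
      simp only [map_sum, map_smul, smul_eq_mul, Finset.sum_mul]
      exact Finset.sum_congr rfl fun i _ => by ring
    · have h0 : fderiv ℝ (chartPull c φ) y = 0 :=
        image_eq_zero_of_notMem_tsupport fun h => hy (huT (tsupport_fderiv_subset ℝ h))
      rw [indicator_of_notMem hy]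
      simp [h0]
  rw [e1, e2, integral_finsetSum, integral_finsetSum, ← Finset.sum_neg_distrib]
  · exact Finset.sum_congr rfl fun i _ => integral_mul_fderiv_eq_neg_of_tsupport_subset hT hu1 hucs
      huT ((hWY i).of_le (by simp)) _
  · intro i _
    refine ((((hu1.continuous_fderiv (by simp)).clm_apply continuous_const).continuousOn).mul
      ((hWY i).continuousOn.mono huT)).integrable_of_tsupport_subset hucs fun x hx => ?_
    have : fderiv ℝ (chartPull c φ) x = 0 :=
      image_eq_zero_of_notMem_tsupport fun h => hx (tsupport_fderiv_subset ℝ h)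
    simp [this]
  · intro i _
    refine (hu.continuous.continuousOn.mul ((((hWY i).continuousOn_fderiv_of_isOpen hT
      (by simp)).clm_apply continuousOn_const).mono huT)).integrable_of_tsupport_subset hucs
      fun x hx => ?_
    simp [image_eq_zero_of_notMem_tsupport hx]

/-- The divergence may be computed in any chart. -/
theorem div_eq_chartDiv [T2Space M] [SecondCountableTopology M] (g : RiemMetric n M) {c x : M}
    (hx : x ∈ (extChartAt (𝓡 n) c).source) {Y : VField n M}
    (hY : ContMDiff (𝓡 n) (𝓡 n).tangent ∞ (fun x => (⟨x, Y x⟩ : TangentBundle (𝓡 n) M))) :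
    div g Y x = chartDiv g c Y (extChartAt (𝓡 n) c x) := by
  have := sigmaCompactSpace n M
  set U := (extChartAt (𝓡 n) c).source ∩ (extChartAt (𝓡 n) x).source with hU
  have hUo : IsOpen U := (isOpen_extChartAt_source c).inter (isOpen_extChartAt_source x)
  have hc : ∀ c' : M, ContinuousOn (fun z => chartDiv g c' Y (extChartAt (𝓡 n) c' z))
      (extChartAt (𝓡 n) c').source := fun c' =>
    (continuousOn_chartDiv g c' (contDiffOn_coord c' hY)).comp (continuousOn_extChartAt c')
      fun z hz => (extChartAt (𝓡 n) c').map_source hz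
  have h1 := (hc x).mono (inter_subset_right : U ⊆ _)
  have h2 := (hc c).mono (inter_subset_left : U ⊆ _)
  -- Paired with a test function supported in the overlap, either chart expression gives `-∫ ⟨∇φ,
  -- Y⟩`, which mentions no chart. Hence they agree almost everywhere on the overlap, and by
  -- continuity everywhere.
  have hae : ∀ᵐ z ∂(vol g), z ∈ U → chartDiv g x Y (extChartAt (𝓡 n) x z) -
      chartDiv g c Y (extChartAt (𝓡 n) c z) = 0 := by
    refine hUo.ae_eq_zero_of_integral_contMDiff_smul_eq_zero (𝓡 n)
      ((h1.sub h2).locallyIntegrableOn hUo.measurableSet) fun φ hφ hφc hφU => ?_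
    have hi : ∀ c' : M, tsupport φ ⊆ (extChartAt (𝓡 n) c').source →
        Integrable (fun z => φ z * chartDiv g c' Y (extChartAt (𝓡 n) c' z)) (vol g) :=
      fun c' hc' => (hφ.continuous.continuousOn.mul ((hc c').mono hc')
        ).integrable_of_tsupport_subset hφc fun z hz => by
          rw [Pi.mul_apply, image_eq_zero_of_notMem_tsupport hz, zero_mul]
    simp only [smul_eq_mul, mul_sub]
    rw [integral_sub (hi x (hφU.trans inter_subset_right)) (hi c (hφU.trans inter_subset_left)),
      integral_mul_chartDiv g x (contDiffOn_coord x hY) ⟨hφ, hφc⟩ (hφU.trans inter_subset_right),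
      integral_mul_chartDiv g c (contDiffOn_coord c hY) ⟨hφ, hφc⟩ (hφU.trans inter_subset_left),
      sub_self]
  have hae' : (fun z => chartDiv g x Y (extChartAt (𝓡 n) x z)) =ᵐ[(vol g).restrict U]
      fun z => chartDiv g c Y (extChartAt (𝓡 n) c z) := by
    rw [EventuallyEq, ae_restrict_iff' hUo.measurableSet]
    filter_upwards [hae] with z hz hzU
    exact sub_eq_zero.1 (hz hzU)
  exact Measure.eqOn_open_of_ae_eq hae' hUo h1 h2 ⟨hx, mem_extChartAt_source x⟩

theorem continuous_div [T2Space M] [SecondCountableTopology M] (g : RiemMetric n M)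
    {Y : VField n M}
    (hY : ContMDiff (𝓡 n) (𝓡 n).tangent ∞ (fun x => (⟨x, Y x⟩ : TangentBundle (𝓡 n) M))) :
    Continuous (div g Y) := by
  refine continuous_iff_continuousAt.2 fun x => ?_
  have h : ContinuousOn (div g Y) (extChartAt (𝓡 n) x).source :=
    ((continuousOn_chartDiv g x (contDiffOn_coord x hY)).comp (continuousOn_extChartAt x)
      fun z hz => (extChartAt (𝓡 n) x).map_source hz).congr
      fun z hz => div_eq_chartDiv g hz hY
  exact h.continuousAt (extChartAt_source_mem_nhds x)

theorem inner_grad_add (g : RiemMetric n M) {φ χ : M → ℝ} (hφ : φ ∈ testFunctions n M)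
    (hχ : χ ∈ testFunctions n M) (Y : VField n M) (x : M) :
    g.inner x (grad g (φ + χ) x) (Y x) =
      g.inner x (grad g φ x) (Y x) + g.inner x (grad g χ x) (Y x) := by
  rw [grad_add g ((hφ.1 x).mdifferentiableAt (by simp)) ((hχ.1 x).mdifferentiableAt (by simp)),
    map_add]
  rfl

/-- The divergence theorem for test functions. -/
theorem integral_mul_div [T2Space M] [SecondCountableTopology M] (g : RiemMetric n M)
    {Y : VField n M}
    (hY : ContMDiff (𝓡 n) (𝓡 n).tangent ∞ (fun x => (⟨x, Y x⟩ : TangentBundle (𝓡 n) M)))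
    {φ : M → ℝ} (hφ : φ ∈ testFunctions n M) :
    ∫ x, φ x * div g Y x ∂(vol g) = - ∫ x, g.inner x (grad g φ x) (Y x) ∂(vol g) := by
  have hi1 : ∀ φ ∈ testFunctions n M, Integrable (fun x => φ x * div g Y x) (vol g) :=
    fun φ hφ => (hφ.1.continuous.mul (continuous_div g hY)).continuousOn
      |>.integrable_of_tsupport_subset hφ.2 fun x hx => by
        simp [image_eq_zero_of_notMem_tsupport hx]
  have hi2 : ∀ φ ∈ testFunctions n M,
      Integrable (fun x => g.inner x (grad g φ x) (Y x)) (vol g) :=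
    fun φ hφ => (contMDiff_inner g (contMDiff_grad g hφ.1) hY).continuous.continuousOn
      |>.integrable_of_tsupport_subset hφ.2 fun x hx => by
        rw [grad_eq_zero_of_notMem_tsupport g hx, map_zero]; rfl
  refine testFunctions_induction (P := fun φ => ∫ x, φ x * div g Y x ∂(vol g) =
    - ∫ x, g.inner x (grad g φ x) (Y x) ∂(vol g)) ?_ ?_ hφ ?_
  · have h0 : ∀ x : M, grad g 0 x = 0 := fun x =>
      grad_eq_zero_of_notMem_tsupport g (by simp [tsupport])
    simp [h0]
  · intro φ hφ χ hχ h1 h2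
    simp only [inner_grad_add g hφ hχ, Pi.add_apply, add_mul]
    rw [integral_add (hi1 φ hφ) (hi1 χ hχ), integral_add (hi2 φ hφ) (hi2 χ hχ), h1, h2]
    ring
  · intro c a ha _ hac
    have hmem := mul_mem_testFunctions ha hφ
    rw [← integral_mul_chartDiv g c (contDiffOn_coord c hY) hmem hac]
    refine integral_congr_ae (Eventually.of_forall fun x => ?_)
    by_cases hx : x ∈ (extChartAt (𝓡 n) c).source
    · simp only
      rw [div_eq_chartDiv g hx hY]
    · have : (a * φ) x = 0 := image_eq_zero_of_notMem_tsupport fun h => hx (hac h)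
      simp only [this, zero_mul]

end

/-! ### Measures with a density -/

section Density

variable {X : Type*} [MeasurableSpace X] {ν : Measure X} {σ : X → ℝ}

theorem integrable_densityMeasure (hσ : Measurable σ) (h0 : ∀ x, 0 ≤ σ x) {F : X → ℝ} :
    Integrable F (densityMeasure ν σ) ↔ Integrable (fun x => σ x * F x) ν := by
  rw [densityMeasure, integrable_withDensity_iff_integrable_smul₀' hσ.ennreal_ofReal.aemeasurable
    (Eventually.of_forall fun _ => ENNReal.ofReal_lt_top)]
  refine integrable_congr (Eventually.of_forall fun x => ?_)
  simp only [ENNReal.toReal_ofReal (h0 x), smul_eq_mul]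

theorem integral_densityMeasure (hσ : Measurable σ) (h0 : ∀ x, 0 ≤ σ x) (F : X → ℝ) :
    ∫ x, F x ∂(densityMeasure ν σ) = ∫ x, σ x * F x ∂ν := by
  rw [densityMeasure, integral_withDensity_eq_integral_toReal_smul₀ hσ.ennreal_ofReal.aemeasurable
    (Eventually.of_forall fun _ => ENNReal.ofReal_lt_top)]
  refine integral_congr_ae (Eventually.of_forall fun x => ?_)
  simp only [ENNReal.toReal_ofReal (h0 x), smul_eq_mul]

theorem absolutelyContinuous_densityMeasure (hσ : Measurable σ) (h0 : ∀ x, 0 < σ x) :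
    ν ≪ densityMeasure ν σ :=
  withDensity_absolutelyContinuous' hσ.ennreal_ofReal.aemeasurable
    (Eventually.of_forall fun x => (ENNReal.ofReal_pos.2 (h0 x)).ne')

theorem densityMeasure_absolutelyContinuous : densityMeasure ν σ ≪ ν :=
  withDensity_absolutelyContinuous _ _

theorem ae_densityMeasure_iff (hσ : Measurable σ) (h0 : ∀ x, 0 < σ x) {P : X → Prop} :
    (∀ᵐ x ∂(densityMeasure ν σ), P x) ↔ ∀ᵐ x ∂ν, P x :=
  ⟨fun h => (absolutelyContinuous_densityMeasure hσ h0).ae_le h,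
    fun h => densityMeasure_absolutelyContinuous.ae_le h⟩

end Density

section

variable {n : ℕ} {M : Type*} [TopologicalSpace M] [ChartedSpace (EuclideanSpace ℝ (Fin n)) M]
  [IsManifold (𝓡 n) ∞ M]

/-! ### Square integrable vector fields -/

theorem inner_self_nonneg (g : RiemMetric n M) (x : M) (v : TangentSpace (𝓡 n) x) :
    0 ≤ g.inner x v v := by
  by_cases h : v = 0
  · rw [h, map_zero]
  · exact (g.pos x v h).le

theorem inner_smul_add_self (g : RiemMetric n M) (x : M) (t : ℝ) (v w : TangentSpace (𝓡 n) x) :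
    g.inner x (v + t • w) (v + t • w) =
      g.inner x v v + 2 * t * g.inner x v w + t ^ 2 * g.inner x w w := by
  have h1 : g.inner x (v + t • w) = g.inner x v + t • g.inner x w := by
    rw [map_add, map_smul]
  rw [h1]
  simp only [add_apply, smul_apply, map_add, map_smul, smul_eq_mul]
  rw [g.symm x w v]
  ring

theorem two_mul_inner_le (g : RiemMetric n M) (x : M) (t : ℝ) (v w : TangentSpace (𝓡 n) x) :
    -(g.inner x v v + t ^ 2 * g.inner x w w) ≤ 2 * t * g.inner x v w := by
  have h := inner_self_nonneg g x (v + t • w)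
  rw [inner_smul_add_self] at h
  linarith

theorem abs_inner_le (g : RiemMetric n M) (x : M) (v w : TangentSpace (𝓡 n) x) :
    |g.inner x v w| ≤ g.inner x v v + g.inner x w w := by
  have h1 := two_mul_inner_le g x 1 v w
  have h2 := two_mul_inner_le g x (-1) v w
  have h3 := inner_self_nonneg g x v
  have h4 := inner_self_nonneg g x w
  exact abs_le.2 ⟨by linarith, by linarith⟩

/-- Cauchy–Schwarz, from the discriminant of the nonnegative quadratic polynomial `t ↦ |v + t w|²`.
-/
theorem sq_inner_le (g : RiemMetric n M) (x : M) (v w : TangentSpace (𝓡 n) x) :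
    g.inner x v w ^ 2 ≤ g.inner x v v * g.inner x w w := by
  have hd := discrim_le_zero (a := g.inner x w w) (b := 2 * g.inner x v w) (c := g.inner x v v)
    fun t => by
      have h := inner_self_nonneg g x (v + t • w)
      rw [inner_smul_add_self] at h
      nlinarith
  rw [discrim] at hd
  nlinarith

theorem inner_sub_self (g : RiemMetric n M) (x : M) (v w : TangentSpace (𝓡 n) x) :
    g.inner x (v - w) (v - w) = g.inner x v v - 2 * g.inner x v w + g.inner x w w := by
  have h := inner_smul_add_self g x (-1) v w
  rw [neg_one_smul, ← sub_eq_add_neg] at h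
  rw [h]
  ring

theorem inner_sub_left (g : RiemMetric n M) (x : M) (u v w : TangentSpace (𝓡 n) x) :
    g.inner x (u - v) w = g.inner x u w - g.inner x v w := by
  rw [map_sub]
  rfl

theorem inner_sub_self_le (g : RiemMetric n M) (x : M) (v w : TangentSpace (𝓡 n) x) :
    g.inner x (v - w) (v - w) ≤ 2 * g.inner x v v + 2 * g.inner x w w := by
  have h := two_mul_inner_le g x 1 v w
  rw [inner_sub_self]
  linarith

theorem inner_eq_sum_gram (g : RiemMetric n M) {c x : M}
    (hx : x ∈ (extChartAt (𝓡 n) c).source) (v w : TangentSpace (𝓡 n) x) :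
    g.inner x v w = ∑ i, ∑ j,
      (show EuclideanSpace ℝ (Fin n) from mfderiv (𝓡 n) (𝓡 n) (extChartAt (𝓡 n) c) x v) i *
      (show EuclideanSpace ℝ (Fin n) from mfderiv (𝓡 n) (𝓡 n) (extChartAt (𝓡 n) c) x w) j *
        gram g c (extChartAt (𝓡 n) c x) i j := by
  have h := inner_mfderiv_symm g c (extChartAt (𝓡 n) c x)
    (mfderiv (𝓡 n) (𝓡 n) (extChartAt (𝓡 n) c) x v)
    (mfderiv (𝓡 n) (𝓡 n) (extChartAt (𝓡 n) c) x w)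
  rw [mfderiv_extChartAt_symm_apply hx, mfderiv_extChartAt_symm_apply hx,
    (extChartAt (𝓡 n) c).left_inv hx] at h
  exact h

variable [MeasurableSpace M] [BorelSpace M]

/-- The coordinates of the vector field `X` in the chart around `c` are measurable. -/
def MeasurableCoord (g : RiemMetric n M) (X : VField n M) (c : M) : Prop :=
  AEMeasurable (fun x => (mfderiv (𝓡 n) (𝓡 n) (extChartAt (𝓡 n) c) x (X x) :
    EuclideanSpace ℝ (Fin n))) ((vol g).restrict (extChartAt (𝓡 n) c).source)

theorem MeasurableCoord.inner {g : RiemMetric n M} {X Z : VField n M} {c : M}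
    (hX : MeasurableCoord g X c) (hZ : MeasurableCoord g Z c) :
    AEMeasurable (fun x => g.inner x (X x) (Z x))
      ((vol g).restrict (extChartAt (𝓡 n) c).source) := by
  have hS := (isOpen_extChartAt_source (I := 𝓡 n) c).measurableSet
  have hcomp : ∀ i : Fin n, Measurable fun v : EuclideanSpace ℝ (Fin n) => v i := fun i =>
    (EuclideanSpace.proj (𝕜 := ℝ) i).continuous.measurable
  have hg : ∀ i j, AEMeasurable (fun x => gram g c (extChartAt (𝓡 n) c x) i j)
      ((vol g).restrict (extChartAt (𝓡 n) c).source) := fun i j =>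
    ((contDiffOn_gram g c i j).continuousOn.comp (continuousOn_extChartAt c)
      fun x hx => (extChartAt (𝓡 n) c).map_source hx).aemeasurable hS
  have h : AEMeasurable (fun x => ∑ i, ∑ j,
      (show EuclideanSpace ℝ (Fin n) from mfderiv (𝓡 n) (𝓡 n) (extChartAt (𝓡 n) c) x (X x)) i *
      (show EuclideanSpace ℝ (Fin n) from mfderiv (𝓡 n) (𝓡 n) (extChartAt (𝓡 n) c) x (Z x)) j *
        gram g c (extChartAt (𝓡 n) c x) i j)
      ((vol g).restrict (extChartAt (𝓡 n) c).source) :=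
    Finset.aemeasurable_fun_sum _ fun i _ => Finset.aemeasurable_fun_sum _ fun j _ =>
      (((hcomp i).comp_aemeasurable hX).mul ((hcomp j).comp_aemeasurable hZ)).mul (hg i j)
  refine h.congr ?_
  filter_upwards [ae_restrict_mem hS] with x hx
  exact (inner_eq_sum_gram g hx _ _).symm

/-- Second countability provides a countable cover by chart domains. -/
theorem aemeasurable_of_source [SecondCountableTopology M] {g : RiemMetric n M} {F : M → ℝ}
    (hF : ∀ c, AEMeasurable F ((vol g).restrict (extChartAt (𝓡 n) c).source)) :
    AEMeasurable F (vol g) := by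
  obtain ⟨s, hs, hsU⟩ := TopologicalSpace.countable_cover_nhds
    (fun x : M => extChartAt_source_mem_nhds (I := 𝓡 n) x)
  have : Countable s := hs.to_subtype
  have h := (aemeasurable_iUnion_iff (μ := vol g)
    (s := fun x : s => (extChartAt (𝓡 n) (x : M)).source) (f := F)).2 fun x => hF x
  rw [← biUnion_eq_iUnion s (fun x _ => (extChartAt (𝓡 n) x).source), hsU,
    Measure.restrict_univ] at h
  exact h

theorem measurableCoord_of_continuousOn {g : RiemMetric n M} {Y : VField n M} {c : M}
    (hY : ContinuousOn (coord c Y) (extChartAt (𝓡 n) c).target) : MeasurableCoord g Y c := by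
  have h : ContinuousOn (fun x => coord c Y (extChartAt (𝓡 n) c x))
      (extChartAt (𝓡 n) c).source :=
    hY.comp (continuousOn_extChartAt c) fun x hx => (extChartAt (𝓡 n) c).map_source hx
  refine (h.aemeasurable (isOpen_extChartAt_source c).measurableSet).congr ?_
  filter_upwards [ae_restrict_mem (isOpen_extChartAt_source c).measurableSet] with x hx
  simp only [coord]
  rw [(extChartAt (𝓡 n) c).left_inv hx]

theorem measurableCoord_chartField (g : RiemMetric n M) (c : M) (v : EuclideanSpace ℝ (Fin n)) :
    MeasurableCoord g (chartField c v) c :=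
  measurableCoord_of_continuousOn (continuousOn_const.congr fun _ hy => coord_chartField hy v)

variable {g : RiemMetric n M} {Ψ : M → ℝ}

theorem memVecL2_iff (hΨ : Continuous Ψ) (hΨ0 : ∀ x, 0 < Ψ x) {X : VField n M} :
    MemVecL2 g Ψ X ↔ (∀ c, MeasurableCoord g X c) ∧
      Integrable (fun x => Ψ x * g.inner x (X x) (X x)) (vol g) := by
  refine and_congr (forall_congr' fun c => ⟨fun h => h.mono_ac ?_, fun h => h.mono_ac ?_⟩)
    (integrable_densityMeasure hΨ.measurable fun x => (hΨ0 x).le)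
  · exact (absolutelyContinuous_densityMeasure hΨ.measurable hΨ0).restrict _
  · exact densityMeasure_absolutelyContinuous.restrict _

theorem MemVecL2.integrable_inner [SecondCountableTopology M] (hΨ : Continuous Ψ)
    (hΨ0 : ∀ x, 0 < Ψ x) {X Z : VField n M} (hX : MemVecL2 g Ψ X) (hZ : MemVecL2 g Ψ Z) :
    Integrable (fun x => Ψ x * g.inner x (X x) (Z x)) (vol g) := by
  rw [memVecL2_iff hΨ hΨ0] at hX hZ
  refine (hX.2.add hZ.2).mono' (hΨ.measurable.aemeasurable.mul
    (aemeasurable_of_source fun c => (hX.1 c).inner (hZ.1 c))).aestronglyMeasurable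
    (Eventually.of_forall fun x => ?_)
  have h := mul_le_mul_of_nonneg_left (abs_inner_le g x (X x) (Z x)) (hΨ0 x).le
  simp only [Pi.add_apply, Real.norm_eq_abs, abs_mul, abs_of_pos (hΨ0 x)]
  linarith

theorem MemVecL2.sub [SecondCountableTopology M] (hΨ : Continuous Ψ)
    (hΨ0 : ∀ x, 0 < Ψ x) {X Z : VField n M} (hX : MemVecL2 g Ψ X) (hZ : MemVecL2 g Ψ Z) :
    MemVecL2 g Ψ (X - Z) := by
  have hXZ := hX.integrable_inner hΨ hΨ0 hZ
  rw [memVecL2_iff hΨ hΨ0] at hX hZ ⊢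
  refine ⟨fun c => ?_, ?_⟩
  · refine ((hX.1 c).sub (hZ.1 c)).congr (Eventually.of_forall fun x => ?_)
    exact (map_sub (mfderiv (𝓡 n) (𝓡 n) (extChartAt (𝓡 n) c) x) (X x) (Z x)).symm
  · refine ((hX.2.sub (hXZ.const_mul 2)).add hZ.2).congr (Eventually.of_forall fun x => ?_)
    simp only [Pi.add_apply, Pi.sub_apply]
    rw [inner_sub_self]
    ring

theorem memVecL2_of_contMDiff [T2Space M] (hΨ : Continuous Ψ) (hΨ0 : ∀ x, 0 < Ψ x)
    {Y : VField n M}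
    (hY : ContMDiff (𝓡 n) (𝓡 n).tangent ∞ (fun x => (⟨x, Y x⟩ : TangentBundle (𝓡 n) M)))
    {K : Set M} (hK : IsCompact K) (hYK : ∀ x ∉ K, Y x = 0) : MemVecL2 g Ψ Y := by
  rw [memVecL2_iff hΨ hΨ0]
  refine ⟨fun c => measurableCoord_of_continuousOn (contDiffOn_coord c hY).continuousOn, ?_⟩
  refine (hΨ.mul (contMDiff_inner g hY hY).continuous).continuousOn.integrable_of_tsupport_subset
    hK fun x hx => ?_
  simp [hYK x hx]

theorem memVecL2_grad [T2Space M] (hΨ : Continuous Ψ) (hΨ0 : ∀ x, 0 < Ψ x) {φ : M → ℝ}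
    (hφ : φ ∈ testFunctions n M) : MemVecL2 g Ψ (grad g φ) :=
  memVecL2_of_contMDiff hΨ hΨ0 (contMDiff_grad g hφ.1) hφ.2
    fun _ hx => grad_eq_zero_of_notMem_tsupport g hx

/-! ### Functions in weighted `L²` spaces -/

theorem aestronglyMeasurable_of_memLp (hΨ : Continuous Ψ) (hΨ0 : ∀ x, 0 < Ψ x) {σ : M → ℝ}
    (hσ : Continuous σ) (hσ0 : ∀ x, 0 < σ x) {f : M → ℝ}
    (hf : MemLp f 2 (densityMeasure (weightedMeasure g Ψ) σ)) :
    AEStronglyMeasurable f (vol g) :=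
  hf.1.mono_ac ((absolutelyContinuous_densityMeasure hΨ.measurable hΨ0).trans
    (absolutelyContinuous_densityMeasure hσ.measurable hσ0))

theorem integrable_sq_of_memLp (hΨ : Continuous Ψ) (hΨ0 : ∀ x, 0 < Ψ x) {σ : M → ℝ}
    (hσ : Continuous σ) (hσ0 : ∀ x, 0 < σ x) {f : M → ℝ}
    (hf : MemLp f 2 (densityMeasure (weightedMeasure g Ψ) σ)) :
    Integrable (fun x => Ψ x * (σ x * f x ^ 2)) (vol g) :=
  (integrable_densityMeasure hΨ.measurable fun x => (hΨ0 x).le).1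
    ((integrable_densityMeasure hσ.measurable fun x => (hσ0 x).le).1 hf.integrable_sq)

/-- With `s = Ψ σ`, the elementary bound `|f| ≤ s f² + s⁻¹` applies; the second term is continuous,
hence integrable on compact sets. -/
theorem integrableOn_of_memLp [T2Space M] (hΨ : Continuous Ψ) (hΨ0 : ∀ x, 0 < Ψ x) {σ : M → ℝ}
    (hσ : Continuous σ) (hσ0 : ∀ x, 0 < σ x) {f : M → ℝ}
    (hf : MemLp f 2 (densityMeasure (weightedMeasure g Ψ) σ)) {K : Set M} (hK : IsCompact K) :
    IntegrableOn f K (vol g) := by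
  have h1 : IntegrableOn (fun x => (Ψ x * σ x)⁻¹) K (vol g) :=
    ((hΨ.mul hσ).inv₀ fun x => (mul_pos (hΨ0 x) (hσ0 x)).ne').continuousOn.integrableOn_compact'
      hK hK.measurableSet
  refine ((integrable_sq_of_memLp hΨ hΨ0 hσ hσ0 hf).integrableOn.add h1).mono'
    (aestronglyMeasurable_of_memLp hΨ hΨ0 hσ hσ0 hf).restrict (Eventually.of_forall fun x => ?_)
  have hs : 0 < Ψ x * σ x := mul_pos (hΨ0 x) (hσ0 x)
  simp only [Pi.add_apply, Real.norm_eq_abs]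
  have h2 : |f x| * (Ψ x * σ x) ≤ (f x * (Ψ x * σ x)) ^ 2 + 1 := by
    rw [← abs_of_pos hs, ← abs_mul, ← sq_abs, abs_of_pos hs]
    nlinarith [sq_nonneg (|f x * (Ψ x * σ x)| - 1), abs_nonneg (f x * (Ψ x * σ x))]
  have h3 : |f x| ≤ ((f x * (Ψ x * σ x)) ^ 2 + 1) / (Ψ x * σ x) := (le_div_iff₀ hs).2 h2
  refine h3.trans (le_of_eq ?_)
  field_simp

theorem _root_.MeasureTheory.IntegrableOn.integrable_mul_of_support {X : Type*}
    [TopologicalSpace X] [T2Space X] [MeasurableSpace X] [BorelSpace X] {μ : Measure X}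
    {f a : X → ℝ} {K : Set X} (hf : IntegrableOn f K μ) (hK : IsCompact K)
    (ha : ContinuousOn a K) (haK : ∀ x ∉ K, a x = 0) : Integrable (fun x => f x * a x) μ :=
  (integrableOn_iff_integrable_of_support_subset fun x hx => by
    by_contra h; exact hx (by simp [haK x h])).1 (hf.mul_continuousOn ha hK)

/-- Integrability on a compact subset of the domain of a chart, read in the chart. -/
theorem integrableOn_comp_symm [T2Space M] {c : M} {L : Set (EuclideanSpace ℝ (Fin n))}
    (hL : IsCompact L) (hLT : L ⊆ (extChartAt (𝓡 n) c).target) {F : M → ℝ}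
    (hF : IntegrableOn F ((extChartAt (𝓡 n) c).symm '' L) (vol g)) :
    IntegrableOn (fun y => F ((extChartAt (𝓡 n) c).symm y)) L volume := by
  have hLc := isCompact_image_extChartAt_symm hL hLT
  have h1 : Integrable (((extChartAt (𝓡 n) c).symm '' L).indicator F) (vol g) :=
    (integrable_indicator_iff hLc.measurableSet).2 hF
  have h2 := ((integrableOn_source_iff g c _).1 h1.integrableOn).mono_set hLT
  have h3 := h2.mul_continuousOn (((contDiffOn_volDensity g c).continuousOn.inv₀
    fun y hy => (volDensity_pos g hy).ne').mono hLT) hL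
  refine h3.congr_fun (fun y hy => ?_) hL.measurableSet
  have hw := (volDensity_pos g (hLT hy)).ne'
  simp only [indicator_of_mem (mem_image_of_mem _ hy), Pi.inv_apply]
  rw [mul_assoc, mul_inv_cancel₀ hw, mul_one]

/-- Since the volume density is positive on the target, Lebesgue measure there is absolutely
continuous with respect to the weighted measure carried over from `M`. -/
theorem aemeasurable_comp_symm {c : M} {F : M → ℝ}
    (hF : AEMeasurable F ((vol g).restrict (extChartAt (𝓡 n) c).source)) :
    AEMeasurable (fun y => F ((extChartAt (𝓡 n) c).symm y))
      (volume.restrict (extChartAt (𝓡 n) c).target) := by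
  rw [← map_symm_withDensity] at hF
  refine (hF.comp_aemeasurable (aemeasurable_extChartAt_symm_withDensity g c)).mono_ac ?_
  refine withDensity_absolutelyContinuous' (aemeasurable_volDensity g c).ennreal_ofReal ?_
  filter_upwards [ae_restrict_mem (isOpen_extChartAt_target c).measurableSet] with y hy
  exact (ENNReal.ofReal_pos.2 (volDensity_pos g hy)).ne'

/-! ### Weak gradients -/

theorem HasL2Grad.neg_integral_mul_div {f : M → ℝ} {X : VField n M} (hX : HasL2Grad g Ψ f X)
    {Y : VField n M} (hY : Y ∈ testFields n M) :
    ∫ x, f x * div g Y x ∂(vol g) = - ∫ x, g.inner x (X x) (Y x) ∂(vol g) := by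
  have h := hX.2 Y hY
  simp only [distGrad, toDist, toFieldDist] at h
  linarith

theorem HasL2Grad.integral_mul_div_grad [T2Space M] {f : M → ℝ} {X : VField n M}
    (hX : HasL2Grad g Ψ f X) (hΨ : ContMDiff (𝓡 n) 𝓘(ℝ, ℝ) ∞ Ψ) {φ : M → ℝ}
    (hφ : φ ∈ testFunctions n M) :
    ∫ x, f x * div g (fun x => Ψ x • grad g φ x) x ∂(vol g) =
      - ∫ x, Ψ x * g.inner x (X x) (grad g φ x) ∂(vol g) := by
  rw [hX.neg_integral_mul_div (smul_grad_mem_testFields g hΨ hφ)]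
  congr 2
  funext x
  rw [map_smul]
  rfl

/-- The differential inequality, tested with nonnegative test functions. -/
theorem weak_inequality [T2Space M] [SecondCountableTopology M] {ρ V : M → ℝ}
    (hΨ : ContMDiff (𝓡 n) 𝓘(ℝ, ℝ) ∞ Ψ) (hΨ0 : ∀ x, 0 < Ψ x)
    (hρ : ContMDiff (𝓡 n) 𝓘(ℝ, ℝ) ∞ ρ) (hρ0 : ∀ x, 0 < ρ x)
    (hV : ContMDiff (𝓡 n) 𝓘(ℝ, ℝ) ∞ V) (hV0 : ∀ x, 0 ≤ V x) {f : M → ℝ} {X : VField n M}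
    (hf : MemLp f 2 (densityMeasure (weightedMeasure g Ψ) (ρ + V))) (hX : HasL2Grad g Ψ f X)
    {α : ℝ}
    (hsup : DistNonneg n (α • toDist g f - schrodinger g Ψ ρ V (toDist g f)))
    {ψ : M → ℝ} (hψ : ψ ∈ testFunctions n M) (hψ0 : ∀ x, 0 ≤ ψ x) :
    0 ≤ ∫ x, Ψ x * (g.inner x (X x) (grad g ψ x) + (α * ρ x + V x) * f x * ψ x) ∂(vol g) := by
  have hσ : Continuous (ρ + V) := hρ.continuous.add hV.continuous
  have hσ0 : ∀ x, 0 < (ρ + V) x := fun x => add_pos_of_pos_of_nonneg (hρ0 x) (hV0 x)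
  -- The operator carries the factors `ρ⁻¹` and `Ψ⁻¹`, which pass to the test function by duality.
  -- The factor `Ψ ρ` cancels them and leaves the weight `Ψ` of the measure `μ`.
  have hφ : Ψ * ρ * ψ ∈ testFunctions n M := mul_mem_testFunctions (hΨ.mul hρ) hψ
  have h := hsup _ hφ fun x => mul_nonneg (mul_nonneg (hΨ0 x).le (hρ0 x).le) (hψ0 x)
  have e1 : Ψ⁻¹ * (ρ⁻¹ * (Ψ * ρ * ψ)) = ψ := by
    funext x
    have h1 := (hΨ0 x).ne'
    have h2 := (hρ0 x).ne'
    simp only [Pi.mul_apply, Pi.inv_apply]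
    field_simp
  have e2 : V * (ρ⁻¹ * (Ψ * ρ * ψ)) = Ψ * V * ψ := by
    funext x
    have h2 := (hρ0 x).ne'
    simp only [Pi.mul_apply, Pi.inv_apply]
    field_simp
  have hgrad : distDiv g (mulFieldDist Ψ (distGrad g (toDist g f))) ψ =
      - ∫ x, Ψ x * g.inner x (X x) (grad g ψ x) ∂(vol g) := by
    simp only [distDiv, mulFieldDist, distGrad, toDist]
    rw [hX.integral_mul_div_grad hΨ hψ]
    ring
  have h' : 0 ≤ α * (∫ x, f x * (Ψ * ρ * ψ) x ∂(vol g)) -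
      (- (∫ x, Ψ x * g.inner x (X x) (grad g ψ x) ∂(vol g)) -
        ∫ x, f x * (Ψ * V * ψ) x ∂(vol g)) := by
    have h1 : schrodinger g Ψ ρ V (toDist g f) (Ψ * ρ * ψ) =
        - (∫ x, Ψ x * g.inner x (X x) (grad g ψ x) ∂(vol g)) -
          ∫ x, f x * (Ψ * V * ψ) x ∂(vol g) := by
      rw [← hgrad]
      simp only [schrodinger, laplacian, mulDist, Pi.sub_apply, toDist, e1, e2]
    rw [← h1]
    exact h
  have hi : ∀ a : M → ℝ, Continuous a → Integrable (fun x => f x * (a x * ψ x)) (vol g) :=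
    fun a ha => (integrableOn_of_memLp hΨ.continuous hΨ0 hσ hσ0 hf hψ.2).integrable_mul_of_support
      hψ.2 (ha.mul hψ.1.continuous).continuousOn fun x hx => by
        simp [image_eq_zero_of_notMem_tsupport hx]
  have hi1 := hi (Ψ * ρ) (hΨ.continuous.mul hρ.continuous)
  have hi2 := hi (Ψ * V) (hΨ.continuous.mul hV.continuous)
  have hi3 := hX.1.integrable_inner hΨ.continuous hΨ0 (memVecL2_grad hΨ.continuous hΨ0 hψ)
  have e3 : ∫ x, Ψ x * (g.inner x (X x) (grad g ψ x) + (α * ρ x + V x) * f x * ψ x) ∂(vol g) =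
      α * (∫ x, f x * ((Ψ * ρ) x * ψ x) ∂(vol g)) +
        (∫ x, Ψ x * g.inner x (X x) (grad g ψ x) ∂(vol g)) +
        ∫ x, f x * ((Ψ * V) x * ψ x) ∂(vol g) := by
    rw [← integral_const_mul, ← integral_add (hi1.const_mul α) hi3,
      ← integral_add ((hi1.const_mul α).fun_add hi3) hi2]
    refine integral_congr_ae (Eventually.of_forall fun x => ?_)
    simp only [Pi.mul_apply]
    ring
  rw [e3]
  simp only [Pi.mul_apply] at h' ⊢
  linarith

end

/-! ### Coordinate expansions, and L² functions times continuous functions -/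

theorem _root_.EuclideanSpace.sum_smul_single {ι : Type*} [Fintype ι] [DecidableEq ι]
    (v : EuclideanSpace ℝ ι) : ∑ i, v i • EuclideanSpace.single i (1 : ℝ) = v := by
  simpa using (EuclideanSpace.basisFun ι ℝ).sum_repr v

theorem _root_.EuclideanSpace.sum_mul_apply_single {ι : Type*} [Fintype ι] [DecidableEq ι]
    (l : EuclideanSpace ℝ ι →L[ℝ] ℝ) (v : EuclideanSpace ℝ ι) :
    ∑ i, v i * l (EuclideanSpace.single i (1 : ℝ)) = l v := by
  conv_rhs => rw [← EuclideanSpace.sum_smul_single v]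
  simp only [map_sum, map_smul, smul_eq_mul]

theorem _root_.MeasureTheory.MemLp.mul_continuousOn_of_isCompact {X : Type*} [TopologicalSpace X]
    [T2Space X] [MeasurableSpace X] [BorelSpace X] {μ : Measure X} {D a : X → ℝ} {K : Set X}
    (hD : MemLp D 2 (μ.restrict K)) (hK : IsCompact K) (ha : ContinuousOn a K) :
    MemLp (fun x => D x * a x) 2 (μ.restrict K) := by
  obtain ⟨C, hC⟩ := hK.exists_bound_of_continuousOn ha
  refine hD.of_le_mul (c := C)
    (hD.1.mul (ha.aemeasurable hK.measurableSet).aestronglyMeasurable) ?_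
  filter_upwards [ae_restrict_mem hK.measurableSet] with x hx
  rw [norm_mul, mul_comm]
  exact mul_le_mul_of_nonneg_right (hC x hx) (norm_nonneg _)

section

variable {n : ℕ} {M : Type*} [TopologicalSpace M] [ChartedSpace (EuclideanSpace ℝ (Fin n)) M]
  [IsManifold (𝓡 n) ∞ M]

/-! ### Vector fields and weak derivatives in a chart -/

/-- The pairing of `X` with the coordinate field in direction `v` of the chart around `c`. -/
noncomputable def chartPairing (g : RiemMetric n M) (X : VField n M) (c : M)
    (v y : EuclideanSpace ℝ (Fin n)) : ℝ :=
  g.inner ((extChartAt (𝓡 n) c).symm y) (X ((extChartAt (𝓡 n) c).symm y))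
    (mfderiv (𝓡 n) (𝓡 n) (extChartAt (𝓡 n) c).symm y v)

theorem chartPairing_eq_inner_chartField (g : RiemMetric n M) (X : VField n M) {c : M}
    (v : EuclideanSpace ℝ (Fin n)) {y : EuclideanSpace ℝ (Fin n)}
    (hy : y ∈ (extChartAt (𝓡 n) c).target) :
    chartPairing g X c v y = g.inner ((extChartAt (𝓡 n) c).symm y)
      (X ((extChartAt (𝓡 n) c).symm y)) (chartField c v ((extChartAt (𝓡 n) c).symm y)) := by
  simp only [chartPairing, chartField]
  rw [(extChartAt (𝓡 n) c).right_inv hy]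

theorem sum_chartPairing_mul_coord (g : RiemMetric n M) (X Z : VField n M) {c : M}
    {y : EuclideanSpace ℝ (Fin n)} (hy : y ∈ (extChartAt (𝓡 n) c).target) :
    ∑ i, coord c Z y i * chartPairing g X c (EuclideanSpace.single i 1) y =
      g.inner ((extChartAt (𝓡 n) c).symm y) (X ((extChartAt (𝓡 n) c).symm y))
        (Z ((extChartAt (𝓡 n) c).symm y)) := by
  let A : EuclideanSpace ℝ (Fin n) →L[ℝ] EuclideanSpace ℝ (Fin n) :=
    mfderiv (𝓡 n) (𝓡 n) (extChartAt (𝓡 n) c).symm y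
  let l : EuclideanSpace ℝ (Fin n) →L[ℝ] ℝ :=
    g.inner ((extChartAt (𝓡 n) c).symm y) (X ((extChartAt (𝓡 n) c).symm y))
  refine (EuclideanSpace.sum_mul_apply_single (l.comp A) (coord c Z y)).trans ?_
  exact congrArg l (mfderiv_extChartAt_symm_coord hy Z)

/-- Raising the index: the pairings with the coordinate fields are the covariant components of `X`,
and the inverse Gram matrix recovers its coordinates. Local square integrability passes from the
former to the latter in this way. -/
theorem coord_eq_sum_chartPairing (g : RiemMetric n M) (X : VField n M) {c : M}
    {y : EuclideanSpace ℝ (Fin n)} (hy : y ∈ (extChartAt (𝓡 n) c).target) (i : Fin n) :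
    coord c X y i =
      ∑ j, chartPairing g X c (EuclideanSpace.single j 1) y * (gram g c y)⁻¹ j i := by
  set u := coord c X y with hu
  have h1 : ∀ j, chartPairing g X c (EuclideanSpace.single j 1) y =
      Matrix.vecMul u.ofLp (gram g c y) j := fun j => by
    have h := inner_mfderiv_symm g c y u (EuclideanSpace.single j 1)
    rw [hu, mfderiv_extChartAt_symm_coord hy X, ← hu] at h
    refine h.trans ?_
    simp [Matrix.vecMul, dotProduct]
  have h2 : Matrix.vecMul (Matrix.vecMul u.ofLp (gram g c y)) (gram g c y)⁻¹ = u.ofLp := by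
    rw [Matrix.vecMul_vecMul, Matrix.mul_nonsing_inv _ (isUnit_iff_ne_zero.2
      (det_gram_pos g hy).ne'), Matrix.vecMul_one]
  rw [← congrFun h2 i]
  simp only [h1]
  rfl

theorem div_eq_zero_of_eventuallyEq (g : RiemMetric n M) {Y : VField n M} {x : M}
    (h : ∀ᶠ z in 𝓝 x, Y z = 0) : div g Y x = 0 := by
  have hy := mem_extChartAt_target (I := 𝓡 n) x
  have hc : ContinuousAt (extChartAt (𝓡 n) x).symm (extChartAt (𝓡 n) x x) :=
    (continuousOn_extChartAt_symm x).continuousAt ((isOpen_extChartAt_target x).mem_nhds hy)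
  have h1 : ∀ᶠ y in 𝓝 (extChartAt (𝓡 n) x x), coord x Y y = 0 := by
    have h2 := hc.eventually (by rwa [extChartAt_to_inv x])
    filter_upwards [h2] with y hy0
    exact (congrArg (mfderiv (𝓡 n) (𝓡 n) (extChartAt (𝓡 n) x)
      ((extChartAt (𝓡 n) x).symm y)) hy0).trans (map_zero _)
  have h3 : ∀ i : Fin n, fderiv ℝ (fun y => volDensity g x y * coord x Y y i)
      (extChartAt (𝓡 n) x x) = 0 := fun i => by
    have h4 : (fun y => volDensity g x y * coord x Y y i) =ᶠ[𝓝 (extChartAt (𝓡 n) x x)]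
        fun _ => 0 := by
      filter_upwards [h1] with y hy0
      rw [hy0]
      simp
    rw [h4.fderiv_eq, fderiv_fun_const]
    rfl
  simp only [div, h3]
  simp

variable [MeasurableSpace M] [BorelSpace M] {g : RiemMetric n M} {Ψ : M → ℝ}

/-- The covariant components of the weak gradient are the Euclidean weak partial derivatives of `f`
in the chart. With `w` the volume density, the test field is `w⁻¹ u` times the coordinate field of
`v`, whose divergence is `w⁻¹ ∂_v u`; the factor `w` of the volume then cancels on both sides. -/
theorem HasL2Grad.integral_mul_fderiv [T2Space M] [SecondCountableTopology M] {f : M → ℝ}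
    {X : VField n M} (hX : HasL2Grad g Ψ f X) (c : M) (v : EuclideanSpace ℝ (Fin n))
    {u : EuclideanSpace ℝ (Fin n) → ℝ} (hu : ContDiff ℝ ∞ u) (hucs : HasCompactSupport u)
    (huT : tsupport u ⊆ (extChartAt (𝓡 n) c).target) :
    ∫ y, f ((extChartAt (𝓡 n) c).symm y) * fderiv ℝ u y v =
      - ∫ y, u y * chartPairing g X c v y := by
  have hT := isOpen_extChartAt_target (I := 𝓡 n) c
  set b : EuclideanSpace ℝ (Fin n) → ℝ := fun y => u y * (volDensity g c y)⁻¹ with hb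
  have hbsub : tsupport b ⊆ tsupport u :=
    closure_mono fun y hy h0 => hy (by simp only [hb, h0, zero_mul])
  have hbcs : HasCompactSupport b := hucs.mul_right
  have hbd : ContDiffOn ℝ ∞ b (extChartAt (𝓡 n) c).target :=
    hu.contDiffOn.mul ((contDiffOn_volDensity g c).inv fun y hy => (volDensity_pos g hy).ne')
  have hh := chartExtend_mem_testFunctions hbd hbcs (hbsub.trans huT)
  have hhsub : tsupport (chartExtend c b) ⊆ (extChartAt (𝓡 n) c).source :=
    (tsupport_chartExtend_subset hbcs (hbsub.trans huT)).trans
      (image_extChartAt_symm_subset (hbsub.trans huT))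
  have hY := smul_mem_testFields (isOpen_extChartAt_source c) hh hhsub
    (contMDiffOn_chartField c v)
  have h := hX.neg_integral_mul_div hY
  have hnear : ∀ x ∉ (extChartAt (𝓡 n) c).source,
      ∀ᶠ z in 𝓝 x, chartExtend c b z • chartField c v z = 0 := fun x hx => by
    filter_upwards [notMem_tsupport_iff_eventuallyEq.1 fun hx' => hx (hhsub hx')] with z hz
    rw [hz]
    exact zero_smul _ _
  rw [integral_eq_of_support_subset g c (fun x hx => by
      rw [div_eq_zero_of_eventuallyEq g (hnear x hx), mul_zero]),
    integral_eq_of_support_subset g c (fun x hx => by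
      rw [(hnear x hx).self_of_nhds, map_zero])] at h
  have hu0 : ∀ y ∉ (extChartAt (𝓡 n) c).target, y ∉ tsupport u := fun y hy h => hy (huT h)
  have e1 : ∫ y in (extChartAt (𝓡 n) c).target,
      f ((extChartAt (𝓡 n) c).symm y) * fderiv ℝ u y v =
        ∫ y, f ((extChartAt (𝓡 n) c).symm y) * fderiv ℝ u y v :=
    setIntegral_eq_integral_of_forall_compl_eq_zero fun y hy => by
      have hf : fderiv ℝ u y = 0 :=
        image_eq_zero_of_notMem_tsupport fun h => hu0 y hy (tsupport_fderiv_subset ℝ h)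
      rw [hf, zero_apply, mul_zero]
  have e2 : ∫ y in (extChartAt (𝓡 n) c).target, u y * chartPairing g X c v y =
      ∫ y, u y * chartPairing g X c v y :=
    setIntegral_eq_integral_of_forall_compl_eq_zero fun y hy => by
      rw [image_eq_zero_of_notMem_tsupport (hu0 y hy), zero_mul]
  rw [← e1, ← e2]
  refine (setIntegral_congr_fun hT.measurableSet fun y hy => ?_).trans (h.trans
    (congrArg Neg.neg (setIntegral_congr_fun hT.measurableSet fun y hy => ?_)))
  · have hw := (volDensity_pos g hy).ne'
    have h1 : ∀ i : Fin n, fderiv ℝ (fun z => volDensity g c z *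
        coord c (fun x => chartExtend c b x • chartField c v x) z i) y =
        v i • fderiv ℝ u y := fun i => by
      have h2 : (fun z => volDensity g c z *
          coord c (fun x => chartExtend c b x • chartField c v x) z i) =ᶠ[𝓝 y]
          fun z => v i * u z := by
        filter_upwards [hT.mem_nhds hy] with z hz
        have hwz := (volDensity_pos g hz).ne'
        rw [coord_smul, coord_chartField hz, chartExtend_symm hz]
        simp only [hb, PiLp.smul_apply, smul_eq_mul]
        field_simp
      rw [h2.fderiv_eq, fderiv_const_mul ((hu.differentiable (by simp)) y)]
    rw [div_eq_chartDiv g ((extChartAt (𝓡 n) c).map_target hy) hY.1,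
      (extChartAt (𝓡 n) c).right_inv hy, chartDiv]
    simp only [h1, smul_apply, smul_eq_mul]
    rw [EuclideanSpace.sum_mul_apply_single]
    field_simp
  · have hw := (volDensity_pos g hy).ne'
    rw [map_smul, chartExtend_symm hy, chartPairing_eq_inner_chartField g X v hy]
    simp only [hb, smul_eq_mul]
    field_simp

/-- Cauchy–Schwarz bounds the square of the pairing by `|X|²` times the squared length of the
coordinate field, which is continuous and so bounded on `L`. The weight `Ψ` can be divided out on a
compact set. -/
theorem MemVecL2.memLp_chartPairing [T2Space M] (hΨ : Continuous Ψ) (hΨ0 : ∀ x, 0 < Ψ x)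
    {X : VField n M} (hX : MemVecL2 g Ψ X) (c : M) (v : EuclideanSpace ℝ (Fin n))
    {L : Set (EuclideanSpace ℝ (Fin n))} (hL : IsCompact L)
    (hLT : L ⊆ (extChartAt (𝓡 n) c).target) :
    MemLp (chartPairing g X c v) 2 (volume.restrict L) := by
  have hT := isOpen_extChartAt_target (I := 𝓡 n) c
  rw [memVecL2_iff hΨ hΨ0] at hX
  have hLc := isCompact_image_extChartAt_symm hL hLT
  have hmeas : AEStronglyMeasurable (chartPairing g X c v) (volume.restrict L) := by
    refine AEMeasurable.aestronglyMeasurable ?_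
    refine ((aemeasurable_comp_symm ((hX.1 c).inner
      (measurableCoord_chartField g c v))).mono_set hLT).congr ?_
    filter_upwards [ae_restrict_mem hL.measurableSet] with y hy
    exact (chartPairing_eq_inner_chartField g X v (hLT hy)).symm
  rw [memLp_two_iff_integrable_sq hmeas]
  have h1 : IntegrableOn (fun x => g.inner x (X x) (X x)) ((extChartAt (𝓡 n) c).symm '' L)
      (vol g) := by
    refine (hX.2.integrableOn.mul_continuousOn
      (hΨ.inv₀ fun x => (hΨ0 x).ne').continuousOn hLc).congr_fun (fun x _ => ?_)
      hLc.measurableSet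
    have := (hΨ0 x).ne'
    simp only [Pi.inv_apply]
    field_simp
  have h2 := contDiffOn_comp_extChartAt_symm (n := n) (c := c) le_rfl
    (contMDiffOn_inner g (contMDiffOn_chartField c v) (contMDiffOn_chartField c v))
  refine ((integrableOn_comp_symm hL hLT h1).mul_continuousOn
    (h2.continuousOn.mono hLT) hL).mono' (hmeas.pow 2) ?_
  filter_upwards [ae_restrict_mem hL.measurableSet] with y hy
  rw [Real.norm_eq_abs, abs_of_nonneg (sq_nonneg _),
    chartPairing_eq_inner_chartField g X v (hLT hy)]
  exact sq_inner_le g _ _ _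

theorem MemVecL2.memLp_coord_mul [T2Space M] (hΨ : Continuous Ψ) (hΨ0 : ∀ x, 0 < Ψ x)
    {X : VField n M} (hX : MemVecL2 g Ψ X) (c : M) (i : Fin n)
    {L : Set (EuclideanSpace ℝ (Fin n))} (hL : IsCompact L)
    (hLT : L ⊆ (extChartAt (𝓡 n) c).target) {a : EuclideanSpace ℝ (Fin n) → ℝ}
    (ha : ContinuousOn a L) :
    MemLp (fun y => coord c X y i * a y) 2 (volume.restrict L) := by
  refine MemLp.mul_continuousOn_of_isCompact ?_ hL ha
  refine (memLp_finsetSum Finset.univ fun j _ =>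
    (hX.memLp_chartPairing hΨ hΨ0 c (EuclideanSpace.single j 1) hL hLT).mul_continuousOn_of_isCompact
    hL ((contDiffOn_matrix_inv (fun i j => contDiffOn_gram g c i j)
      (fun y hy => (det_gram_pos g hy).ne') j i).continuousOn.mono hLT)).ae_eq ?_
  filter_upwards [ae_restrict_mem hL.measurableSet] with y hy
  exact (coord_eq_sum_chartPairing g X (hLT hy) i).symm

end

section

variable {n : ℕ} {M : Type*} [TopologicalSpace M] [ChartedSpace (EuclideanSpace ℝ (Fin n)) M]
  [IsManifold (𝓡 n) ∞ M]

/-! ### Testing with truncations -/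

/-- The integrand of the weak inequality for `q`, tested formally with `p(f) χ`, where `X` is the
gradient of `f`. -/
noncomputable def truncatedIntegrand (g : RiemMetric n M) (Ψ q f : M → ℝ) (X : VField n M)
    (p : ℝ → ℝ) (χ : M → ℝ) (x : M) : ℝ :=
  Ψ x * (deriv p (f x) * χ x * g.inner x (X x) (X x) +
    p (f x) * (g.inner x (X x) (grad g χ x) + q x * f x * χ x))

variable [MeasurableSpace M] [BorelSpace M]

theorem truncatedIntegrand_add (g : RiemMetric n M) (Ψ q f : M → ℝ) (X : VField n M)
    (p : ℝ → ℝ) {φ χ : M → ℝ} (hφ : φ ∈ testFunctions n M) (hχ : χ ∈ testFunctions n M) (x : M) :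
    truncatedIntegrand g Ψ q f X p (φ + χ) x =
      truncatedIntegrand g Ψ q f X p φ x + truncatedIntegrand g Ψ q f X p χ x := by
  have h := inner_grad_add g hφ hχ X x
  rw [g.symm x _ (X x), g.symm x (grad g φ x) (X x), g.symm x (grad g χ x) (X x)] at h
  simp only [truncatedIntegrand, h, Pi.add_apply]
  ring

theorem truncatedIntegrand_eq_zero (g : RiemMetric n M) (Ψ q f : M → ℝ) (X : VField n M)
    (p : ℝ → ℝ) {χ : M → ℝ} {x : M} (hx : x ∉ tsupport χ) :
    truncatedIntegrand g Ψ q f X p χ x = 0 := by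
  simp only [truncatedIntegrand, image_eq_zero_of_notMem_tsupport hx,
    grad_eq_zero_of_notMem_tsupport g hx, map_zero]
  ring

variable {g : RiemMetric n M} {Ψ q f : M → ℝ} {X : VField n M} {p : ℝ → ℝ} {C : ℝ}

/-- Boundedness of `p` and `p'` is what matters: the first term is a bounded function times `Ψ
|X|²`, the second a bounded function times an integrable one. -/
theorem integrable_truncatedIntegrand [T2Space M] [SecondCountableTopology M]
    (hΨ : Continuous Ψ) (hΨ0 : ∀ x, 0 < Ψ x) (hq : Continuous q)
    (hf : AEStronglyMeasurable f (vol g)) (hf' : ∀ K, IsCompact K → IntegrableOn f K (vol g))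
    (hX : MemVecL2 g Ψ X) (hp : ContDiff ℝ ∞ p) (hpC : ∀ t, |p t| ≤ C)
    (hpC' : ∀ t, |deriv p t| ≤ C) {χ : M → ℝ} (hχ : χ ∈ testFunctions n M) :
    Integrable (truncatedIntegrand g Ψ q f X p χ) (vol g) := by
  have hX2 := ((memVecL2_iff hΨ hΨ0).1 hX).2
  obtain ⟨B, hB⟩ := hχ.2.exists_bound_of_continuous hχ.1.continuous
  have h1 : Integrable (fun x => (deriv p (f x) * χ x) * (Ψ x * g.inner x (X x) (X x)))
      (vol g) := by
    refine hX2.bdd_mul (c := C * B) (((hp.continuous_deriv (by simp)).comp_aestronglyMeasurable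
      hf).mul hχ.1.continuous.aestronglyMeasurable) (Eventually.of_forall fun x => ?_)
    rw [norm_mul]
    exact mul_le_mul (hpC' _) (hB x) (norm_nonneg _) ((abs_nonneg _).trans (hpC' 0))
  have h2 : Integrable (fun x => Ψ x * g.inner x (X x) (grad g χ x) + f x * (Ψ x * q x * χ x))
      (vol g) :=
    (hX.integrable_inner hΨ hΨ0 (memVecL2_grad hΨ hΨ0 hχ)).add
      ((hf' _ hχ.2).integrable_mul_of_support hχ.2
        ((hΨ.mul hq).mul hχ.1.continuous).continuousOn fun x hx => by
          simp [image_eq_zero_of_notMem_tsupport hx])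
  have h3 := h2.bdd_mul (hp.continuous.comp_aestronglyMeasurable hf)
    (Eventually.of_forall fun x => hpC (f x))
  refine (h1.add h3).congr (Eventually.of_forall fun x => ?_)
  simp only [truncatedIntegrand, Pi.add_apply]
  ring

theorem truncated_mem_testFunctions {c : M} (hp : ContDiff ℝ ∞ p)
    {F : EuclideanSpace ℝ (Fin n) → ℝ} (hF : ContDiff ℝ ∞ F) {χ : M → ℝ}
    (hχ : χ ∈ testFunctions n M) (hχc : tsupport χ ⊆ (extChartAt (𝓡 n) c).source) :
    (fun x => p (chartExtend c F x) * χ x) ∈ testFunctions n M := by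
  have hsub : tsupport (fun x => p (chartExtend c F x) * χ x) ⊆ tsupport χ :=
    closure_mono fun x hx h0 => hx (by simp only [h0, mul_zero])
  refine ⟨contMDiff_of_tsupport_subset (isOpen_extChartAt_source c) ?_ (hsub.trans hχc),
    hχ.2.mul_left⟩
  refine ContMDiffOn.mul ?_ hχ.1.contMDiffOn
  refine (contMDiff_iff_contDiff.2 (hp.comp hF)).comp_contMDiffOn
    (contMDiffOn_extChartAt_source c) |>.congr fun x hx => ?_
  rw [chartExtend_of_mem hx]
  rfl

theorem inner_grad_truncated (g : RiemMetric n M) (X : VField n M) {c : M} (hp : ContDiff ℝ ∞ p)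
    {F : EuclideanSpace ℝ (Fin n) → ℝ} (hF : ContDiff ℝ ∞ F) {χ : M → ℝ}
    (hχ : χ ∈ testFunctions n M) (hχc : tsupport χ ⊆ (extChartAt (𝓡 n) c).source)
    {y : EuclideanSpace ℝ (Fin n)} (hy : y ∈ (extChartAt (𝓡 n) c).target) :
    g.inner ((extChartAt (𝓡 n) c).symm y) (X ((extChartAt (𝓡 n) c).symm y))
        (grad g (fun x => p (chartExtend c F x) * χ x) ((extChartAt (𝓡 n) c).symm y)) =
      deriv p (F y) * χ ((extChartAt (𝓡 n) c).symm y) * fderiv ℝ F y (coord c X y) +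
      p (F y) * g.inner ((extChartAt (𝓡 n) c).symm y) (X ((extChartAt (𝓡 n) c).symm y))
        (grad g χ ((extChartAt (𝓡 n) c).symm y)) := by
  have hT := isOpen_extChartAt_target (I := 𝓡 n) c
  have hψ := truncated_mem_testFunctions hp hF hχ hχc
  rw [g.symm, inner_grad_eq_fderiv g hy ((hψ.1 _).mdifferentiableAt (by simp)),
    g.symm _ (X _), inner_grad_eq_fderiv g hy ((hχ.1 _).mdifferentiableAt (by simp))]
  have h1 : (fun x => p (chartExtend c F x) * χ x) ∘ (extChartAt (𝓡 n) c).symm =ᶠ[𝓝 y]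
      fun z => p (F z) * (χ ∘ (extChartAt (𝓡 n) c).symm) z := by
    filter_upwards [hT.mem_nhds hy] with z hz
    simp only [Function.comp_apply, chartExtend_symm hz]
  have h2 : HasFDerivAt (χ ∘ (extChartAt (𝓡 n) c).symm)
      (fderiv ℝ (χ ∘ (extChartAt (𝓡 n) c).symm) y) y :=
    (((contDiffOn_comp_extChartAt_symm le_rfl hχ.1.contMDiffOn).contDiffAt
      (hT.mem_nhds hy)).differentiableAt (by simp)).hasFDerivAt
  have h3 : HasFDerivAt (fun z => p (F z)) (deriv p (F y) • fderiv ℝ F y) y :=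
    ((hp.differentiable (by simp) _).hasDerivAt).comp_hasFDerivAt y
      (hF.differentiable (by simp) y).hasFDerivAt
  rw [h1.fderiv_eq, (h3.fun_mul h2).fderiv]
  simp only [add_apply, smul_apply, smul_eq_mul, Function.comp_apply]
  ring

/-- As `f` is only a Sobolev function, `p(f) χ` is not an admissible test function. In the chart `f`
is approximated by smooth `F j`; each `p (F j) χ` is admissible and nonnegative, and the inequality
survives the limit because the other factors, `f` and `X`, are kept fixed. -/
theorem truncated_inequality_of_tsupport_subset [T2Space M] [SecondCountableTopology M]
    (hΨ : Continuous Ψ) (hΨ0 : ∀ x, 0 < Ψ x) (hq : Continuous q)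
    (hf' : ∀ K, IsCompact K → IntegrableOn f K (vol g))
    (hX : HasL2Grad g Ψ f X)
    (hweak : ∀ ψ ∈ testFunctions n M, (∀ x, 0 ≤ ψ x) →
      0 ≤ ∫ x, Ψ x * (g.inner x (X x) (grad g ψ x) + q x * f x * ψ x) ∂(vol g))
    (hp : ContDiff ℝ ∞ p) (hp0 : ∀ t, 0 ≤ p t) (hpC : ∀ t, |p t| ≤ C)
    (hpC' : ∀ t, |deriv p t| ≤ C) {χ : M → ℝ} (hχ : χ ∈ testFunctions n M) (hχ0 : ∀ x, 0 ≤ χ x)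
    {c : M} (hχc : tsupport χ ⊆ (extChartAt (𝓡 n) c).source) :
    0 ≤ ∫ x, truncatedIntegrand g Ψ q f X p χ x ∂(vol g) := by
  have hT := isOpen_extChartAt_target (I := 𝓡 n) c
  set K := extChartAt (𝓡 n) c '' tsupport χ with hKdef
  have hK : IsCompact K := isCompact_image_extChartAt hχ.2 hχc
  have hKT : K ⊆ (extChartAt (𝓡 n) c).target := image_extChartAt_subset hχc
  have hnotK : ∀ y ∈ (extChartAt (𝓡 n) c).target \ K,
      (extChartAt (𝓡 n) c).symm y ∉ tsupport χ := fun y hy h =>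
    hy.2 ⟨_, h, (extChartAt (𝓡 n) c).right_inv hy.1⟩
  have hcs : ContinuousOn (extChartAt (𝓡 n) c).symm K :=
    (continuousOn_extChartAt_symm c).mono hKT
  have hwK : ContinuousOn (volDensity g c) K := (contDiffOn_volDensity g c).continuousOn.mono hKT
  -- The integrand is sorted by how it depends on the approximant: `d`, multiplied by the
  -- coordinates of `X`, is the coefficient of the derivative terms, while `a` collects everything
  -- multiplied by the value of `p`.
  set d : EuclideanSpace ℝ (Fin n) → ℝ := fun y => χ ((extChartAt (𝓡 n) c).symm y) *
    Ψ ((extChartAt (𝓡 n) c).symm y) * volDensity g c y with hd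
  have hdK : ContinuousOn d K := ((hχ.1.continuous.comp_continuousOn hcs).mul
    (hΨ.comp_continuousOn hcs)).mul hwK
  set a : EuclideanSpace ℝ (Fin n) → ℝ := fun y => (Ψ ((extChartAt (𝓡 n) c).symm y) *
    (g.inner ((extChartAt (𝓡 n) c).symm y) (X ((extChartAt (𝓡 n) c).symm y))
      (grad g χ ((extChartAt (𝓡 n) c).symm y)) +
      q ((extChartAt (𝓡 n) c).symm y) * f ((extChartAt (𝓡 n) c).symm y) *
      χ ((extChartAt (𝓡 n) c).symm y))) * volDensity g c y with ha
  have haK : IntegrableOn a K volume := by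
    have h1 : Integrable (fun x => Ψ x * (g.inner x (X x) (grad g χ x) + q x * f x * χ x))
        (vol g) := by
      refine ((hX.1.integrable_inner hΨ hΨ0 (memVecL2_grad hΨ hΨ0 hχ)).add
        ((hf' _ hχ.2).integrable_mul_of_support hχ.2
        ((hΨ.mul hq).mul hχ.1.continuous).continuousOn fun x hx => by
          simp [image_eq_zero_of_notMem_tsupport hx])).congr (Eventually.of_forall fun x => ?_)
      simp only [Pi.add_apply, Pi.mul_apply]
      ring
    exact ((integrableOn_source_iff g c _).1 h1.integrableOn).mono_set hKT
  obtain ⟨F, hF, hlim⟩ := exists_contDiff_tendsto_setIntegral hT hK hKT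
    (f := fun y => f ((extChartAt (𝓡 n) c).symm y))
    (D := fun i : Fin n => chartPairing g X c (EuclideanSpace.single i 1))
    (fun i => EuclideanSpace.single i 1)
    (fun L hLT hL => integrableOn_comp_symm hL hLT
      (hf' _ (isCompact_image_extChartAt_symm hL hLT)))
    (fun i L hLT hL => hX.1.memLp_chartPairing hΨ hΨ0 c _ hL hLT)
    (fun i u hu hucs huT => hX.integral_mul_fderiv c _ hu hucs huT)
    hp.continuous (hp.continuous_deriv (by simp)) hpC hpC' haK
    (fun i => hX.1.memLp_coord_mul hΨ hΨ0 c i hK hKT hdK)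
  have hsrc : ∀ x ∉ (extChartAt (𝓡 n) c).source, x ∉ tsupport χ := fun x hx h => hx (hχc h)
  have hval : ∫ x, truncatedIntegrand g Ψ q f X p χ x ∂(vol g) =
      ∫ y in K, (deriv p (f ((extChartAt (𝓡 n) c).symm y)) *
        ∑ i, chartPairing g X c (EuclideanSpace.single i 1) y * (coord c X y i * d y)) +
        p (f ((extChartAt (𝓡 n) c).symm y)) * a y := by
    rw [integral_eq_of_support_subset g c
      (fun x hx => truncatedIntegrand_eq_zero g Ψ q f X p (hsrc x hx)),
      setIntegral_eq_of_subset_of_forall_sdiff_eq_zero hT.measurableSet hKT (fun y hy => by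
        rw [truncatedIntegrand_eq_zero g Ψ q f X p (hnotK y hy), zero_mul])]
    refine setIntegral_congr_fun hK.measurableSet fun y hy => ?_
    -- In the limit the derivatives of `F j` become the covariant components of `X`, and their
    -- contraction with the coordinates of `X` is `|X|²`.
    have h1 := sum_chartPairing_mul_coord g X X (hKT hy)
    have h2 : ∑ i, chartPairing g X c (EuclideanSpace.single i 1) y * (coord c X y i * d y) =
        g.inner ((extChartAt (𝓡 n) c).symm y) (X ((extChartAt (𝓡 n) c).symm y))
          (X ((extChartAt (𝓡 n) c).symm y)) * d y := by
      rw [← h1, Finset.sum_mul]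
      exact Finset.sum_congr rfl fun i _ => by ring
    simp only [h2]
    simp only [truncatedIntegrand, ha, hd]
    ring
  rw [hval]
  refine ge_of_tendsto' hlim fun j => ?_
  have hψ := truncated_mem_testFunctions hp (hF j) hχ hχc
  have h := hweak _ hψ fun x => mul_nonneg (hp0 _) (hχ0 x)
  have hψsub : tsupport (fun x => p (chartExtend c (F j) x) * χ x) ⊆ tsupport χ :=
    closure_mono fun x hx h0 => hx (by simp only [h0, mul_zero])
  have hz : ∀ x ∉ tsupport χ, Ψ x * (g.inner x (X x)
      (grad g (fun x => p (chartExtend c (F j) x) * χ x) x) +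
      q x * f x * (p (chartExtend c (F j) x) * χ x)) = 0 := fun x hx => by
    rw [grad_eq_zero_of_notMem_tsupport g fun h => hx (hψsub h),
      image_eq_zero_of_notMem_tsupport hx, map_zero]
    ring
  rw [integral_eq_of_support_subset g c (fun x hx => hz x (hsrc x hx)),
    setIntegral_eq_of_subset_of_forall_sdiff_eq_zero hT.measurableSet hKT (fun y hy => by
      rw [hz _ (hnotK y hy), zero_mul])] at h
  refine h.trans_eq (setIntegral_congr_fun hK.measurableSet fun y hy => ?_)
  have h1 : ∑ i, fderiv ℝ (F j) y (EuclideanSpace.single i 1) * (coord c X y i * d y) =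
      fderiv ℝ (F j) y (coord c X y) * d y := by
    rw [← EuclideanSpace.sum_mul_apply_single, Finset.sum_mul]
    exact Finset.sum_congr rfl fun i _ => by ring
  simp only [h1]
  rw [inner_grad_truncated g X hp (hF j) hχ hχc (hKT hy), chartExtend_symm (hKT hy)]
  simp only [ha, hd]
  ring

/-- The weak inequality may be tested with `p(f) χ`. -/
theorem truncated_inequality [T2Space M] [SecondCountableTopology M]
    (hΨ : Continuous Ψ) (hΨ0 : ∀ x, 0 < Ψ x) (hq : Continuous q)
    (hf : AEStronglyMeasurable f (vol g)) (hf' : ∀ K, IsCompact K → IntegrableOn f K (vol g))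
    (hX : HasL2Grad g Ψ f X)
    (hweak : ∀ ψ ∈ testFunctions n M, (∀ x, 0 ≤ ψ x) →
      0 ≤ ∫ x, Ψ x * (g.inner x (X x) (grad g ψ x) + q x * f x * ψ x) ∂(vol g))
    (hp : ContDiff ℝ ∞ p) (hp0 : ∀ t, 0 ≤ p t) (hpC : ∀ t, |p t| ≤ C)
    (hpC' : ∀ t, |deriv p t| ≤ C) {χ : M → ℝ} (hχ : χ ∈ testFunctions n M)
    (hχ0 : ∀ x, 0 ≤ χ x) : 0 ≤ ∫ x, truncatedIntegrand g Ψ q f X p χ x ∂(vol g) := by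
  refine testFunctions_induction
    (P := fun χ => 0 ≤ ∫ x, truncatedIntegrand g Ψ q f X p χ x ∂(vol g)) ?_ ?_ hχ ?_
  · have h : ∀ x, truncatedIntegrand g Ψ q f X p 0 x = 0 := fun x =>
      truncatedIntegrand_eq_zero g Ψ q f X p (by simp [tsupport])
    simp only [h, integral_zero, le_refl]
  · intro φ hφ χ hχ h1 h2
    simp only [truncatedIntegrand_add g Ψ q f X p hφ hχ]
    rw [integral_add (integrable_truncatedIntegrand hΨ hΨ0 hq hf hf' hX.1 hp hpC hpC' hφ)
      (integrable_truncatedIntegrand hΨ hΨ0 hq hf hf' hX.1 hp hpC hpC' hχ)]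
    exact add_nonneg h1 h2
  · intro c a ha ha0 hac
    exact truncated_inequality_of_tsupport_subset hΨ hΨ0 hq hf' hX hweak hp hp0 hpC hpC'
      (mul_mem_testFunctions ha hχ) (fun x => mul_nonneg (ha0 x) (hχ0 x)) hac

end

/-! ### Cutoff functions on the line -/

/-- A rescaled `Real.smoothTransition`. Its derivative is bounded because it is continuous on `[a,
b]` and vanishes outside. -/
theorem exists_smooth_step {a b : ℝ} (hab : a < b) : ∃ q : ℝ → ℝ, ContDiff ℝ ∞ q ∧
    (∀ t, 0 ≤ q t) ∧ (∀ t, q t ≤ 1) ∧ (∀ t ≤ a, q t = 0) ∧ (∀ t, a < t → 0 < q t) ∧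
    (∀ t, b ≤ t → q t = 1) ∧ (∀ t, 0 ≤ deriv q t) ∧ ∃ C, ∀ t, |deriv q t| ≤ C := by
  have hba : 0 < b - a := sub_pos.2 hab
  have hq : ContDiff ℝ ∞ fun t : ℝ => Real.smoothTransition ((t - a) / (b - a)) :=
    Real.smoothTransition.contDiff.comp ((contDiff_id.sub contDiff_const).div_const _)
  have h0 : ∀ t ≤ a, Real.smoothTransition ((t - a) / (b - a)) = 0 := fun t ht =>
    Real.smoothTransition.zero_of_nonpos (div_nonpos_of_nonpos_of_nonneg (by linarith) hba.le)
  have h1 : ∀ t, b ≤ t → Real.smoothTransition ((t - a) / (b - a)) = 1 := fun t ht =>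
    Real.smoothTransition.one_of_one_le ((one_le_div hba).2 (by linarith))
  refine ⟨_, hq, fun t => Real.smoothTransition.nonneg _, fun t => Real.smoothTransition.le_one _,
    h0, fun t ht => Real.smoothTransition.pos_of_pos (div_pos (by linarith) hba), h1,
    fun t => Monotone.deriv_nonneg fun s t hst =>
      Real.smoothTransition.monotone (div_le_div_of_nonneg_right (by linarith) hba.le), ?_⟩
  obtain ⟨C, hC⟩ := (isCompact_Icc (a := a) (b := b)).exists_bound_of_continuousOn
    (hq.continuous_deriv (by simp)).continuousOn
  refine ⟨C, fun t => ?_⟩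
  have hC0 : 0 ≤ C := (norm_nonneg _).trans (hC a ⟨le_rfl, hab.le⟩)
  rcases lt_or_ge t a with hta | hta
  · have h : (fun t : ℝ => Real.smoothTransition ((t - a) / (b - a))) =ᶠ[𝓝 t] fun _ => 0 := by
      filter_upwards [Iio_mem_nhds hta] with s hs using h0 s (le_of_lt hs)
    rw [h.deriv_eq, deriv_const, abs_zero]
    exact hC0
  rcases le_or_gt t b with htb | htb
  · exact hC t ⟨hta, htb⟩
  · have h : (fun t : ℝ => Real.smoothTransition ((t - a) / (b - a))) =ᶠ[𝓝 t] fun _ => 1 := by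
      filter_upwards [Ioi_mem_nhds htb] with s hs using h1 s (le_of_lt hs)
    rw [h.deriv_eq, deriv_const, abs_zero]
    exact hC0

/-- Convergence in L¹ implies convergence in measure, and hence convergence almost everywhere along
a subsequence. -/
theorem _root_.MeasureTheory.exists_seq_tendsto_zero_of_tendsto_integral {X : Type*}
    [MeasurableSpace X] {μ : Measure X} {F : ℕ → X → ℝ} (hF : ∀ k, Integrable (F k) μ)
    (h0 : ∀ k x, 0 ≤ F k x) (hlim : Tendsto (fun k => ∫ x, F k x ∂μ) atTop (𝓝 0)) :
    ∃ ns : ℕ → ℕ, ∀ᵐ x ∂μ, Tendsto (fun i => F (ns i) x) atTop (𝓝 0) := by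
  have h : TendstoInMeasure μ F atTop (0 : X → ℝ) := by
    refine tendstoInMeasure_of_tendsto_eLpNorm one_ne_zero (fun k => (hF k).1)
      aestronglyMeasurable_zero ?_
    have h1 : ∀ k, eLpNorm (F k - 0) 1 μ = ENNReal.ofReal (∫ x, F k x ∂μ) := fun k => by
      rw [sub_zero, eLpNorm_one_eq_lintegral_enorm,
        ← ofReal_integral_norm_eq_lintegral_enorm (hF k)]
      simp only [Real.norm_of_nonneg (h0 k _)]
    simp only [h1]
    simpa using ENNReal.tendsto_ofReal hlim
  obtain ⟨ns, -, hns⟩ := h.exists_seq_tendsto_ae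
  exact ⟨ns, hns⟩

section

variable {n : ℕ} {M : Type*} [TopologicalSpace M] [ChartedSpace (EuclideanSpace ℝ (Fin n)) M]
  [IsManifold (𝓡 n) ∞ M]

theorem comp_mem_testFunctions {q : ℝ → ℝ} (hq : ContDiff ℝ ∞ q) (hq0 : q 0 = 0) {φ : M → ℝ}
    (hφ : φ ∈ testFunctions n M) : q ∘ φ ∈ testFunctions n M :=
  ⟨(contMDiff_iff_contDiff.2 hq).comp hφ.1, hφ.2.comp_left hq0⟩

theorem inner_grad_comp (g : RiemMetric n M) {q : ℝ → ℝ} (hq : ContDiff ℝ ∞ q) {φ : M → ℝ}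
    (hφ : φ ∈ testFunctions n M) (X : VField n M) (x : M) :
    g.inner x (X x) (grad g (q ∘ φ) x) = deriv q (φ x) * g.inner x (X x) (grad g φ x) := by
  rw [g.symm, g.symm x (X x), inner_grad, inner_grad]
  have h1 : HasMFDerivAt 𝓘(ℝ, ℝ) 𝓘(ℝ, ℝ) q (φ x)
      (ContinuousLinearMap.toSpanSingleton ℝ (deriv q (φ x))) :=
    ((hq.differentiable (by simp) (φ x)).hasDerivAt).hasFDerivAt.hasMFDerivAt
  have h2 := h1.comp x ((hφ.1 x).mdifferentiableAt (by simp)).hasMFDerivAt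
  rw [h2.mfderiv]
  exact mul_comm _ _

variable [MeasurableSpace M] [BorelSpace M] {g : RiemMetric n M} {Ψ : M → ℝ}

/-! ### Approximation by test functions -/

theorem weakGrad_spec {f : M → ℝ} (h : ∃ X, HasL2Grad g Ψ f X) :
    HasL2Grad g Ψ f (weakGrad g Ψ f) := by
  rw [weakGrad, dif_pos h]
  exact h.choose_spec

/-- The divergence theorem identifies the weak gradient of a test function with its classical one;
the rest is linearity, for which each integral must be shown to exist. -/
theorem HasL2Grad.sub_grad [T2Space M] [SecondCountableTopology M] (hΨ : Continuous Ψ)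
    (hΨ0 : ∀ x, 0 < Ψ x) {h : M → ℝ} (hh : ∀ K, IsCompact K → IntegrableOn h K (vol g))
    {X : VField n M} (hX : HasL2Grad g Ψ h X) {φ : M → ℝ} (hφ : φ ∈ testFunctions n M) :
    HasL2Grad g Ψ (h - φ) (X - grad g φ) := by
  refine ⟨hX.1.sub hΨ hΨ0 (memVecL2_grad hΨ hΨ0 hφ), fun Y hY => ?_⟩
  have h1 := hX.neg_integral_mul_div hY
  have h2 := integral_mul_div g hY.1 hφ
  have hdiv : ∀ x ∉ closure {x | Y x ≠ 0}, div g Y x = 0 := fun x hx =>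
    div_eq_zero_of_eventuallyEq g (by
      filter_upwards [isClosed_closure.isOpen_compl.mem_nhds hx] with z hz
      by_contra h0
      exact hz (subset_closure h0))
  have i1 : Integrable (fun x => h x * div g Y x) (vol g) :=
    (hh _ hY.2).integrable_mul_of_support hY.2 (continuous_div g hY.1).continuousOn hdiv
  have i2 : Integrable (fun x => φ x * div g Y x) (vol g) :=
    (hφ.1.continuous.mul (continuous_div g hY.1)).continuousOn.integrable_of_tsupport_subset hφ.2
      fun x hx => by simp [image_eq_zero_of_notMem_tsupport hx]
  have hY0 : ∀ x ∉ closure {x | Y x ≠ 0}, Y x = 0 := fun x hx => by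
    by_contra h0
    exact hx (subset_closure h0)
  have hYL := memVecL2_of_contMDiff (g := g) continuous_const (fun _ => one_pos) hY.1 hY.2 hY0
  have i3 : Integrable (fun x => g.inner x (grad g φ x) (Y x)) (vol g) := by
    simpa using (memVecL2_grad (g := g) (Ψ := fun _ => 1) continuous_const (fun _ => one_pos)
      hφ).integrable_inner continuous_const (fun _ => one_pos) hYL
  have i4 : Integrable (fun x => g.inner x (X x) (Y x)) (vol g) := by
    have hΨY := memVecL2_of_contMDiff (g := g) hΨ hΨ0 hY.1 hY.2 hY0
    have i5 := hX.1.integrable_inner hΨ hΨ0 hΨY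
    refine (integrableOn_iff_integrable_of_support_subset (s := closure {x | Y x ≠ 0})
      fun x hx => ?_).1 ((i5.integrableOn.mul_continuousOn
      (hΨ.inv₀ fun x => (hΨ0 x).ne').continuousOn hY.2).congr_fun (fun x _ => ?_)
      isClosed_closure.measurableSet)
    · by_contra h0
      exact hx (by simp only [hY0 x h0, map_zero])
    · have := (hΨ0 x).ne'
      simp only [Pi.inv_apply]
      field_simp
  simp only [distGrad, toDist, toFieldDist, Pi.sub_apply, sub_mul, inner_sub_left]
  rw [integral_sub i1 i2, integral_sub i4 i3, h1, h2]
  ring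

/-- The norm of W¹ involves a chosen weak gradient `Z` of `h - φ`, not `X - ∇φ`. Both pair equally
with the test field `Ψ ∇φ`, so `∫ Ψ |∇φ|² = ∫ Ψ ⟨X - Z, ∇φ⟩`, and Young's inequality absorbs half of
the left side. Uniqueness of weak gradients is thus not needed. -/
theorem integral_inner_grad_le [T2Space M] [SecondCountableTopology M]
    (hΨ : ContMDiff (𝓡 n) 𝓘(ℝ, ℝ) ∞ Ψ) (hΨ0 : ∀ x, 0 < Ψ x) {h : M → ℝ}
    (hh : ∀ K, IsCompact K → IntegrableOn h K (vol g)) {X Z : VField n M}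
    (hX : HasL2Grad g Ψ h X) {φ : M → ℝ} (hφ : φ ∈ testFunctions n M)
    (hZ : HasL2Grad g Ψ (h - φ) Z) :
    ∫ x, Ψ x * g.inner x (grad g φ x) (grad g φ x) ∂(vol g) ≤
      2 * (∫ x, Ψ x * g.inner x (X x) (X x) ∂(vol g)) +
        2 * ∫ x, Ψ x * g.inner x (Z x) (Z x) ∂(vol g) := by
  have hΨc := hΨ.continuous
  have h1 := (hX.sub_grad hΨc hΨ0 hh hφ).integral_mul_div_grad hΨ hφ
  rw [hZ.integral_mul_div_grad hΨ hφ] at h1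
  have hφL := memVecL2_grad (g := g) hΨc hΨ0 hφ
  have iX := ((memVecL2_iff hΨc hΨ0).1 hX.1).2
  have iZ := ((memVecL2_iff hΨc hΨ0).1 hZ.1).2
  have iφ := ((memVecL2_iff hΨc hΨ0).1 hφL).2
  have iXφ := hX.1.integrable_inner hΨc hΨ0 hφL
  have iZφ := hZ.1.integrable_inner hΨc hΨ0 hφL
  have h2 : ∫ x, Ψ x * g.inner x ((X - grad g φ) x) (grad g φ x) ∂(vol g) =
      (∫ x, Ψ x * g.inner x (X x) (grad g φ x) ∂(vol g)) -
        ∫ x, Ψ x * g.inner x (grad g φ x) (grad g φ x) ∂(vol g) := by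
    rw [← integral_sub iXφ iφ]
    refine integral_congr_ae (Eventually.of_forall fun x => ?_)
    simp only [Pi.sub_apply, inner_sub_left, mul_sub]
  have h3 : 2 * ∫ x, Ψ x * g.inner x (grad g φ x) (grad g φ x) ∂(vol g) =
      ∫ x, 2 * (Ψ x * g.inner x (X x) (grad g φ x) - Ψ x * g.inner x (Z x) (grad g φ x))
        ∂(vol g) := by
    rw [integral_const_mul, integral_sub iXφ iZφ]
    linarith
  have h4 : 2 * ∫ x, Ψ x * g.inner x (grad g φ x) (grad g φ x) ∂(vol g) ≤
      ∫ x, (2 * (Ψ x * g.inner x (X x) (X x)) + 2 * (Ψ x * g.inner x (Z x) (Z x))) +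
        Ψ x * g.inner x (grad g φ x) (grad g φ x) ∂(vol g) := by
    rw [h3]
    refine integral_mono ((iXφ.sub iZφ).const_mul 2)
      (((iX.const_mul 2).add (iZ.const_mul 2)).add iφ) fun x => ?_
    have e1 := two_mul_inner_le g x (-1) (X x - Z x) (grad g φ x)
    have e2 := inner_sub_self_le g x (X x) (Z x)
    have e3 := inner_sub_left g x (X x) (Z x) (grad g φ x)
    have e4 : 2 * (g.inner x (X x) (grad g φ x) - g.inner x (Z x) (grad g φ x)) ≤
        2 * g.inner x (X x) (X x) + 2 * g.inner x (Z x) (Z x) +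
          g.inner x (grad g φ x) (grad g φ x) := by linarith
    have e5 := mul_le_mul_of_nonneg_left e4 (hΨ0 x).le
    simp only
    linarith
  rw [integral_add ((iX.const_mul 2).fun_add (iZ.const_mul 2)) iφ,
    integral_add (iX.const_mul 2) (iZ.const_mul 2), integral_const_mul, integral_const_mul] at h4
  linarith

/-- Functions in `W¹₀` are limits almost everywhere of test functions with bounded energy. -/
theorem exists_testFunctions_tendsto [T2Space M] [SecondCountableTopology M]
    (hΨ : ContMDiff (𝓡 n) 𝓘(ℝ, ℝ) ∞ Ψ) (hΨ0 : ∀ x, 0 < Ψ x) {σ : M → ℝ} (hσ : Continuous σ)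
    (hσ0 : ∀ x, 0 < σ x) {h : M → ℝ} (hh : h ∈ W10 g Ψ σ) :
    ∃ (φ : ℕ → M → ℝ) (B : ℝ), (∀ k, φ k ∈ testFunctions n M) ∧
      (∀ k, ∫ x, Ψ x * g.inner x (grad g (φ k) x) (grad g (φ k) x) ∂(vol g) ≤ B) ∧
      ∀ᵐ x ∂(vol g), Tendsto (fun k => φ k x) atTop (𝓝 (h x)) := by
  have hΨc := hΨ.continuous
  obtain ⟨⟨hL2, X, hX⟩, happrox⟩ := hh
  have hloc : ∀ K, IsCompact K → IntegrableOn h K (vol g) := fun K hK =>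
    integrableOn_of_memLp hΨc hΨ0 hσ hσ0 hL2 hK
  have hpos : ∀ k : ℕ, (0 : ℝ) < 1 / (k + 1) := fun k => by positivity
  choose φ hφ hφlt using fun k : ℕ => happrox (1 / (k + 1)) (hpos k)
  have hZ : ∀ k, HasL2Grad g Ψ (h - φ k) (weakGrad g Ψ (h - φ k)) := fun k =>
    weakGrad_spec ⟨_, hX.sub_grad hΨc hΨ0 hloc (hφ k)⟩
  set Z : ℕ → VField n M := fun k => weakGrad g Ψ (h - φ k) with hZdef
  have hsum : ∀ k, (∫ x, Ψ x * g.inner x (Z k x) (Z k x) ∂(vol g)) +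
      ∫ x, Ψ x * ((h - φ k) x ^ 2 * σ x) ∂(vol g) < 1 / ((k : ℝ) + 1) := fun k => by
    have h1 := (Real.sqrt_lt' (hpos k)).1 (hφlt k)
    rw [weightedMeasure, integral_densityMeasure hΨc.measurable (fun x => (hΨ0 x).le),
      integral_densityMeasure hΨc.measurable (fun x => (hΨ0 x).le)] at h1
    refine h1.trans_le ?_
    -- Undoing the square root gives the bound `(1 / (k + 1))²`, which is weakened to `1 / (k + 1)`.
    have h2 : (1 : ℝ) / (k + 1) ≤ 1 := by
      rw [div_le_one (by positivity)]
      linarith [(Nat.cast_nonneg k : (0 : ℝ) ≤ k)]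
    rw [sq]
    exact mul_le_of_le_one_right (hpos k).le h2
  have hn1 : ∀ k, 0 ≤ ∫ x, Ψ x * g.inner x (Z k x) (Z k x) ∂(vol g) := fun k =>
    integral_nonneg fun x => mul_nonneg (hΨ0 x).le (inner_self_nonneg g x _)
  have hn2' : ∀ k x, 0 ≤ Ψ x * ((h - φ k) x ^ 2 * σ x) := fun k x =>
    mul_nonneg (hΨ0 x).le (mul_nonneg (sq_nonneg _) (hσ0 x).le)
  have hn2 : ∀ k, 0 ≤ ∫ x, Ψ x * ((h - φ k) x ^ 2 * σ x) ∂(vol g) := fun k =>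
    integral_nonneg (hn2' k)
  have hint : ∀ k, Integrable (fun x => Ψ x * ((h - φ k) x ^ 2 * σ x)) (vol g) := fun k => by
    have i1 := integrable_sq_of_memLp hΨc hΨ0 hσ hσ0 hL2
    have i2 : Integrable (fun x => h x * (Ψ x * σ x * φ k x)) (vol g) :=
      (hloc _ (hφ k).2).integrable_mul_of_support (hφ k).2
        ((hΨc.mul hσ).mul (hφ k).1.continuous).continuousOn
        fun x hx => by simp [image_eq_zero_of_notMem_tsupport hx]
    have i3 : Integrable (fun x => Ψ x * σ x * φ k x ^ 2) (vol g) :=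
      ((hΨc.mul hσ).mul ((hφ k).1.continuous.pow 2)).continuousOn.integrable_of_tsupport_subset
        (hφ k).2 fun x hx => by simp [image_eq_zero_of_notMem_tsupport hx]
    refine ((i1.sub (i2.const_mul 2)).add i3).congr (Eventually.of_forall fun x => ?_)
    simp only [Pi.add_apply, Pi.sub_apply]
    ring
  have hlim : Tendsto (fun k => ∫ x, Ψ x * ((h - φ k) x ^ 2 * σ x) ∂(vol g)) atTop (𝓝 0) :=
    squeeze_zero hn2 (fun k => by linarith [hsum k, hn1 k]) tendsto_one_div_add_atTop_nhds_zero_nat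
  obtain ⟨ns, hns⟩ := exists_seq_tendsto_zero_of_tendsto_integral hint hn2' hlim
  -- The summand 2 in the energy bound comes from `∫ Ψ |Z|² < 1 / (k + 1) ≤ 1`.
  refine ⟨fun i => φ (ns i), 2 * (∫ x, Ψ x * g.inner x (X x) (X x) ∂(vol g)) + 2,
    fun i => hφ _, fun i => ?_, ?_⟩
  · have h1 := integral_inner_grad_le hΨ hΨ0 hloc hX (hφ (ns i)) (hZ (ns i))
    have h2 : (1 : ℝ) / (ns i + 1) ≤ 1 := by
      rw [div_le_one (by positivity)]
      linarith [(Nat.cast_nonneg (ns i) : (0 : ℝ) ≤ ns i)]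
    have h3 := hsum (ns i)
    have h4 := hn2 (ns i)
    simp only [hZdef] at h3
    linarith
  · filter_upwards [hns] with x hx
    have hc : 0 < Ψ x * σ x := mul_pos (hΨ0 x) (hσ0 x)
    have h1 : Tendsto (fun i => (h - φ (ns i)) x ^ 2) atTop (𝓝 0) := by
      have h2 := hx.const_mul (Ψ x * σ x)⁻¹
      rw [mul_zero] at h2
      refine h2.congr fun i => ?_
      have h3 := (hΨ0 x).ne'
      have h4 := (hσ0 x).ne'
      field_simp
    have h5 : Tendsto (fun i => |(h - φ (ns i)) x|) atTop (𝓝 0) := by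
      have h6 := h1.sqrt
      simpa only [Real.sqrt_sq_eq_abs, Real.sqrt_zero] using h6
    have h7 := (tendsto_zero_iff_abs_tendsto_zero _).2 h5
    have h8 := h7.const_sub (h x)
    simpa using h8

end

section

variable {n : ℕ} {M : Type*} [TopologicalSpace M] [ChartedSpace (EuclideanSpace ℝ (Fin n)) M]
  [IsManifold (𝓡 n) ∞ M]

/-! ### The maximum principle -/

/-- Young's inequality with a free parameter. The small factor goes to `w`, later the gradient of `φ
k`, whose energy is merely bounded; the large factor goes to a term that vanishes in the limit. -/
theorem two_mul_mul_inner_le (g : RiemMetric n M) (x : M) {δ : ℝ} (hδ : 0 < δ) (s : ℝ)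
    (v w : TangentSpace (𝓡 n) x) :
    2 * (s * g.inner x v w) ≤ δ * g.inner x w w + δ⁻¹ * (s ^ 2 * g.inner x v v) := by
  have h := two_mul_inner_le g x (-(s / δ)) w v
  rw [g.symm x w v] at h
  have h1 : 2 * (s / δ) * g.inner x v w ≤ g.inner x w w + (s / δ) ^ 2 * g.inner x v v := by
    linarith
  have h2 := mul_le_mul_of_nonneg_left h1 hδ.le
  calc 2 * (s * g.inner x v w) = δ * (2 * (s / δ) * g.inner x v w) := by field_simp
    _ ≤ _ := h2
    _ = _ := by field_simp

variable [MeasurableSpace M] [BorelSpace M] {g : RiemMetric n M} {Ψ q f h : M → ℝ}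
  {X : VField n M}

/-- The bound obtained from the weak inequality, tested with `p(f) r(φ)`. -/
theorem two_mul_integral_le [T2Space M] [SecondCountableTopology M]
    (hΨ : Continuous Ψ) (hΨ0 : ∀ x, 0 < Ψ x) (hq : Continuous q)
    (hf : AEStronglyMeasurable f (vol g)) (hf' : ∀ K, IsCompact K → IntegrableOn f K (vol g))
    (hX : HasL2Grad g Ψ f X)
    (hweak : ∀ ψ ∈ testFunctions n M, (∀ x, 0 ≤ ψ x) →
      0 ≤ ∫ x, Ψ x * (g.inner x (X x) (grad g ψ x) + q x * f x * ψ x) ∂(vol g))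
    {p r : ℝ → ℝ} {C C' : ℝ} (hp : ContDiff ℝ ∞ p) (hp0 : ∀ t, 0 ≤ p t) (hpC : ∀ t, |p t| ≤ C)
    (hpC' : ∀ t, |deriv p t| ≤ C) (hp' : ∀ t, deriv p t ≤ 0)
    (hr : ContDiff ℝ ∞ r) (hr0 : ∀ t, 0 ≤ r t) (hr00 : r 0 = 0) (hrC' : ∀ t, |deriv r t| ≤ C')
    {φ : M → ℝ} (hφ : φ ∈ testFunctions n M) {δ : ℝ} (hδ : 0 < δ) :
    2 * ∫ x, Ψ x * (q x * -(f x * p (f x))) * r (φ x) ∂(vol g) ≤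
      δ * (∫ x, Ψ x * g.inner x (grad g φ x) (grad g φ x) ∂(vol g)) +
      δ⁻¹ * ∫ x, (p (f x) * deriv r (φ x)) ^ 2 * (Ψ x * g.inner x (X x) (X x)) ∂(vol g) := by
  have hχ := comp_mem_testFunctions hr hr00 hφ
  have h0 := truncated_inequality hΨ hΨ0 hq hf hf' hX hweak hp hp0 hpC hpC' hχ fun x => hr0 _
  have i0 := integrable_truncatedIntegrand (q := q) hΨ hΨ0 hq hf hf' hX.1 hp hpC hpC' hχ
  have i1 := ((memVecL2_iff hΨ hΨ0).1 (memVecL2_grad (g := g) hΨ hΨ0 hφ)).2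
  have iX := ((memVecL2_iff hΨ hΨ0).1 hX.1).2
  have i2 : Integrable (fun x => (p (f x) * deriv r (φ x)) ^ 2 * (Ψ x * g.inner x (X x) (X x)))
      (vol g) := by
    refine iX.bdd_mul (c := (C * C') ^ 2) (((hp.continuous.comp_aestronglyMeasurable hf).mul
      ((hr.continuous_deriv (by simp)).comp hφ.1.continuous).aestronglyMeasurable).pow 2)
      (Eventually.of_forall fun x => ?_)
    rw [norm_pow, norm_mul]
    exact pow_le_pow_left₀ (by positivity) (mul_le_mul (hpC _) (hrC' _) (abs_nonneg _)
      ((abs_nonneg _).trans (hpC 0))) 2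
  have i3 : Integrable (fun x => Ψ x * (q x * -(f x * p (f x))) * r (φ x)) (vol g) := by
    have i4 : Integrable (fun x => f x * (Ψ x * q x * r (φ x))) (vol g) :=
      (hf' _ hχ.2).integrable_mul_of_support hχ.2
        ((hΨ.mul hq).mul hχ.1.continuous).continuousOn fun x hx => by
          have := image_eq_zero_of_notMem_tsupport hx
          simp only [Function.comp_apply] at this
          simp [this]
    refine ((i4.bdd_mul (hp.continuous.comp_aestronglyMeasurable hf)
      (Eventually.of_forall fun x => hpC (f x))).neg).congr (Eventually.of_forall fun x => ?_)
    simp only [Pi.neg_apply]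
    ring
  -- Adding the nonnegative truncated integral makes the zero-order terms cancel pointwise. There
  -- remain the term with `p'`, which has the favourable sign, and the mixed term, to which Young's
  -- inequality applies.
  have h1 : 2 * ((∫ x, Ψ x * (q x * -(f x * p (f x))) * r (φ x) ∂(vol g)) +
      ∫ x, truncatedIntegrand g Ψ q f X p (r ∘ φ) x ∂(vol g)) ≤
      δ * (∫ x, Ψ x * g.inner x (grad g φ x) (grad g φ x) ∂(vol g)) +
      δ⁻¹ * ∫ x, (p (f x) * deriv r (φ x)) ^ 2 * (Ψ x * g.inner x (X x) (X x)) ∂(vol g) := by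
    rw [← integral_add i3 i0, ← integral_const_mul, ← integral_const_mul, ← integral_const_mul,
      ← integral_add (i1.const_mul δ) (i2.const_mul δ⁻¹)]
    refine integral_mono ((i3.add i0).const_mul 2) ((i1.const_mul δ).add (i2.const_mul δ⁻¹))
      fun x => ?_
    have e1 := two_mul_mul_inner_le g x hδ (p (f x) * deriv r (φ x)) (X x) (grad g φ x)
    have e2 : deriv p (f x) * r (φ x) * g.inner x (X x) (X x) ≤ 0 :=
      mul_nonpos_of_nonpos_of_nonneg (mul_nonpos_of_nonpos_of_nonneg (hp' _) (hr0 _))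
        (inner_self_nonneg g x _)
    have e3 := mul_le_mul_of_nonneg_left (add_le_add e1 (mul_nonpos_of_nonneg_of_nonpos
      zero_le_two e2)) (hΨ0 x).le
    simp only [truncatedIntegrand, inner_grad_comp g hr hφ X x, Function.comp_apply]
    linarith
  linarith

/-- The boundary condition enters only through the values of the approximants: where `f < -ε`,
eventually `φ k > ε`, so the cutoff `r (φ k)` is locally constant in its argument and the mixed
gradient term disappears. -/
theorem ae_neg_le_of_nonnegMod [T2Space M] [SecondCountableTopology M]
    (hΨ : Continuous Ψ) (hΨ0 : ∀ x, 0 < Ψ x) (hq : Continuous q) (hq0 : ∀ x, 0 < q x)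
    (hf : AEStronglyMeasurable f (vol g)) (hf' : ∀ K, IsCompact K → IntegrableOn f K (vol g))
    (hf2 : Integrable (fun x => Ψ x * (q x * f x ^ 2)) (vol g))
    (hX : HasL2Grad g Ψ f X)
    (hweak : ∀ ψ ∈ testFunctions n M, (∀ x, 0 ≤ ψ x) →
      0 ≤ ∫ x, Ψ x * (g.inner x (X x) (grad g ψ x) + q x * f x * ψ x) ∂(vol g))
    {φ : ℕ → M → ℝ} {B : ℝ} (hφ : ∀ k, φ k ∈ testFunctions n M)
    (hB : ∀ k, ∫ x, Ψ x * g.inner x (grad g (φ k) x) (grad g (φ k) x) ∂(vol g) ≤ B)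
    (hlim : ∀ᵐ x ∂(vol g), Tendsto (fun k => φ k x) atTop (𝓝 (h x)))
    (hfh : ∀ᵐ x ∂(vol g), 0 ≤ f x + h x) {ε : ℝ} (hε : 0 < ε) :
    ∀ᵐ x ∂(vol g), -ε ≤ f x := by
  -- The two steps meet at `ε`: `r` has reached 1 there, and `s`, reflected to give `p`, only starts
  -- to be positive beyond it.
  obtain ⟨r, hr, hr0, hr1, hrz, -, hrone, -, Cr, hCr⟩ := exists_smooth_step hε
  obtain ⟨s, hs, hs0, hs1, hsz, hspos, -, hsd, Cs, hCs⟩ :=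
    exists_smooth_step (show ε < 2 * ε by linarith)
  set p : ℝ → ℝ := fun t => s (-t) with hpdef
  have hp : ContDiff ℝ ∞ p := hs.comp contDiff_neg
  have hpd : ∀ t, deriv p t = -deriv s (-t) := fun t => deriv_comp_neg s t
  have hp0 : ∀ t, 0 ≤ p t := fun t => hs0 _
  have hpz : ∀ t, -ε ≤ t → p t = 0 := fun t ht => hsz _ (by linarith)
  have hpC : ∀ t, |p t| ≤ max 1 Cs := fun t => by
    rw [abs_of_nonneg (hp0 t)]
    exact (hs1 _).trans (le_max_left _ _)
  have hpC' : ∀ t, |deriv p t| ≤ max 1 Cs := fun t => by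
    rw [hpd, abs_neg]
    exact (hCs _).trans (le_max_right _ _)
  have hp' : ∀ t, deriv p t ≤ 0 := fun t => by
    rw [hpd]
    linarith [hsd (-t)]
  have hfp : ∀ t, 0 ≤ -(t * p t) := fun t => by
    rcases le_or_gt (-ε) t with ht | ht
    · rw [hpz t ht]
      simp
    · have := mul_nonneg (show 0 ≤ -t by linarith) (hp0 t)
      linarith
  -- Where `p` is nonzero one has `|t| > ε`, so `|t| ≤ ε⁻¹ t²`. This makes `F` integrable although
  -- `f` itself is only known to be square integrable.
  have hfp2 : ∀ t, -(t * p t) ≤ ε⁻¹ * t ^ 2 := fun t => by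
    rcases le_or_gt (-ε) t with ht | ht
    · rw [hpz t ht]
      have : 0 ≤ ε⁻¹ * t ^ 2 := by positivity
      linarith
    · have h1 : -t * p t ≤ -t * 1 := mul_le_mul_of_nonneg_left (hs1 _) (by linarith)
      have h2 : -t ≤ ε⁻¹ * t ^ 2 := by
        rw [inv_mul_eq_div, le_div_iff₀ hε]
        nlinarith
      linarith
  set F : M → ℝ := fun x => Ψ x * (q x * -(f x * p (f x))) with hF
  have hF0 : ∀ x, 0 ≤ F x := fun x =>
    mul_nonneg (hΨ0 x).le (mul_nonneg (hq0 x).le (hfp _))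
  have hFm : AEStronglyMeasurable F (vol g) := hΨ.aestronglyMeasurable.mul
    (hq.aestronglyMeasurable.mul (hf.mul (hp.continuous.comp_aestronglyMeasurable hf)).neg)
  have hFi : Integrable F (vol g) := by
    refine (hf2.const_mul ε⁻¹).mono' hFm (Eventually.of_forall fun x => ?_)
    rw [Real.norm_of_nonneg (hF0 x)]
    have := mul_le_mul_of_nonneg_left (hfp2 (f x)) (mul_pos (hΨ0 x) (hq0 x)).le
    simp only [hF]
    linarith
  have iX := ((memVecL2_iff hΨ hΨ0).1 hX.1).2
  -- If `f x < -ε`, then `h x ≥ -f x > ε`, so `φ k x` eventually lies in the open half-line where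
  -- `r` is constantly 1.
  have hcase : ∀ᵐ x ∂(vol g), p (f x) = 0 ∨
      (∀ᶠ k in atTop, r (φ k x) = 1 ∧ deriv r (φ k x) = 0) := by
    filter_upwards [hlim, hfh] with x hx1 hx2
    rcases le_or_gt (-ε) (f x) with ht | ht
    · exact Or.inl (hpz _ ht)
    · right
      filter_upwards [hx1.eventually (Ioi_mem_nhds (show ε < h x by linarith))] with k hk
      have hev : r =ᶠ[𝓝 (φ k x)] fun _ => 1 := by
        filter_upwards [Ioi_mem_nhds hk] with t ht' using hrone t (le_of_lt ht')
      exact ⟨hev.self_of_nhds, by rw [hev.deriv_eq, deriv_const]⟩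
  have hlim1 : Tendsto (fun k => ∫ x, F x * r (φ k x) ∂(vol g)) atTop
      (𝓝 (∫ x, F x ∂(vol g))) := by
    refine tendsto_integral_of_dominated_convergence F (fun k => hFm.mul
      (hr.continuous.comp (hφ k).1.continuous).aestronglyMeasurable) hFi
      (fun k => Eventually.of_forall fun x => ?_) ?_
    · rw [Real.norm_of_nonneg (mul_nonneg (hF0 x) (hr0 _))]
      exact mul_le_of_le_one_right (hF0 x) (hr1 _)
    · filter_upwards [hcase] with x hx
      rcases hx with hx | hx
      · have : F x = 0 := by simp [hF, hx]
        simp [this]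
      · refine tendsto_const_nhds.congr' ?_
        filter_upwards [hx] with k hk
        rw [hk.1, mul_one]
  have hlim2 : Tendsto (fun k => ∫ x, (p (f x) * deriv r (φ k x)) ^ 2 *
      (Ψ x * g.inner x (X x) (X x)) ∂(vol g)) atTop (𝓝 0) := by
    rw [← integral_zero M ℝ (μ := vol g)]
    refine tendsto_integral_of_dominated_convergence
      (fun x => (max 1 Cs * Cr) ^ 2 * (Ψ x * g.inner x (X x) (X x)))
      (fun k => (((hp.continuous.comp_aestronglyMeasurable hf).mul
        ((hr.continuous_deriv (by simp)).comp (hφ k).1.continuous).aestronglyMeasurable).pow 2).mul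
        iX.1) (iX.const_mul _) (fun k => Eventually.of_forall fun x => ?_) ?_
    · have hnn : 0 ≤ Ψ x * g.inner x (X x) (X x) :=
        mul_nonneg (hΨ0 x).le (inner_self_nonneg g x _)
      rw [norm_mul, Real.norm_of_nonneg hnn, norm_pow, norm_mul]
      exact mul_le_mul_of_nonneg_right (pow_le_pow_left₀ (by positivity) (mul_le_mul (hpC _)
        (hCr _) (abs_nonneg _) (by positivity)) 2) hnn
    · filter_upwards [hcase] with x hx
      rcases hx with hx | hx
      · simp [hx]
      · refine tendsto_const_nhds.congr' ?_
        filter_upwards [hx] with k hk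
        rw [hk.2]
        ring
  -- The order of the limits matters: `k → ∞` at fixed `δ` removes the term with `δ⁻¹`, and only
  -- then does `δ` tend to zero.
  have hbound : ∀ δ : ℝ, 0 < δ → 2 * ∫ x, F x ∂(vol g) ≤ δ * B := fun δ hδ => by
    have h1 := (hlim2.const_mul δ⁻¹).const_add (δ * B)
    rw [mul_zero, add_zero] at h1
    refine le_of_tendsto_of_tendsto' (hlim1.const_mul 2) h1 fun k => ?_
    have h2 := two_mul_integral_le hΨ hΨ0 hq hf hf' hX hweak hp hp0 hpC hpC' hp' hr hr0
      (hrz 0 le_rfl) hCr (hφ k) hδ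
    have h3 := mul_le_mul_of_nonneg_left (hB k) hδ.le
    linarith
  have hzero : ∫ x, F x ∂(vol g) = 0 := by
    refine le_antisymm ?_ (integral_nonneg hF0)
    have h1 : Tendsto (fun δ : ℝ => δ * B) (𝓝[>] 0) (𝓝 (0 * B)) :=
      ((continuous_id.mul continuous_const).tendsto 0).mono_left nhdsWithin_le_nhds
    have h2 : 2 * ∫ x, F x ∂(vol g) ≤ 0 * B :=
      ge_of_tendsto h1 (eventually_mem_nhdsWithin.mono fun δ hδ => hbound δ hδ)
    linarith
  have hFae := (integral_eq_zero_iff_of_nonneg hF0 hFi).1 hzero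
  filter_upwards [hFae] with x hx
  by_contra! hlt
  have h1 : 0 < p (f x) := hspos _ (by linarith)
  have h2 : 0 < F x := mul_pos (hΨ0 x) (mul_pos (hq0 x) (by nlinarith))
  exact h2.ne' hx

end
end WeightedManifold

/-! ### The elliptic maximum principle -/

theorem mainTheorem11 {n : ℕ} {M : Type*} [TopologicalSpace M]
    [ChartedSpace (EuclideanSpace ℝ (Fin n)) M] [IsManifold (𝓡 n) ∞ M]
    [T2Space M] [SecondCountableTopology M] [ConnectedSpace M]
    [MeasurableSpace M] [BorelSpace M]
    (g : WeightedManifold.RiemMetric n M) (Ψ ρ V : M → ℝ)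
    (hΨ : ContMDiff (𝓡 n) 𝓘(ℝ, ℝ) ∞ Ψ) (hΨ_pos : ∀ x, 0 < Ψ x)
    (hρ : ContMDiff (𝓡 n) 𝓘(ℝ, ℝ) ∞ ρ) (hρ_pos : ∀ x, 0 < ρ x)
    (hV : ContMDiff (𝓡 n) 𝓘(ℝ, ℝ) ∞ V) (hV_nonneg : ∀ x, 0 ≤ V x)
    (f : M → ℝ) (hf : f ∈ WeightedManifold.W1 g Ψ (ρ + V))
    (hbd : WeightedManifold.NonnegMod g Ψ (ρ + V) f)
    (α : ℝ) (hα : 0 < α)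
    (hsup : WeightedManifold.DistNonneg n
      (α • WeightedManifold.toDist g f
        - WeightedManifold.schrodinger g Ψ ρ V (WeightedManifold.toDist g f))) :
    ∀ᵐ x ∂(WeightedManifold.weightedMeasure g Ψ), 0 ≤ f x := by
  obtain ⟨hfL, X, hX⟩ := hf
  obtain ⟨h, hh, hfh⟩ := hbd
  have hσ : Continuous (ρ + V) := hρ.continuous.add hV.continuous
  have hσ0 : ∀ x, 0 < (ρ + V) x := fun x => add_pos_of_pos_of_nonneg (hρ_pos x) (hV_nonneg x)
  have hΨc := hΨ.continuous
  have hq : Continuous fun x => α * ρ x + V x :=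
    (continuous_const.mul hρ.continuous).add hV.continuous
  have hq0 : ∀ x, 0 < α * ρ x + V x := fun x =>
    add_pos_of_pos_of_nonneg (mul_pos hα (hρ_pos x)) (hV_nonneg x)
  obtain ⟨φ, B, hφ, hB, hlim⟩ :=
    WeightedManifold.exists_testFunctions_tendsto hΨ hΨ_pos hσ hσ0 hh
  have hfm := WeightedManifold.aestronglyMeasurable_of_memLp hΨc hΨ_pos hσ hσ0 hfL
  have hf2 : MeasureTheory.Integrable (fun x => Ψ x * ((α * ρ x + V x) * f x ^ 2))
      (WeightedManifold.vol g) := by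
    refine ((WeightedManifold.integrable_sq_of_memLp hΨc hΨ_pos hσ hσ0 hfL).const_mul
      (max α 1)).mono' (hΨc.aestronglyMeasurable.mul (hq.aestronglyMeasurable.mul (hfm.pow 2)))
      (Filter.Eventually.of_forall fun x => ?_)
    -- The space W¹ carries the weight `ρ + V`, the weak inequality the coefficient `α ρ + V`; the
    -- constant `max α 1` compares them.
    have h1 : α * ρ x + V x ≤ max α 1 * (ρ + V) x := by
      have e1 := mul_le_mul_of_nonneg_right (le_max_left α 1) (hρ_pos x).le
      have e2 := mul_le_mul_of_nonneg_right (le_max_right α 1) (hV_nonneg x)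
      simp only [Pi.add_apply]
      linarith
    have h2 := mul_le_mul_of_nonneg_left h1 (mul_nonneg (hΨ_pos x).le (sq_nonneg (f x)))
    rw [Real.norm_of_nonneg (mul_nonneg (hΨ_pos x).le (mul_nonneg (hq0 x).le (sq_nonneg _)))]
    linarith
  -- A sequence of values of `ε` tending to zero, so that only countably many null sets are
  -- discarded.
  have hε : ∀ m : ℕ, ∀ᵐ x ∂(WeightedManifold.vol g), -(1 / ((m : ℝ) + 1)) ≤ f x := fun m =>
    WeightedManifold.ae_neg_le_of_nonnegMod hΨc hΨ_pos hq hq0 hfm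
      (fun K hK => WeightedManifold.integrableOn_of_memLp hΨc hΨ_pos hσ hσ0 hfL hK) hf2 hX
      (fun ψ hψ hψ0 => WeightedManifold.weak_inequality hΨ hΨ_pos hρ hρ_pos hV hV_nonneg hfL hX
        hsup hψ hψ0) hφ hB hlim
      ((WeightedManifold.ae_densityMeasure_iff hΨc.measurable hΨ_pos).1 hfh) (by positivity)
  refine (WeightedManifold.ae_densityMeasure_iff hΨc.measurable hΨ_pos).2 ?_
  filter_upwards [MeasureTheory.ae_all_iff.2 hε] with x hx
  have h1 : Filter.Tendsto (fun m : ℕ => -(1 / ((m : ℝ) + 1))) Filter.atTop (nhds (-0)) :=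
    tendsto_one_div_add_atTop_nhds_zero_nat.neg
  rw [neg_zero] at h1
  exact le_of_tendsto' h1 hx
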